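/- Let $F$ be a field. A depth-3 circuit over $F$ in $n$ variables is an expression $\sum_{i=1}^{k'} a_i\prod_{j=1}^{d_i}\ell_{ij}$ with $a_i\in F$ and $\ell_{ij}=b_0+\sum_{v=1}^n b_v x_v$ polynomials of degree at most $1$ over $F$; $k'$ is its top fan-in. It is set-multilinear if there is a partition of the variables $x_1,\dots,x_n$ into nonempty colors such that, for every $i$, the factors $\ell_{i1},\dots,\ell_{id_i}$ can be assigned pairwise distinct colors so that each factor contains variables of its own color only. Theorem. There are an absolute constant $A$ and a deterministic (whitebox) algorithm with the following property. For every field $F$ and all integers $n\ge 2$, $c\ge 1$, $k\ge 2$: given $c$ set-multilinear depth-3 circuits $C_1,\dots,C_c$ over $F$ in the same $n$ variables, each of top fan-in at most $k$ (the partitions may differ from circuit to circuit and are not part of the input), the algorithm decides whether the polynomial $C_1+\dots+C_c$ is zero, in at most $$n^{A\cdot 2^{c-1}\,n^{1-\epsilon}\,\log k},\qquad \epsilon:=1/2^{c-1},$$ steps. Here the algorithm is a single random access machine program, independent of $F,n,c,k$ and of the circuits, which performs field operations and tests for zero in $F$ as well as additions, subtractions and tests for zero of natural numbers at unit cost, and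 whose only field constants are $0$ and $1$. The input lists $n$, $c$, all fan-ins, and all scalars $a_i$ and coefficients of the linear polynomials $\ell_{ij}$ (including the zero coefficients). -/

import Mathlib

universe u

/-! Depth-three circuits -/

/-- A polynomial of degree at most one: `const + ∑ v, coeff v * x_v`. -/
structure AffineForm (F : Type*) (n : ℕ) where
  const : F
  coeff : Fin n → F

/-- The polynomial given by an affine form. -/
noncomputable def AffineForm.toPoly {F : Type*} [Field F] {n : ℕ} (L : AffineForm F n) :
    MvPolynomial (Fin n) F :=
  MvPolynomial.C L.const + ∑ v : Fin n, MvPolynomial.C (L.coeff v) * MvPolynomial.X v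

/-- A depth-three circuit `∑ i, scalar i * ∏ j, factor i j` in `n` variables. Its number of
product gates is `topFanin`, and `fanin i` is the number of inputs of the `i`-th product gate. -/
structure DepthThreeCircuit (F : Type*) (n : ℕ) where
  topFanin : ℕ
  scalar : Fin topFanin → F
  fanin : Fin topFanin → ℕ
  factor : (i : Fin topFanin) → Fin (fanin i) → AffineForm F n

namespace DepthThreeCircuit

/-- The polynomial computed by the circuit. -/
noncomputable def toPoly {F : Type*} [Field F] {n : ℕ} (C : DepthThreeCircuit F n) :
    MvPolynomial (Fin n) F :=
  ∑ i : Fin C.topFanin, MvPolynomial.C (C.scalar i) * ∏ j : Fin (C.fanin i), (C.factor i j).toPoly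

/-- Set-multilinear: one partition of the variables into colors serves all product gates, that is,
in each product gate distinct factors belong to distinct colors, and a factor contains variables
of its own color only. -/
def IsSetMultilinear {F : Type*} [Field F] {n : ℕ} (C : DepthThreeCircuit F n) : Prop :=
  ∃ P : Finpartition (Finset.univ : Finset (Fin n)),
    ∀ i : Fin C.topFanin, ∃ color : Fin (C.fanin i) → Finset (Fin n),
      Function.Injective color ∧
      (∀ j, color j ∈ P.parts) ∧
      (∀ j v, (C.factor i j).coeff v ≠ 0 → v ∈ color j)

end DepthThreeCircuit

/-! A random access machine over an arbitrary field -/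

/-- A configuration of the machine: registers and memory cells for natural numbers (`reg`, `mem`)
and for field elements (`freg`, `fmem`). A program names finitely many registers; memory is
addressed indirectly, through the content of a register. -/
structure RamState (F : Type*) where
  reg : ℕ → ℕ
  freg : ℕ → F
  mem : ℕ → ℕ
  fmem : ℕ → F

/-- Programs. They do not mention the field; its only constants available are `0` and `1`.
Natural numbers have addition and truncated subtraction, but no multiplication, at unit cost. -/
inductive RamProgram : Type where
  /-- do nothing -/
  | skip
  /-- `reg a := v` -/
  | set (a v : ℕ)
  /-- `reg a := reg b + reg d` -/
  | add (a b d : ℕ)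
  /-- `reg a := reg b - reg d` (truncated) -/
  | sub (a b d : ℕ)
  /-- `reg a := mem (reg b)` -/
  | load (a b : ℕ)
  /-- `mem (reg a) := reg b` -/
  | store (a b : ℕ)
  /-- `freg a := 0` -/
  | fzero (a : ℕ)
  /-- `freg a := 1` -/
  | fone (a : ℕ)
  /-- `freg a := freg b + freg d` -/
  | fadd (a b d : ℕ)
  /-- `freg a := freg b - freg d` -/
  | fsub (a b d : ℕ)
  /-- `freg a := freg b * freg d` -/
  | fmul (a b d : ℕ)
  /-- `freg a := (freg b)⁻¹`, with `0⁻¹ = 0` -/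
  | finv (a b : ℕ)
  /-- `freg a := fmem (reg b)` -/
  | fload (a b : ℕ)
  /-- `fmem (reg a) := freg b` -/
  | fstore (a b : ℕ)
  /-- run `p`, then `q` -/
  | seq (p q : RamProgram)
  /-- if `reg a = 0` run `p`, otherwise run `q` -/
  | ifz (a : ℕ) (p q : RamProgram)
  /-- if `freg a = 0` run `p`, otherwise run `q` -/
  | fifz (a : ℕ) (p q : RamProgram)
  /-- as long as `reg a ≠ 0` run `p` -/
  | loop (a : ℕ) (p : RamProgram)

/-- `p.Runs s s' t`: started in configuration `s`, the program `p` halts in configuration `s'`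
after exactly `t` steps. Every elementary instruction (in particular every field operation) and
every evaluation of a test is one step. -/
inductive RamProgram.Runs {F : Type*} [Field F] :
    RamProgram → RamState F → RamState F → ℕ → Prop where
  | skip (s : RamState F) : Runs .skip s s 1
  | set (s : RamState F) (a v : ℕ) :
      Runs (.set a v) s { s with reg := Function.update s.reg a v } 1
  | add (s : RamState F) (a b d : ℕ) :
      Runs (.add a b d) s { s with reg := Function.update s.reg a (s.reg b + s.reg d) } 1
  | sub (s : RamState F) (a b d : ℕ) :
      Runs (.sub a b d) s { s with reg := Function.update s.reg a (s.reg b - s.reg d) } 1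
  | load (s : RamState F) (a b : ℕ) :
      Runs (.load a b) s { s with reg := Function.update s.reg a (s.mem (s.reg b)) } 1
  | store (s : RamState F) (a b : ℕ) :
      Runs (.store a b) s { s with mem := Function.update s.mem (s.reg a) (s.reg b) } 1
  | fzero (s : RamState F) (a : ℕ) :
      Runs (.fzero a) s { s with freg := Function.update s.freg a 0 } 1
  | fone (s : RamState F) (a : ℕ) :
      Runs (.fone a) s { s with freg := Function.update s.freg a 1 } 1
  | fadd (s : RamState F) (a b d : ℕ) :
      Runs (.fadd a b d) s { s with freg := Function.update s.freg a (s.freg b + s.freg d) } 1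
  | fsub (s : RamState F) (a b d : ℕ) :
      Runs (.fsub a b d) s { s with freg := Function.update s.freg a (s.freg b - s.freg d) } 1
  | fmul (s : RamState F) (a b d : ℕ) :
      Runs (.fmul a b d) s { s with freg := Function.update s.freg a (s.freg b * s.freg d) } 1
  | finv (s : RamState F) (a b : ℕ) :
      Runs (.finv a b) s { s with freg := Function.update s.freg a (s.freg b)⁻¹ } 1
  | fload (s : RamState F) (a b : ℕ) :
      Runs (.fload a b) s { s with freg := Function.update s.freg a (s.fmem (s.reg b)) } 1
  | fstore (s : RamState F) (a b : ℕ) :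
      Runs (.fstore a b) s { s with fmem := Function.update s.fmem (s.reg a) (s.freg b) } 1
  | seq {p q : RamProgram} {s s₁ s₂ : RamState F} {t u : ℕ} :
      Runs p s s₁ t → Runs q s₁ s₂ u → Runs (.seq p q) s s₂ (t + u)
  | ifz_zero {a : ℕ} {p q : RamProgram} {s s₁ : RamState F} {t : ℕ} :
      s.reg a = 0 → Runs p s s₁ t → Runs (.ifz a p q) s s₁ (t + 1)
  | ifz_ne {a : ℕ} {p q : RamProgram} {s s₁ : RamState F} {t : ℕ} :
      s.reg a ≠ 0 → Runs q s s₁ t → Runs (.ifz a p q) s s₁ (t + 1)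
  | fifz_zero {a : ℕ} {p q : RamProgram} {s s₁ : RamState F} {t : ℕ} :
      s.freg a = 0 → Runs p s s₁ t → Runs (.fifz a p q) s s₁ (t + 1)
  | fifz_ne {a : ℕ} {p q : RamProgram} {s s₁ : RamState F} {t : ℕ} :
      s.freg a ≠ 0 → Runs q s s₁ t → Runs (.fifz a p q) s s₁ (t + 1)
  | loop_zero {a : ℕ} {p : RamProgram} {s : RamState F} :
      s.reg a = 0 → Runs (.loop a p) s s 1
  | loop_ne {a : ℕ} {p : RamProgram} {s s₁ s₂ : RamState F} {t u : ℕ} :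
      s.reg a ≠ 0 → Runs p s s₁ t → Runs (.loop a p) s₁ s₂ u → Runs (.loop a p) s s₂ (t + u + 1)

/-- The machine is deterministic: the final configuration and the running time are unique. -/
theorem RamProgram.Runs.unique {F : Type*} [Field F] {p : RamProgram} {s s₁ s₂ : RamState F}
    {t u : ℕ} (h : p.Runs s s₁ t) (h' : p.Runs s s₂ u) : s₁ = s₂ ∧ t = u := by
  induction h generalizing s₂ u with
  | seq _ _ ih₁ ih₂ =>
    cases h' with
    | seq g₁ g₂ =>
      obtain ⟨rfl, rfl⟩ := ih₁ g₁
      obtain ⟨rfl, rfl⟩ := ih₂ g₂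
      exact ⟨rfl, rfl⟩
  | ifz_zero h₀ _ ih =>
    cases h' with
    | ifz_zero _ g => obtain ⟨rfl, rfl⟩ := ih g; exact ⟨rfl, rfl⟩
    | ifz_ne g₀ _ => exact absurd h₀ g₀
  | ifz_ne h₀ _ ih =>
    cases h' with
    | ifz_zero g₀ _ => exact absurd g₀ h₀
    | ifz_ne _ g => obtain ⟨rfl, rfl⟩ := ih g; exact ⟨rfl, rfl⟩
  | fifz_zero h₀ _ ih =>
    cases h' with
    | fifz_zero _ g => obtain ⟨rfl, rfl⟩ := ih g; exact ⟨rfl, rfl⟩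
    | fifz_ne g₀ _ => exact absurd h₀ g₀
  | fifz_ne h₀ _ ih =>
    cases h' with
    | fifz_zero g₀ _ => exact absurd g₀ h₀
    | fifz_ne _ g => obtain ⟨rfl, rfl⟩ := ih g; exact ⟨rfl, rfl⟩
  | loop_zero h₀ =>
    cases h' with
    | loop_zero _ => exact ⟨rfl, rfl⟩
    | loop_ne g₀ _ _ => exact absurd h₀ g₀
  | loop_ne h₀ _ _ ih₁ ih₂ =>
    cases h' with
    | loop_zero g₀ => exact absurd g₀ h₀
    | loop_ne _ g₁ g₂ =>
      obtain ⟨rfl, rfl⟩ := ih₁ g₁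
      obtain ⟨rfl, rfl⟩ := ih₂ g₂
      exact ⟨rfl, rfl⟩
  | _ => cases h'; exact ⟨rfl, rfl⟩

/-! The input of an identity test for a sum of depth-three circuits -/

namespace DepthThreeCircuit

/-- The shape of a sum of circuits: the number of variables, the number of circuits, and for each
circuit its top fan-in followed by the fan-ins of its product gates. -/
def shapeCode {F : Type*} {n c : ℕ} (C : Fin c → DepthThreeCircuit F n) : List ℕ :=
  n :: c :: (List.ofFn fun l => (C l).topFanin :: List.ofFn (C l).fanin).flatten

/-- The field elements occurring in a sum of circuits, in reading order: for each circuit and each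
of its product gates the scalar, followed, for each factor of the gate, by the constant term and
the coefficients of all `n` variables. -/
def fieldCode {F : Type*} {n c : ℕ} (C : Fin c → DepthThreeCircuit F n) : List F :=
  (List.ofFn fun l => (List.ofFn fun i =>
    (C l).scalar i :: (List.ofFn fun j =>
      ((C l).factor i j).const :: List.ofFn ((C l).factor i j).coeff).flatten).flatten).flatten

/-- The initial configuration: the circuits are written into memory, from address `0` on; all
other cells and all registers are zero. -/
def inputState {F : Type*} [Field F] {n c : ℕ} (C : Fin c → DepthThreeCircuit F n) :
    RamState F where
  reg := fun _ => 0
  freg := fun _ => 0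
  mem := fun a => (shapeCode C).getD a 0
  fmem := fun a => (fieldCode C).getD a 0

end DepthThreeCircuit

/-! Merging two variables of a polynomial of small rank -/

theorem coeff_eq_zero_of_eval_pow_eq_zero {Ω : Type*} [Field Ω] {α : Ω}
    (hα : Function.Injective fun e : ℕ => α ^ e) {J : Finset ℕ} {w : ℕ} (hJ : J.card ≤ w)
    {c : ℕ → Ω} (h : ∀ e < w, ∑ j ∈ J, c j * (α ^ e) ^ j = 0) : ∀ j ∈ J, c j = 0 := by
  classical
  let φ : Fin J.card ≃ J := J.equivFin.symm
  have hinj : Function.Injective fun k : Fin J.card => α ^ (φ k : ℕ) := fun k k' hk =>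
    φ.injective (Subtype.ext (hα hk))
  have hz : (fun k => c (φ k)) = 0 := by
    refine Matrix.eq_zero_of_forall_pow_sum_mul_pow_eq_zero hinj fun i => ?_
    have h1 := h i (i.2.trans_le hJ)
    rw [← Finset.sum_coe_sort, ← Equiv.sum_comp φ] at h1
    rw [← h1]
    refine Finset.sum_congr rfl fun k _ => ?_
    rw [← pow_mul, ← pow_mul, mul_comm (i : ℕ)]
  intro j hj
  have := congrFun hz (φ.symm ⟨j, hj⟩)
  simpa using this

theorem card_le_of_antitriangular {Ω ι : Type*} [Field Ω] [Fintype ι] (g h : ι → ℕ → Ω)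
    {d : ℕ} {I : Finset ℕ} (hI : ∀ i ∈ I, i ≤ d)
    (hlow : ∀ i j, i + j < d → ∑ r, g r i * h r j = 0)
    (hdiag : ∀ i ∈ I, ∑ r, g r i * h r (d - i) ≠ 0) : I.card ≤ Fintype.card ι := by
  classical
  let R : I → ℕ → Ω := fun i => ∑ r, g r i • h r
  have hR : ∀ (i : I) j, R i j = ∑ r, g r i * h r j := fun i j => by simp [R]
  have hli : LinearIndependent Ω R := by
    rw [Fintype.linearIndependent_iff]
    intro x hx
    by_contra! hne
    have hs : (Finset.univ.filter fun i : I => x i ≠ 0).Nonempty := by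
      obtain ⟨i, hi⟩ := hne
      exact ⟨i, by simpa using hi⟩
    obtain ⟨m, hm, hmax⟩ := Finset.exists_max_image _ (fun i : I => (i : ℕ)) hs
    have hev := congrFun hx (d - m)
    rw [Finset.sum_apply, Finset.sum_eq_single m] at hev
    · simp only [Pi.smul_apply, hR, smul_eq_mul, Pi.zero_apply, mul_eq_zero] at hev
      rcases hev with h0 | h0
      · simp at hm; exact hm h0
      · exact hdiag m m.2 h0
    · intro b _ hb
      by_cases hb0 : x b = 0
      · simp [hb0]
      · have hle := hmax b (by simpa using hb0)
        have hlt : (b : ℕ) < m := lt_of_le_of_ne hle fun h => hb (Subtype.ext h)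
        have := hI m m.2
        simp [hR, hlow b (d - m) (by omega)]
    · simp
  have hspan : Set.range R ≤ Submodule.span Ω (↑(Finset.univ.image h) : Set (ℕ → Ω)) := by
    rintro _ ⟨i, rfl⟩
    refine Submodule.sum_mem _ fun r _ => Submodule.smul_mem _ _ (Submodule.subset_span ?_)
    simp
  have := linearIndependent_le_span_aux' R hli _ hspan
  simp only [Finset.coe_sort_coe, Fintype.card_coe] at this
  exact this.trans (Finset.card_image_le.trans_eq Finset.card_univ)

/-- A function of two variables that is a sum of at most `w` products of univariate polynomials
and that does not vanish identically does not vanish identically on the curve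
`t ↦ (p t, t * p t)`, where `p t = ∏ e < w, (t - α ^ e)`. -/
theorem exists_curve_ne_zero {Ω ι : Type*} [Field Ω] [Infinite Ω] [Fintype ι] {α : Ω}
    (hα : Function.Injective fun e : ℕ => α ^ e) {w : ℕ} (hw : Fintype.card ι ≤ w)
    (g h : ι → Polynomial Ω) {x y : Ω} (hxy : ∑ r, (g r).eval x * (h r).eval y ≠ 0) :
    ∃ τ : Ω, ∑ r, (g r).eval (∏ e ∈ Finset.range w, (τ - α ^ e)) *
      (h r).eval (τ * ∏ e ∈ Finset.range w, (τ - α ^ e)) ≠ 0 := by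
  classical
  by_contra! hcon
  let c : ℕ → ℕ → Ω := fun i j => ∑ r, (g r).coeff i * (h r).coeff j
  obtain ⟨B, hB⟩ : ∃ B, ∀ r, (g r).natDegree < B ∧ (h r).natDegree < B :=
    ⟨∑ r, ((g r).natDegree + (h r).natDegree) + 1, fun r => by
      have := Finset.single_le_sum (f := fun r => (g r).natDegree + (h r).natDegree)
        (fun _ _ => Nat.zero_le _) (Finset.mem_univ r)
      omega⟩
  have hexp : ∀ u v : Ω, ∑ r, (g r).eval u * (h r).eval v =
      ∑ i ∈ Finset.range B, ∑ j ∈ Finset.range B, c i j * (u ^ i * v ^ j) := by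
    intro u v
    have h1 : ∀ r, (g r).eval u * (h r).eval v =
        ∑ i ∈ Finset.range B, ∑ j ∈ Finset.range B,
          (g r).coeff i * (h r).coeff j * (u ^ i * v ^ j) := fun r => by
      rw [Polynomial.eval_eq_sum_range' (hB r).1, Polynomial.eval_eq_sum_range' (hB r).2,
        Finset.sum_mul_sum]
      refine Finset.sum_congr rfl fun i _ => Finset.sum_congr rfl fun j _ => by ring
    rw [Finset.sum_congr rfl fun r _ => h1 r, Finset.sum_comm]
    refine Finset.sum_congr rfl fun i _ => ?_
    rw [Finset.sum_comm]
    refine Finset.sum_congr rfl fun j _ => ?_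
    rw [Finset.sum_mul]
  have hcne : ∃ d i j, i + j = d ∧ c i j ≠ 0 := by
    by_contra! h0
    refine hxy ?_
    rw [hexp]
    refine Finset.sum_eq_zero fun i _ => Finset.sum_eq_zero fun j _ => ?_
    rw [h0 _ i j rfl, zero_mul]
  let d := Nat.find hcne
  obtain ⟨i₀, j₀, hij₀, hc₀⟩ : ∃ i j, i + j = d ∧ c i j ≠ 0 := Nat.find_spec hcne
  have hlow : ∀ i j, i + j < d → c i j = 0 := fun i j hij => by
    by_contra hc
    exact Nat.find_min hcne hij ⟨i, j, rfl, hc⟩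
  have hcB : ∀ i j, B ≤ i ∨ B ≤ j → c i j = 0 := by
    intro i j hij
    refine Finset.sum_eq_zero fun r _ => ?_
    rcases hij with hi | hj
    · rw [Polynomial.coeff_eq_zero_of_natDegree_lt ((hB r).1.trans_le hi), zero_mul]
    · rw [Polynomial.coeff_eq_zero_of_natDegree_lt ((hB r).2.trans_le hj), mul_zero]
  let p : Polynomial Ω := ∏ e ∈ Finset.range w, (Polynomial.X - Polynomial.C (α ^ e))
  have hp0 : p ≠ 0 := Finset.prod_ne_zero_iff.2 fun e _ => Polynomial.X_sub_C_ne_zero _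
  have hpev : ∀ τ, p.eval τ = ∏ e ∈ Finset.range w, (τ - α ^ e) := fun τ => by
    simp [p, Polynomial.eval_prod]
  let low : Polynomial Ω := ∑ i ∈ Finset.range B, ∑ j ∈ Finset.range B,
    if i + j = d then Polynomial.C (c i j) * Polynomial.X ^ j else 0
  let high : Polynomial Ω := ∑ i ∈ Finset.range B, ∑ j ∈ Finset.range B,
    if i + j = d then 0 else Polynomial.C (c i j) * p ^ (i + j - d - 1) * Polynomial.X ^ j
  have hzero : p ^ d * (low + p * high) = 0 := by
    refine Polynomial.funext fun τ => ?_
    rw [Polynomial.eval_zero, ← hcon τ, hexp]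
    simp only [low, high, Polynomial.eval_mul, Polynomial.eval_add, Polynomial.eval_finsetSum,
      Polynomial.eval_pow, Finset.mul_sum, ← Finset.sum_add_distrib]
    refine Finset.sum_congr rfl fun i _ => Finset.sum_congr rfl fun j _ => ?_
    rw [← hpev]
    split_ifs with hij
    · simp only [Polynomial.eval_mul, Polynomial.eval_C, Polynomial.eval_pow, Polynomial.eval_X,
        Polynomial.eval_zero]
      rw [← hij]; ring
    · simp only [Polynomial.eval_mul, Polynomial.eval_C, Polynomial.eval_pow, Polynomial.eval_X,
        Polynomial.eval_zero]
      rcases lt_or_ge (i + j) d with hlt | hge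
      · rw [hlow i j hlt]; ring
      · obtain ⟨k, hk⟩ : ∃ k, i + j = d + 1 + k := ⟨i + j - d - 1, by omega⟩
        have : i + j - d - 1 = k := by omega
        rw [this, mul_pow]
        have h2 : ∀ z : Ω, z ^ i * z ^ j = z ^ d * z * z ^ k := fun z => by
          rw [← pow_add, hk]; ring
        linear_combination (-(c i j * τ ^ j)) * h2 (p.eval τ)
  have hlz : low + p * high = 0 := (mul_eq_zero.1 hzero).resolve_left (pow_ne_zero _ hp0)
  have hlev : ∀ e < w, low.eval (α ^ e) = 0 := by
    intro e he
    have h1 := congrArg (Polynomial.eval (α ^ e)) hlz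
    have h2 : p.eval (α ^ e) = 0 := by
      rw [hpev]; exact Finset.prod_eq_zero (Finset.mem_range.2 he) (sub_self _)
    simpa [h2] using h1
  let I : Finset ℕ := (Finset.range (d + 1)).filter fun i => c i (d - i) ≠ 0
  have hIcard : I.card ≤ w := by
    refine (card_le_of_antitriangular (fun r => (g r).coeff) (fun r => (h r).coeff) (d := d)
      (fun i hi => ?_) hlow fun i hi => ?_).trans hw
    · simp [I] at hi; omega
    · exact (Finset.mem_filter.1 hi).2
  let J : Finset ℕ := I.image fun i => d - i
  have hJ : J.card ≤ w := Finset.card_image_le.trans hIcard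
  have hsum : ∀ v : Ω, low.eval v = ∑ j ∈ J, c (d - j) j * v ^ j := by
    intro v
    have h1 : low.eval v = ∑ i ∈ Finset.range B, ∑ j ∈ Finset.range B,
        if i + j = d then c i j * v ^ j else 0 := by
      simp only [low, Polynomial.eval_finsetSum]
      refine Finset.sum_congr rfl fun i _ => Finset.sum_congr rfl fun j _ => ?_
      split_ifs <;> simp
    rw [h1, Finset.sum_comm]
    have h2 : ∀ j ∈ Finset.range B, (∑ i ∈ Finset.range B,
        if i + j = d then c i j * v ^ j else 0) = if j ≤ d then c (d - j) j * v ^ j else 0 := by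
      intro j _
      split_ifs with hjd
      · by_cases hdB : d - j < B
        · rw [Finset.sum_eq_single (d - j)]
          · rw [if_pos (by omega)]
          · intro b _ hb; rw [if_neg (by omega)]
          · intro hn; exact absurd (Finset.mem_range.2 hdB) hn
        · rw [hcB (d - j) j (Or.inl (by omega)), zero_mul]
          refine Finset.sum_eq_zero fun i hi => ?_
          rw [if_neg]; simp at hi; omega
      · refine Finset.sum_eq_zero fun i hi => ?_
        rw [if_neg (by omega)]
    rw [Finset.sum_congr rfl h2, ← Finset.sum_filter]
    symm
    refine Finset.sum_subset_zero_on_sdiff ?_ ?_ fun _ _ => rfl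
    · intro j hj
      simp only [J, I, Finset.mem_image, Finset.mem_filter, Finset.mem_range] at hj
      obtain ⟨i, ⟨hi, hc⟩, rfl⟩ := hj
      simp only [Finset.mem_filter, Finset.mem_range]
      refine ⟨?_, by omega⟩
      by_contra hge
      exact hc (hcB _ _ (Or.inr (by omega)))
    · intro j hj
      simp only [J, I, Finset.mem_sdiff, Finset.mem_filter, Finset.mem_range, Finset.mem_image,
        not_exists, not_and] at hj
      by_contra hne
      refine hj.2 (d - j) ⟨by omega, ?_⟩ (by omega)
      intro h0
      rw [show d - (d - j) = j by omega] at h0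
      rw [h0, zero_mul] at hne
      exact hne rfl
  have hall := coeff_eq_zero_of_eval_pow_eq_zero hα hJ (c := fun j => c (d - j) j)
    fun e he => by rw [← hsum, hlev e he]
  have hmem : j₀ ∈ J := by
    simp only [J, I, Finset.mem_image, Finset.mem_filter, Finset.mem_range]
    exact ⟨i₀, ⟨by omega, by rwa [show d - i₀ = j₀ by omega]⟩, by omega⟩
  have h0 : c (d - j₀) j₀ = 0 := hall j₀ hmem
  rw [show d - j₀ = i₀ by omega] at h0
  exact hc₀ h0

/-! The generator -/

/-- The two polynomials merged by `exists_curve_ne_zero`. -/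
def curve {S : Type*} [CommRing S] (α : S) (w b : ℕ) (τ : S) : S :=
  (∏ e ∈ Finset.range w, (τ - α ^ e)) * if b = 0 then 1 else τ

/-- Iterated composition of curves along the binary digits of `m`, the highest of the `r` lowest
digits being the innermost. -/
def gen {S : Type*} [CommRing S] (α : S) (w : ℕ) : ℕ → ℕ → S → S
  | 0, _, τ => τ
  | r + 1, m, τ => gen α w r m (curve α w (m / 2 ^ r % 2) τ)

theorem map_curve {S T : Type*} [CommRing S] [CommRing T] (φ : S →+* T) (α : S) (w b : ℕ) (τ : S) :
    φ (curve α w b τ) = curve (φ α) w b (φ τ) := by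
  unfold curve
  split_ifs <;> simp [map_prod]

theorem map_gen {S T : Type*} [CommRing S] [CommRing T] (φ : S →+* T) (α : S) (w r m : ℕ) (τ : S) :
    φ (gen α w r m τ) = gen (φ α) w r m (φ τ) := by
  induction r generalizing τ with
  | zero => rfl
  | succ r ih => simp only [gen, ih, map_curve]

/-- The value of an affine form. -/
def AffineForm.value {F S : Type*} [Field F] [CommRing S] [Algebra F S] {n : ℕ}
    (L : AffineForm F n) (η : Fin n → S) : S :=
  algebraMap F S L.const + ∑ v, algebraMap F S (L.coeff v) * η v

theorem AffineForm.map_value {F S T : Type*} [Field F] [CommRing S] [Algebra F S] [CommRing T]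
    [Algebra F T] {n : ℕ} (φ : S →ₐ[F] T) (L : AffineForm F n) (η : Fin n → S) :
    φ (L.value η) = L.value fun v => φ (η v) := by
  simp [value]

/-- A function of two variables that is a sum of `m` products of univariate polynomials. -/
def HasRank {Ω : Type*} [Field Ω] (m : ℕ) (φ : Ω → Ω → Ω) : Prop :=
  ∃ g h : Fin m → Polynomial Ω, ∀ x y, φ x y = ∑ r, (g r).eval x * (h r).eval y

section HasRank
variable {Ω : Type*} [Field Ω]

theorem hasRank_one {φ : Ω → Ω → Ω} (g h : Polynomial Ω) (H : ∀ x y, φ x y = g.eval x * h.eval y) :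
    HasRank 1 φ := ⟨fun _ => g, fun _ => h, fun x y => by simp [H]⟩

theorem hasRank_left (g : Polynomial Ω) : HasRank 1 fun x _ => g.eval x :=
  hasRank_one g 1 fun x y => by simp

theorem hasRank_right (h : Polynomial Ω) : HasRank 1 fun _ y => h.eval y :=
  hasRank_one 1 h fun x y => by simp

theorem HasRank.mul {m m' : ℕ} {φ ψ : Ω → Ω → Ω} (hφ : HasRank m φ) (hψ : HasRank m' ψ) :
    HasRank (m * m') fun x y => φ x y * ψ x y := by
  obtain ⟨g, h, H⟩ := hφ
  obtain ⟨g', h', H'⟩ := hψ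
  refine ⟨fun r => g (finProdFinEquiv.symm r).1 * g' (finProdFinEquiv.symm r).2,
    fun r => h (finProdFinEquiv.symm r).1 * h' (finProdFinEquiv.symm r).2, fun x y => ?_⟩
  dsimp only
  rw [H, H', ← Equiv.sum_comp finProdFinEquiv, Fintype.sum_prod_type, Finset.sum_mul_sum]
  refine Finset.sum_congr rfl fun i _ => Finset.sum_congr rfl fun j _ => ?_
  simp only [Equiv.symm_apply_apply, Polynomial.eval_mul]
  ring

theorem HasRank.add {m m' : ℕ} {φ ψ : Ω → Ω → Ω} (hφ : HasRank m φ) (hψ : HasRank m' ψ) :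
    HasRank (m + m') fun x y => φ x y + ψ x y := by
  obtain ⟨g, h, H⟩ := hφ
  obtain ⟨g', h', H'⟩ := hψ
  refine ⟨Fin.append g g', Fin.append h h', fun x y => ?_⟩
  dsimp only
  rw [Fin.sum_univ_add, H, H']
  simp

theorem HasRank.sum {ι : Type*} {m : ℕ} (s : Finset ι) {φ : ι → Ω → Ω → Ω}
    (h : ∀ i ∈ s, HasRank m (φ i)) : HasRank (s.card * m) fun x y => ∑ i ∈ s, φ i x y := by
  classical
  induction s using Finset.induction_on with
  | empty =>
    rw [Finset.card_empty, zero_mul]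
    exact ⟨fun _ => 0, fun _ => 0, by simp⟩
  | insert a s ha ih =>
    have h1 := (h a (Finset.mem_insert_self _ _)).add
      (ih fun i hi => h i (Finset.mem_insert_of_mem hi))
    rw [Finset.card_insert_of_notMem ha, add_mul, one_mul, add_comm]
    simpa only [Finset.sum_insert ha] using h1

theorem HasRank.prod_one {ι : Type*} (s : Finset ι) {φ : ι → Ω → Ω → Ω}
    (h : ∀ i ∈ s, HasRank 1 (φ i)) : HasRank 1 fun x y => ∏ i ∈ s, φ i x y := by
  classical
  induction s using Finset.induction_on with
  | empty => exact hasRank_one 1 1 (by simp)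
  | insert a s ha ih =>
    have h1 := (h a (Finset.mem_insert_self _ _)).mul
      (ih fun i hi => h i (Finset.mem_insert_of_mem hi))
    simpa only [Finset.prod_insert ha] using h1

theorem HasRank.prod_two {ι : Type*} (s : Finset ι) {φ : ι → Ω → Ω → Ω}
    (h : ∀ i ∈ s, HasRank 2 (φ i))
    (h1 : ∀ i ∈ s, ∀ j ∈ s, ¬HasRank 1 (φ i) → ¬HasRank 1 (φ j) → i = j) :
    HasRank 2 fun x y => ∏ i ∈ s, φ i x y := by
  classical
  by_cases hall : ∀ i ∈ s, HasRank 1 (φ i)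
  · have h2 := (HasRank.prod_one s hall).add (hasRank_one (φ := fun _ _ => 0) 0 0 (by simp))
    simpa only [add_zero] using h2
  · push Not at hall
    obtain ⟨a, ha, hna⟩ := hall
    have h2 := (h a ha).mul (HasRank.prod_one (s.erase a) fun i hi => by
      by_contra hni
      exact (Finset.mem_erase.1 hi).1 (h1 i (Finset.mem_erase.1 hi).2 a ha hni hna))
    have h3 : ∀ x y, φ a x y * ∏ i ∈ s.erase a, φ i x y = ∏ i ∈ s, φ i x y := fun x y =>
      Finset.mul_prod_erase s (fun i => φ i x y) ha
    simpa only [h3, mul_one] using h2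

theorem exists_curve_ne_zero_of_hasRank [Infinite Ω] {α : Ω}
    (hα : Function.Injective fun e : ℕ => α ^ e) {m w : ℕ} (hw : m ≤ w) {φ : Ω → Ω → Ω}
    (hφ : HasRank m φ) {x y : Ω} (hxy : φ x y ≠ 0) :
    ∃ τ, φ (curve α w 0 τ) (curve α w 1 τ) ≠ 0 := by
  obtain ⟨g, h, H⟩ := hφ
  rw [H] at hxy
  obtain ⟨τ, hτ⟩ := exists_curve_ne_zero hα (by simpa using hw) g h hxy
  refine ⟨τ, ?_⟩
  rw [H]
  simpa [curve, mul_comm τ] using hτ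

end HasRank

/-- A sum of products of affine forms. -/
structure GateSum (F : Type*) (n : ℕ) where
  ι : Type
  [fin : Fintype ι]
  scalar : ι → F
  fanin : ι → ℕ
  factor : (i : ι) → Fin (fanin i) → AffineForm F n

attribute [instance] GateSum.fin

namespace GateSum
variable {F : Type u} [Field F] {n : ℕ}

/-- The value of a sum of products of affine forms. -/
def value {S : Type*} [CommRing S] [Algebra F S] (f : GateSum F n) (η : Fin n → S) : S :=
  ∑ i, algebraMap F S (f.scalar i) * ∏ j, (f.factor i j).value η

theorem map_value {S T : Type*} [CommRing S] [Algebra F S] [CommRing T]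
    [Algebra F T] (φ : S →ₐ[F] T) (f : GateSum F n) (η : Fin n → S) :
    φ (f.value η) = f.value fun v => φ (η v) := by
  simp [value, AffineForm.map_value, map_prod]

/-- Along the linear order of the variables in `X` given by `pos`, no gate has two factors that
both cross the same cut. -/
def Separated (f : GateSum F n) (pos : Fin n → ℕ) (X : Set (Fin n)) : Prop :=
  ∀ i j j', ∀ v ∈ X, ∀ x ∈ X, ∀ v' ∈ X, ∀ x' ∈ X,
    pos v < pos x → pos v' < pos x → pos v < pos x' → pos v' < pos x' →
    (f.factor i j).coeff v ≠ 0 → (f.factor i j).coeff x ≠ 0 →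
    (f.factor i j').coeff v' ≠ 0 → (f.factor i j').coeff x' ≠ 0 → j = j'

theorem hasRank_two {Ω : Type*} [Field Ω] [Algebra F Ω] (f : GateSum F n)
    (γ ζ : Fin n → Polynomial Ω) (ξ : Fin n → Ω)
    (hsep : ∀ i j j' v x v' x', γ v ≠ 0 → ζ x ≠ 0 → γ v' ≠ 0 → ζ x' ≠ 0 →
      (f.factor i j).coeff v ≠ 0 → (f.factor i j).coeff x ≠ 0 →
      (f.factor i j').coeff v' ≠ 0 → (f.factor i j').coeff x' ≠ 0 → j = j') :
    HasRank (Fintype.card f.ι * 2) fun x y =>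
      f.value fun v => (γ v).eval x + (ζ v).eval y + ξ v := by
  classical
  refine HasRank.sum Finset.univ fun i _ => ?_
  have hsplit : ∀ j x y, (f.factor i j).value (fun v => (γ v).eval x + (ζ v).eval y + ξ v) =
      (Polynomial.C ((f.factor i j).value ξ) +
        ∑ v, Polynomial.C (algebraMap F Ω ((f.factor i j).coeff v)) * γ v).eval x +
      (∑ v, Polynomial.C (algebraMap F Ω ((f.factor i j).coeff v)) * ζ v).eval y := by
    intro j x y
    simp only [AffineForm.value, Polynomial.eval_add, Polynomial.eval_C, Polynomial.eval_finsetSum,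
      Polynomial.eval_mul, mul_add, Finset.sum_add_distrib]
    ring
  have key : HasRank 2 fun x y =>
      ∏ j, (f.factor i j).value fun v => (γ v).eval x + (ζ v).eval y + ξ v := by
    refine HasRank.prod_two _ (fun j _ => ?_) fun j _ j' _ hj hj' => ?_
    · simp only [hsplit]
      exact (hasRank_left _).add (hasRank_right _)
    · have hx : ∀ j, ¬HasRank 1 (fun x y =>
          (f.factor i j).value fun v => (γ v).eval x + (ζ v).eval y + ξ v) →
          (∃ v, γ v ≠ 0 ∧ (f.factor i j).coeff v ≠ 0) ∧
          ∃ v, ζ v ≠ 0 ∧ (f.factor i j).coeff v ≠ 0 := by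
        intro j hj
        constructor
        · by_contra! hz
          refine hj ?_
          simp only [hsplit]
          refine hasRank_one 1 (Polynomial.C ((f.factor i j).value ξ) +
            ∑ v, Polynomial.C (algebraMap F Ω ((f.factor i j).coeff v)) * ζ v) fun x y => ?_
          have : ∑ v, Polynomial.C (algebraMap F Ω ((f.factor i j).coeff v)) * γ v = 0 :=
            Finset.sum_eq_zero fun v _ => by
              by_cases h : γ v = 0
              · simp [h]
              · simp [hz v h]
          simp [this]
        · by_contra! hz
          refine hj ?_
          simp only [hsplit]
          refine hasRank_one (Polynomial.C ((f.factor i j).value ξ) +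
            ∑ v, Polynomial.C (algebraMap F Ω ((f.factor i j).coeff v)) * γ v) 1 fun x y => ?_
          have : ∑ v, Polynomial.C (algebraMap F Ω ((f.factor i j).coeff v)) * ζ v = 0 :=
            Finset.sum_eq_zero fun v _ => by
              by_cases h : ζ v = 0
              · simp [h]
              · simp [hz v h]
          simp [this]
      obtain ⟨⟨v, hv, hcv⟩, x, hx', hcx⟩ := hx j hj
      obtain ⟨⟨v', hv', hcv'⟩, x'', hx'', hcx'⟩ := hx j' hj'
      exact hsep i j j' v x v' x'' hv hx' hv' hx'' hcv hcx hcv' hcx'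
  have h2 := (hasRank_one (φ := fun _ _ => algebraMap F Ω (f.scalar i))
    (Polynomial.C (algebraMap F Ω (f.scalar i))) 1 (by simp)).mul key
  simpa using h2

/-- One parameter serves all variables in a node of the binary tree over `X`. -/
theorem exists_node_ne_zero {Ω : Type*} [Field Ω] [Infinite Ω] [Algebra F Ω] (f : GateSum F n)
    {α : Ω} (hα : Function.Injective fun e : ℕ => α ^ e) {w : ℕ} (hw : 2 * Fintype.card f.ι ≤ w)
    {pos : Fin n → ℕ} (hpos : Function.Injective pos) {X : Set (Fin n)} [DecidablePred (· ∈ X)]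
    (hX : f.Separated pos X) (r q : ℕ) (η : Fin n → Ω) (hη : f.value η ≠ 0) :
    ∃ τ, f.value (fun v => if v ∈ X ∧ pos v / 2 ^ r = q then gen α w r (pos v) τ else η v) ≠ 0 := by
  classical
  induction r generalizing q η with
  | zero =>
    by_cases h : ∃ v ∈ X, pos v = q
    · obtain ⟨v, hv, hq⟩ := h
      refine ⟨η v, ?_⟩
      convert hη using 3 with v'
      split_ifs with hv'
      · rw [hpos (show pos v' = pos v by simpa [hq] using hv'.2)]; rfl
      · rfl
    · push Not at h
      refine ⟨0, ?_⟩
      convert hη using 3 with v'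
      rw [if_neg]
      rintro ⟨h1, h2⟩
      exact h v' h1 (by simpa using h2)
  | succ r ih =>
    obtain ⟨τ₁, h₁⟩ := ih (2 * q) η hη
    obtain ⟨τ₂, h₂⟩ := ih (2 * q + 1) _ h₁
    let γ : Fin n → Polynomial Ω := fun v => if v ∈ X ∧ pos v / 2 ^ r = 2 * q then
      gen (Polynomial.C α) w r (pos v) Polynomial.X else 0
    let ζ : Fin n → Polynomial Ω := fun v => if v ∈ X ∧ pos v / 2 ^ r = 2 * q + 1 then
      gen (Polynomial.C α) w r (pos v) Polynomial.X else 0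
    let ξ : Fin n → Ω := fun v => if v ∈ X ∧ pos v / 2 ^ (r + 1) = q then 0 else η v
    have hev : ∀ v x, (gen (Polynomial.C α) w r (pos v) Polynomial.X : Polynomial Ω).eval x =
        gen α w r (pos v) x := fun v x => by
      have := map_gen (Polynomial.evalRingHom x) (Polynomial.C α) w r (pos v) Polynomial.X
      simpa using this
    have hdiv : ∀ v, pos v / 2 ^ (r + 1) = pos v / 2 ^ r / 2 := fun v => by
      rw [pow_succ, Nat.div_div_eq_div_mul]
    have hrank := f.hasRank_two γ ζ ξ (by
      intro i j j' v x v' x' hv hx hv' hx' c1 c2 c3 c4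
      have mγ : ∀ v, γ v ≠ 0 → v ∈ X ∧ pos v / 2 ^ r = 2 * q := fun v h => by
        by_contra h'; exact h (if_neg h')
      have mζ : ∀ v, ζ v ≠ 0 → v ∈ X ∧ pos v / 2 ^ r = 2 * q + 1 := fun v h => by
        by_contra h'; exact h (if_neg h')
      have lt : ∀ v x, γ v ≠ 0 → ζ x ≠ 0 → pos v < pos x := fun v x h h' => by
        by_contra hle
        have := Nat.div_le_div_right (c := 2 ^ r) (not_lt.1 hle)
        rw [(mγ v h).2, (mζ x h').2] at this
        omega
      exact hX i j j' v (mγ v hv).1 x (mζ x hx).1 v' (mγ v' hv').1 x' (mζ x' hx').1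
        (lt _ _ hv hx) (lt _ _ hv' hx) (lt _ _ hv hx') (lt _ _ hv' hx') c1 c2 c3 c4)
    obtain ⟨τ, hτ⟩ := exists_curve_ne_zero_of_hasRank hα (w := w) (by omega) hrank (x := τ₁) (y := τ₂) (by
      convert h₂ using 3 with v
      simp only [γ, ζ, ξ, hdiv]
      by_cases hv : v ∈ X
      · rcases lt_trichotomy (pos v / 2 ^ r / 2) q with h | h | h
        · rw [if_neg (by omega), if_neg (by omega), if_neg (by omega), if_neg (by omega),
            if_neg (by omega)]
          simp
        · rcases Nat.mod_two_eq_zero_or_one (pos v / 2 ^ r) with hm | hm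
          · rw [if_pos ⟨hv, by omega⟩, if_neg (by omega), if_pos ⟨hv, h⟩, if_neg (by omega),
              if_pos ⟨hv, by omega⟩, hev]
            simp
          · rw [if_neg (by omega), if_pos ⟨hv, by omega⟩, if_pos ⟨hv, h⟩, if_pos ⟨hv, by omega⟩,
              hev]
            simp
        · rw [if_neg (by omega), if_neg (by omega), if_neg (by omega), if_neg (by omega),
            if_neg (by omega)]
          simp
      · simp [hv])
    refine ⟨τ, ?_⟩
    convert hτ using 3 with v
    simp only [γ, ζ, ξ, hdiv]
    by_cases hv : v ∈ X
    · by_cases h : pos v / 2 ^ r / 2 = q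
      · rcases Nat.mod_two_eq_zero_or_one (pos v / 2 ^ r) with hm | hm
        · rw [if_pos ⟨hv, h⟩, if_pos ⟨hv, by omega⟩, if_neg (by omega), if_pos ⟨hv, h⟩, hev, gen, hm]
          simp
        · rw [if_pos ⟨hv, h⟩, if_neg (by omega), if_pos ⟨hv, by omega⟩, if_pos ⟨hv, h⟩, hev, gen, hm]
          simp
      · rw [if_neg (by tauto), if_neg (by omega), if_neg (by omega), if_neg (by tauto)]
        simp
    · simp [hv]

/-- One parameter per block. -/
theorem exists_blocks_ne_zero {Ω : Type*} [Field Ω] [Infinite Ω] [Algebra F Ω] (f : GateSum F n)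
    {α : Ω} (hα : Function.Injective fun e : ℕ => α ^ e) {w : ℕ} (hw : 2 * Fintype.card f.ι ≤ w)
    {pos : Fin n → ℕ} (hpos : Function.Injective pos) {r : ℕ} (hr : ∀ v, pos v < 2 ^ r)
    {blk : Fin n → ℕ} (hsep : ∀ s, f.Separated pos {v | blk v = s})
    {η : Fin n → Ω} (hη : f.value η ≠ 0) :
    ∃ τ : ℕ → Ω, f.value (fun v => gen α w r (pos v) (τ (blk v))) ≠ 0 := by
  have key : ∀ u, ∃ τ : ℕ → Ω,
      f.value (fun v => if blk v < u then gen α w r (pos v) (τ (blk v)) else η v) ≠ 0 := by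
    intro u
    induction u with
    | zero => exact ⟨0, by simpa using hη⟩
    | succ u ih =>
      obtain ⟨τ, hτ⟩ := ih
      obtain ⟨τ', hτ'⟩ := f.exists_node_ne_zero hα hw hpos (hsep u) r 0 _ hτ
      refine ⟨Function.update τ u τ', ?_⟩
      convert hτ' using 3 with v
      have hv : pos v / 2 ^ r = 0 := Nat.div_eq_of_lt (hr v)
      rcases lt_trichotomy (blk v) u with h | h | h
      · rw [if_pos (by omega), if_neg (by simp; omega), if_pos h, Function.update_of_ne h.ne]
      · rw [if_pos (by omega), if_pos ⟨h, hv⟩, h, Function.update_self]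
      · rw [if_neg (by omega), if_neg (by simp; omega), if_neg (by omega)]
  obtain ⟨τ, hτ⟩ := key (∑ v, blk v + 1)
  refine ⟨τ, ?_⟩
  convert hτ using 3 with v
  rw [if_pos]
  exact Nat.lt_succ_of_le (Finset.single_le_sum (fun _ _ => Nat.zero_le _) (Finset.mem_univ v))

end GateSum

/-! Kronecker substitution -/

theorem sum_mul_pow_lt {m D : ℕ} (s : Fin m → ℕ) (hs : ∀ i, s i < D) :
    ∑ i, s i * D ^ (i : ℕ) < D ^ m := by
  induction m with
  | zero => simp
  | succ m ih =>
    rw [Fin.sum_univ_succ]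
    have h1 := ih (fun i => s i.succ) fun i => hs _
    have h2 : ∑ i : Fin m, s i.succ * D ^ (i.succ : ℕ) =
        D * ∑ i : Fin m, s i.succ * D ^ (i : ℕ) := by
      rw [Finset.mul_sum]
      refine Finset.sum_congr rfl fun i _ => ?_
      rw [Fin.val_succ, pow_succ]; ring
    rw [h2, pow_succ']
    have h3 := Nat.mul_le_mul_left D (Nat.succ_le_of_lt h1)
    have h4 := hs 0
    rw [Nat.succ_eq_add_one, mul_add] at h3
    simp only [Fin.val_zero, pow_zero, mul_one]
    omega

theorem sum_mul_pow_injective {m D : ℕ} (s s' : Fin m → ℕ) (hs : ∀ i, s i < D)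
    (hs' : ∀ i, s' i < D) (h : ∑ i, s i * D ^ (i : ℕ) = ∑ i, s' i * D ^ (i : ℕ)) : s = s' := by
  induction m with
  | zero => exact Subsingleton.elim _ _
  | succ m ih =>
    have h2 : ∀ s : Fin (m + 1) → ℕ, ∑ i, s i * D ^ (i : ℕ) =
        s 0 + D * ∑ i : Fin m, s i.succ * D ^ (i : ℕ) := by
      intro s
      rw [Fin.sum_univ_succ, Finset.mul_sum]
      simp only [Fin.val_zero, pow_zero, mul_one, Fin.val_succ, pow_succ]
      congr 1
      exact Finset.sum_congr rfl fun i _ => by ring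
    rw [h2, h2] at h
    have h0 : s 0 = s' 0 := by
      have := congrArg (· % D) h
      simpa [Nat.mod_eq_of_lt (hs 0), Nat.mod_eq_of_lt (hs' 0)] using this
    have hD : 0 < D := (Nat.zero_le _).trans_lt (hs 0)
    have h1 := Nat.eq_of_mul_eq_mul_left hD (Nat.add_left_cancel (h0 ▸ h))
    have h3 := ih (fun i => s i.succ) (fun i => s' i.succ) (fun i => hs _) (fun i => hs' _) h1
    funext i
    refine Fin.cases h0 (fun i => congrFun h3 i) i

section Kronecker
variable {F : Type*} [Field F]

theorem aeval_kronecker {m D : ℕ} (P : MvPolynomial (Fin m) F) :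
    MvPolynomial.aeval (fun i : Fin m => (Polynomial.X : Polynomial F) ^ D ^ (i : ℕ)) P =
      ∑ s ∈ P.support, Polynomial.monomial (∑ i, s i * D ^ (i : ℕ)) (P.coeff s) := by
  rw [MvPolynomial.aeval_def, MvPolynomial.eval₂_eq']
  refine Finset.sum_congr rfl fun s _ => ?_
  rw [← Polynomial.C_mul_X_pow_eq_monomial, ← Finset.prod_pow_eq_pow_sum]
  congr 1
  exact Finset.prod_congr rfl fun i _ => by rw [← pow_mul, mul_comm]

theorem aeval_kronecker_ne_zero {m D : ℕ} {P : MvPolynomial (Fin m) F} (hP : P ≠ 0)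
    (hD : ∀ i, P.degreeOf i < D) :
    MvPolynomial.aeval (fun i : Fin m => (Polynomial.X : Polynomial F) ^ D ^ (i : ℕ)) P ≠ 0 := by
  classical
  obtain ⟨s, hs⟩ := MvPolynomial.support_nonempty.2 hP
  have hlt : ∀ s ∈ P.support, ∀ i, s i < D := fun s hs i =>
    (MvPolynomial.degreeOf_le_iff.1 le_rfl s hs).trans_lt (hD i)
  intro h0
  have := congrArg (fun Q => Polynomial.coeff Q (∑ i, s i * D ^ (i : ℕ))) h0
  rw [aeval_kronecker] at this
  simp only [Polynomial.finsetSum_coeff, Polynomial.coeff_monomial, Polynomial.coeff_zero] at this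
  rw [Finset.sum_eq_single s] at this
  · rw [if_pos rfl] at this
    exact MvPolynomial.mem_support_iff.1 hs this
  · intro s' hs' hne
    rw [if_neg]
    intro h
    exact hne (DFunLike.coe_injective (sum_mul_pow_injective _ _ (hlt s' hs') (hlt s hs) h))
  · exact fun h => absurd hs h

theorem natDegree_aeval_kronecker_lt {m D : ℕ} (P : MvPolynomial (Fin m) F)
    (hD : ∀ i, P.degreeOf i < D) (hD0 : 0 < D) :
    (MvPolynomial.aeval (fun i : Fin m => (Polynomial.X : Polynomial F) ^ D ^ (i : ℕ))
      P).natDegree < D ^ m := by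
  rw [aeval_kronecker]
  refine (Polynomial.natDegree_sum_le_of_forall_le (n := D ^ m - 1) _ _ fun s hs => ?_).trans_lt
    (Nat.sub_lt (pow_pos hD0 _) one_pos)
  refine (Polynomial.natDegree_monomial_le _).trans ?_
  have := sum_mul_pow_lt (D := D) (fun i => s i) fun i =>
    (MvPolynomial.degreeOf_le_iff.1 le_rfl s hs).trans_lt (hD i)
  omega

end Kronecker

/-- A bound for the degree of `curve` in terms of the degree of its argument. -/
def curveDegree (w d : ℕ) : ℕ := (w + 1) * (d + w)

section Degree
variable {F : Type*} [Field F] {m : ℕ}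

theorem degreeOf_curve_le (w b d : ℕ) (i₀ i : Fin m) (τ : MvPolynomial (Fin m) F)
    (hτ : τ.degreeOf i ≤ d) :
    (curve (MvPolynomial.X i₀) w b τ).degreeOf i ≤ curveDegree w d := by
  unfold curve curveDegree
  have h1 : (∏ e ∈ Finset.range w, (τ - MvPolynomial.X i₀ ^ e)).degreeOf i ≤ w * (d + w) := by
    refine (MvPolynomial.degreeOf_prod_le i _ _).trans ?_
    refine (Finset.sum_le_card_nsmul _ _ (d + w) fun e he => ?_).trans (by simp)
    refine (MvPolynomial.degreeOf_sub_le i _ _).trans (max_le (by omega) ?_)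
    refine (MvPolynomial.degreeOf_pow_le i _ _).trans ?_
    have : (MvPolynomial.X i₀ : MvPolynomial (Fin m) F).degreeOf i ≤ 1 := by
      rw [MvPolynomial.degreeOf_X]; split_ifs <;> omega
    have := Nat.mul_le_mul_left e this
    have := Finset.mem_range.1 he
    omega
  refine (MvPolynomial.degreeOf_mul_le i _ _).trans ?_
  have h2 : (if b = 0 then 1 else τ : MvPolynomial (Fin m) F).degreeOf i ≤ d := by
    split_ifs
    · simp
    · exact hτ
  rw [add_mul, one_mul]
  omega

theorem degreeOf_gen_le (w r q d : ℕ) (i₀ i : Fin m) (τ : MvPolynomial (Fin m) F)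
    (hτ : τ.degreeOf i ≤ d) :
    (gen (MvPolynomial.X i₀) w r q τ).degreeOf i ≤ (curveDegree w)^[r] d := by
  induction r generalizing τ d with
  | zero => exact hτ
  | succ r ih => exact ih _ _ (degreeOf_curve_le w _ d i₀ i τ hτ)

theorem GateSum.degreeOf_value_le {n N d : ℕ} (f : GateSum F n) (hN : ∀ i, f.fanin i ≤ N)
    (i : Fin m) (γ : Fin n → MvPolynomial (Fin m) F) (hγ : ∀ v, (γ v).degreeOf i ≤ d) :
    (f.value γ).degreeOf i ≤ N * d := by
  unfold value
  refine (MvPolynomial.degreeOf_sum_le i _ _).trans (Finset.sup_le fun k _ => ?_)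
  rw [MvPolynomial.algebraMap_eq]
  refine (MvPolynomial.degreeOf_C_mul_le _ _ _).trans ?_
  refine (MvPolynomial.degreeOf_prod_le i _ _).trans ?_
  refine (Finset.sum_le_card_nsmul _ _ d fun j _ => ?_).trans ?_
  · unfold AffineForm.value
    refine (MvPolynomial.degreeOf_add_le i _ _).trans (max_le (by simp) ?_)
    refine (MvPolynomial.degreeOf_sum_le i _ _).trans (Finset.sup_le fun v _ => ?_)
    rw [MvPolynomial.algebraMap_eq]
    exact (MvPolynomial.degreeOf_C_mul_le _ _ _).trans (hγ v)
  · simpa using Nat.mul_le_mul_right d (hN k)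

end Degree

/-- The substitution of univariate polynomials for the variables. -/
noncomputable def substitution (F : Type*) [Field F] {n : ℕ} (w r D : ℕ) (pos blk : Fin n → ℕ)
    (v : Fin n) : Polynomial F :=
  gen Polynomial.X w r (pos v) (Polynomial.X ^ D ^ (blk v + 1))

theorem ratFunc_X_pow_injective (F : Type*) [Field F] :
    Function.Injective fun e : ℕ => (RatFunc.X : RatFunc F) ^ e := by
  intro a b h
  have h' : algebraMap (Polynomial F) (RatFunc F) (Polynomial.X ^ a) =
      algebraMap (Polynomial F) (RatFunc F) (Polynomial.X ^ b) := by simpa using h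
  have := congrArg Polynomial.natDegree (RatFunc.algebraMap_injective F h')
  simpa using this

theorem GateSum.substitution_spec {F : Type u} [Field F] {n : ℕ} (f : GateSum F n) {w r D u : ℕ}
    (hw : 2 * Fintype.card f.ι ≤ w) {pos : Fin n → ℕ} (hpos : Function.Injective pos)
    (hr : ∀ v, pos v < 2 ^ r) {blk : Fin n → ℕ} (hu : ∀ v, blk v < u)
    (hsep : ∀ s, f.Separated pos {v | blk v = s}) (hn : ∀ i, f.fanin i ≤ n)
    (hD : n * (curveDegree w)^[r] 1 < D) :
    (f.value (substitution F w r D pos blk) = 0 ↔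
      f.value (MvPolynomial.X : Fin n → MvPolynomial (Fin n) F) = 0) ∧
    (f.value (substitution F w r D pos blk)).natDegree < D ^ (u + 1) := by
  classical
  let γ : Fin n → MvPolynomial (Fin (u + 1)) F := fun v =>
    gen (MvPolynomial.X 0) w r (pos v) (MvPolynomial.X ⟨blk v + 1, Nat.succ_lt_succ (hu v)⟩)
  let κ : MvPolynomial (Fin (u + 1)) F →ₐ[F] Polynomial F :=
    MvPolynomial.aeval (fun i : Fin (u + 1) => (Polynomial.X : Polynomial F) ^ D ^ (i : ℕ))
  have hκ : κ (f.value γ) = f.value (substitution F w r D pos blk) := by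
    rw [map_value]
    congr 1
    funext v
    have := map_gen (κ : MvPolynomial (Fin (u + 1)) F →+* Polynomial F) (MvPolynomial.X 0) w r
      (pos v) (MvPolynomial.X ⟨blk v + 1, Nat.succ_lt_succ (hu v)⟩)
    simpa [κ, substitution] using this
  have hdeg : ∀ i, (f.value γ).degreeOf i < D := fun i => by
    refine (f.degreeOf_value_le hn i γ fun v => ?_).trans_lt hD
    refine degreeOf_gen_le w r (pos v) 1 0 i _ ?_
    rw [MvPolynomial.degreeOf_X]; split_ifs <;> omega
  refine ⟨⟨fun h => ?_, fun h => ?_⟩, ?_⟩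
  · by_contra hf
    have hne : f.value γ ≠ 0 := by
      have : Infinite (RatFunc F) :=
        Infinite.of_injective _ (RatFunc.algebraMap_injective F)
      obtain ⟨η, hη⟩ : ∃ η : Fin n → RatFunc F, f.value η ≠ 0 := by
        by_contra! hall
        refine hf (MvPolynomial.map_injective (algebraMap F (RatFunc F))
          (algebraMap F (RatFunc F)).injective ?_)
        rw [map_zero]
        refine MvPolynomial.funext fun η => ?_
        rw [MvPolynomial.eval_map, ← MvPolynomial.aeval_def, map_value, map_zero]
        simpa using hall η
      obtain ⟨τ, hτ⟩ := f.exists_blocks_ne_zero (ratFunc_X_pow_injective F) hw hpos hr hsep hη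
      intro h0
      let ψ : MvPolynomial (Fin (u + 1)) F →ₐ[F] RatFunc F :=
        MvPolynomial.aeval (Fin.cases RatFunc.X fun s : Fin u => τ s)
      refine hτ ?_
      rw [← map_zero ψ, ← h0, map_value]
      congr 1
      funext v
      have := map_gen (ψ : MvPolynomial (Fin (u + 1)) F →+* RatFunc F) (MvPolynomial.X 0) w r
        (pos v) (MvPolynomial.X (Fin.succ ⟨blk v, hu v⟩))
      simpa [ψ, γ] using this.symm
    exact aeval_kronecker_ne_zero hne hdeg (hκ.trans h)
  · have := map_value (MvPolynomial.aeval (substitution F w r D pos blk)) f MvPolynomial.X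
    rw [h, map_zero] at this
    simpa using this.symm
  · rw [← hκ]
    exact natDegree_aeval_kronecker_lt _ hdeg ((Nat.zero_le _).trans_lt hD)

/-! Weakest preconditions for programs whose loops run at most `M` times -/

namespace RamProgram

infixr:60 ";;" => RamProgram.seq

/-- A bound for the running time when every loop runs at most `M` times. -/
def timeBound (M : ℕ) : RamProgram → ℕ
  | seq p q => p.timeBound M + q.timeBound M
  | ifz _ p q => p.timeBound M + q.timeBound M + 1
  | fifz _ p q => p.timeBound M + q.timeBound M + 1
  | loop _ p => M * (p.timeBound M + 1) + 1
  | _ => 1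

theorem exists_timeBound_le (p : RamProgram) :
    ∃ C d : ℕ, ∀ M, 1 ≤ M → p.timeBound M ≤ C * M ^ d := by
  have pair : ∀ p q : RamProgram, (∃ C d : ℕ, ∀ M, 1 ≤ M → p.timeBound M ≤ C * M ^ d) →
      (∃ C d : ℕ, ∀ M, 1 ≤ M → q.timeBound M ≤ C * M ^ d) →
      ∃ C d : ℕ, ∀ M, 1 ≤ M → p.timeBound M + q.timeBound M + 1 ≤ C * M ^ d := by
    rintro p q ⟨C, d, h⟩ ⟨C', d', h'⟩
    refine ⟨C + C' + 1, d + d', fun M hM => ?_⟩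
    have h1 := (h M hM).trans (Nat.mul_le_mul_left C
      (Nat.pow_le_pow_right hM (Nat.le_add_right d d')))
    have h2 := (h' M hM).trans (Nat.mul_le_mul_left C'
      (Nat.pow_le_pow_right hM (Nat.le_add_left d' d)))
    have h3 := Nat.one_le_pow (d + d') M hM
    nlinarith
  induction p with
  | seq p q ihp ihq =>
    obtain ⟨C, d, h⟩ := pair p q ihp ihq
    exact ⟨C, d, fun M hM => (Nat.le_succ _).trans (h M hM)⟩
  | ifz a p q ihp ihq => exact pair p q ihp ihq
  | fifz a p q ihp ihq => exact pair p q ihp ihq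
  | loop a p ih =>
    obtain ⟨C, d, h⟩ := ih
    refine ⟨C + 2, d + 1, fun M hM => ?_⟩
    have h1 := Nat.mul_le_mul_left M (h M hM)
    have h2 := Nat.one_le_pow d M hM
    have h3 : M ≤ M * M ^ d := Nat.le_mul_of_pos_right _ h2
    simp only [timeBound, pow_succ]
    nlinarith
  | _ => exact ⟨1, 0, fun M _ => by simp [timeBound]⟩

/-- Does the program assign to the register `r`? -/
def wr : RamProgram → ℕ → Bool
  | set a _, r | add a _ _, r | sub a _ _, r | load a _, r => r == a
  | seq p q, r | ifz _ p q, r | fifz _ p q, r => p.wr r || q.wr r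
  | loop _ p, r => p.wr r
  | _, _ => false

/-- Does the program assign to the field register `r`? -/
def fwr : RamProgram → ℕ → Bool
  | fzero a, r | fone a, r | fadd a _ _, r | fsub a _ _, r | fmul a _ _, r | finv a _, r
  | fload a _, r => r == a
  | seq p q, r | ifz _ p q, r | fifz _ p q, r => p.fwr r || q.fwr r
  | loop _ p, r => p.fwr r
  | _, _ => false

/-- Does the program write to the memory of natural numbers? -/
def stores : RamProgram → Bool
  | store _ _ => true
  | seq p q | ifz _ p q | fifz _ p q => p.stores || q.stores
  | loop _ p => p.stores
  | _ => false

/-- Does the program write to the memory of field elements? -/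
def fstores : RamProgram → Bool
  | fstore _ _ => true
  | seq p q | ifz _ p q | fifz _ p q => p.fstores || q.fstores
  | loop _ p => p.fstores
  | _ => false

section Frame
variable {F : Type*}

/-- What the program does not assign to has not changed. -/
structure Frame (p : RamProgram) (s s' : RamState F) : Prop where
  reg : ∀ r, p.wr r = false → s'.reg r = s.reg r
  freg : ∀ r, p.fwr r = false → s'.freg r = s.freg r
  mem : p.stores = false → s'.mem = s.mem
  fmem : p.fstores = false → s'.fmem = s.fmem

theorem Frame.refl (p : RamProgram) (s : RamState F) : Frame p s s :=
  ⟨fun _ _ => rfl, fun _ _ => rfl, fun _ => rfl, fun _ => rfl⟩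

theorem Frame.trans {p : RamProgram} {s s' s'' : RamState F} (h : Frame p s s')
    (h' : Frame p s' s'') : Frame p s s'' :=
  ⟨fun r hr => (h'.reg r hr).trans (h.reg r hr), fun r hr => (h'.freg r hr).trans (h.freg r hr),
    fun hr => (h'.mem hr).trans (h.mem hr), fun hr => (h'.fmem hr).trans (h.fmem hr)⟩

theorem Frame.mono {p q : RamProgram} {s s' : RamState F} (h : Frame p s s')
    (h1 : ∀ r, q.wr r = false → p.wr r = false) (h2 : ∀ r, q.fwr r = false → p.fwr r = false)
    (h3 : q.stores = false → p.stores = false) (h4 : q.fstores = false → p.fstores = false) :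
    Frame q s s' :=
  ⟨fun r hr => h.reg r (h1 r hr), fun r hr => h.freg r (h2 r hr), fun hr => h.mem (h3 hr),
    fun hr => h.fmem (h4 hr)⟩

/-- The configuration after an update of the counter `i` and of the loop test. -/
abbrev tick (s : RamState F) (i k x : ℕ) : RamState F :=
  ⟨Function.update (Function.update s.reg i k) 1 x, s.freg, s.mem, s.fmem⟩

end Frame

section wp
variable {F : Type*} [Field F]

/-- `k` iterations of a loop with test register `a`. -/
def loopWp (W : (RamState F → Prop) → RamState F → Prop) (a : ℕ) (Q : RamState F → Prop) :
    ℕ → RamState F → Prop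
  | 0, s => s.reg a = 0 ∧ Q s
  | k + 1, s => s.reg a ≠ 0 ∧ W (loopWp W a Q k) s

/-- The program halts in a configuration satisfying `Q`, every loop running at most `M` times. -/
def wp (M : ℕ) : RamProgram → (RamState F → Prop) → RamState F → Prop
  | skip, Q, s => Q s
  | set a v, Q, s => Q { s with reg := Function.update s.reg a v }
  | add a b d, Q, s => Q { s with reg := Function.update s.reg a (s.reg b + s.reg d) }
  | sub a b d, Q, s => Q { s with reg := Function.update s.reg a (s.reg b - s.reg d) }
  | load a b, Q, s => Q { s with reg := Function.update s.reg a (s.mem (s.reg b)) }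
  | store a b, Q, s => Q { s with mem := Function.update s.mem (s.reg a) (s.reg b) }
  | fzero a, Q, s => Q { s with freg := Function.update s.freg a 0 }
  | fone a, Q, s => Q { s with freg := Function.update s.freg a 1 }
  | fadd a b d, Q, s => Q { s with freg := Function.update s.freg a (s.freg b + s.freg d) }
  | fsub a b d, Q, s => Q { s with freg := Function.update s.freg a (s.freg b - s.freg d) }
  | fmul a b d, Q, s => Q { s with freg := Function.update s.freg a (s.freg b * s.freg d) }
  | finv a b, Q, s => Q { s with freg := Function.update s.freg a (s.freg b)⁻¹ }
  | fload a b, Q, s => Q { s with freg := Function.update s.freg a (s.fmem (s.reg b)) }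
  | fstore a b, Q, s => Q { s with fmem := Function.update s.fmem (s.reg a) (s.freg b) }
  | seq p q, Q, s => wp M p (wp M q Q) s
  | ifz a p q, Q, s => (s.reg a = 0 → wp M p Q s) ∧ (s.reg a ≠ 0 → wp M q Q s)
  | fifz a p q, Q, s => (s.freg a = 0 → wp M p Q s) ∧ (s.freg a ≠ 0 → wp M q Q s)
  | loop a p, Q, s => ∃ k ≤ M, loopWp (wp M p) a Q k s

theorem exists_runs_of_wp {M : ℕ} {p : RamProgram} {Q : RamState F → Prop} {s : RamState F}
    (h : wp M p Q s) : ∃ s' t, p.Runs s s' t ∧ t ≤ p.timeBound M ∧ Q s' := by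
  induction p generalizing Q s with
  | seq p q ihp ihq =>
    obtain ⟨s₁, t, h₁, ht, h₂⟩ := ihp h
    obtain ⟨s₂, u, h₃, hu, h₄⟩ := ihq h₂
    exact ⟨s₂, _, .seq h₁ h₃, Nat.add_le_add ht hu, h₄⟩
  | ifz a p q ihp ihq =>
    by_cases h0 : s.reg a = 0
    · obtain ⟨s₁, t, h₁, ht, h₂⟩ := ihp (h.1 h0)
      exact ⟨s₁, _, .ifz_zero h0 h₁, by simp only [timeBound]; omega, h₂⟩
    · obtain ⟨s₁, t, h₁, ht, h₂⟩ := ihq (h.2 h0)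
      exact ⟨s₁, _, .ifz_ne h0 h₁, by simp only [timeBound]; omega, h₂⟩
  | fifz a p q ihp ihq =>
    by_cases h0 : s.freg a = 0
    · obtain ⟨s₁, t, h₁, ht, h₂⟩ := ihp (h.1 h0)
      exact ⟨s₁, _, .fifz_zero h0 h₁, by simp only [timeBound]; omega, h₂⟩
    · obtain ⟨s₁, t, h₁, ht, h₂⟩ := ihq (h.2 h0)
      exact ⟨s₁, _, .fifz_ne h0 h₁, by simp only [timeBound]; omega, h₂⟩
  | loop a p ih =>
    obtain ⟨k, hk, h⟩ := h
    have key : ∀ k s, loopWp (wp M p) a Q k s →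
        ∃ s' t, (loop a p).Runs s s' t ∧ t ≤ k * (p.timeBound M + 1) + 1 ∧ Q s' := by
      intro k
      induction k with
      | zero => intro s h; exact ⟨s, 1, .loop_zero h.1, by omega, h.2⟩
      | succ k ihk =>
        intro s h
        obtain ⟨s₁, t, h₁, ht, h₂⟩ := ih h.2
        obtain ⟨s₂, u, h₃, hu, h₄⟩ := ihk s₁ h₂
        refine ⟨s₂, _, .loop_ne h.1 h₁ h₃, ?_, h₄⟩
        rw [add_mul]; omega
    obtain ⟨s', t, h₁, ht, h₂⟩ := key k s h
    exact ⟨s', t, h₁, ht.trans (Nat.succ_le_succ (Nat.mul_le_mul_right _ hk)), h₂⟩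
  | _ => exact ⟨_, 1, by constructor, le_rfl, h⟩

theorem wp_conseq {M : ℕ} {p : RamProgram} {Q Q' : RamState F → Prop} {s : RamState F}
    (h : wp M p Q s) (hQ : ∀ s', Frame p s s' → Q s' → Q' s') : wp M p Q' s := by
  induction p generalizing Q Q' s with
  | seq p q ihp ihq =>
    refine ihp h fun s₁ f₁ h₁ => ihq h₁ fun s₂ f₂ h₂ => hQ s₂ ?_ h₂
    refine (f₁.mono ?_ ?_ ?_ ?_).trans (f₂.mono ?_ ?_ ?_ ?_) <;>
      simp +contextual [wr, fwr, stores, fstores]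
  | ifz a p q ihp ihq =>
    refine ⟨fun h0 => ihp (h.1 h0) fun s₁ f₁ h₁ => hQ s₁ (f₁.mono ?_ ?_ ?_ ?_) h₁,
      fun h0 => ihq (h.2 h0) fun s₁ f₁ h₁ => hQ s₁ (f₁.mono ?_ ?_ ?_ ?_) h₁⟩ <;>
      simp +contextual [wr, fwr, stores, fstores]
  | fifz a p q ihp ihq =>
    refine ⟨fun h0 => ihp (h.1 h0) fun s₁ f₁ h₁ => hQ s₁ (f₁.mono ?_ ?_ ?_ ?_) h₁,
      fun h0 => ihq (h.2 h0) fun s₁ f₁ h₁ => hQ s₁ (f₁.mono ?_ ?_ ?_ ?_) h₁⟩ <;>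
      simp +contextual [wr, fwr, stores, fstores]
  | loop a p ih =>
    obtain ⟨k, hk, h⟩ := h
    refine ⟨k, hk, ?_⟩
    clear hk
    induction k generalizing s with
    | zero => exact ⟨h.1, hQ s (Frame.refl _ _) h.2⟩
    | succ k ihk =>
      refine ⟨h.1, ih h.2 fun s₁ f₁ h₁ => ihk (fun s₂ f₂ h₂ => hQ s₂ (Frame.trans ?_ f₂) h₂) h₁⟩
      exact f₁.mono (fun _ h => h) (fun _ h => h) (fun h => h) (fun h => h)
  | skip => exact hQ _ (Frame.refl _ _) h
  | store | fstore => exact hQ _ (by constructor <;> simp [stores, fstores]) h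
  | _ =>
    refine hQ _ ?_ h
    constructor <;> intros <;> first | rfl | skip
    · rename_i r hr
      exact Function.update_of_ne (ne_of_beq_false hr) _ _

/-- `for i in [0, reg m) do p`. Register `1` is used for the loop test. -/
def forDo (i m : ℕ) (p : RamProgram) : RamProgram :=
  set i 0 ;; sub 1 m i ;; loop 1 (p ;; set 1 1 ;; add i i 1 ;; sub 1 m i)

theorem wp_forDo {M i m : ℕ} {p : RamProgram} {Q : RamState F → Prop} {s : RamState F}
    (Inv : ℕ → RamState F → Prop) (hi : p.wr i = false) (hm : p.wr m = false)
    (him : i ≠ m ∧ i ≠ 1 ∧ m ≠ 1) (hM : s.reg m ≤ M)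
    (h0 : Inv 0 (tick s i 0 (s.reg m)))
    (hstep : ∀ k s', k < s.reg m → Frame (forDo i m p) s s' → s'.reg i = k → Inv k s' →
      wp M p (fun s'' => Inv (k + 1) (tick s'' i (k + 1) (s.reg m - (k + 1)))) s')
    (hQ : ∀ s', Frame (forDo i m p) s s' → Inv (s.reg m) s' → Q s') :
    wp M (forDo i m p) Q s := by
  obtain ⟨him, hi1, hm1⟩ := him
  have hfr : ∀ s', (∀ r, r ≠ i → r ≠ 1 → s'.reg r = s.reg r) → s'.freg = s.freg → s'.mem = s.mem →
      s'.fmem = s.fmem → Frame (forDo i m p) s s' := by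
    intro s' h1 h2 h3 h4
    refine ⟨fun r hr => h1 r ?_ ?_, fun r _ => by rw [h2], fun _ => h3, fun _ => h4⟩
    · rintro rfl; simp [forDo, wr] at hr
    · rintro rfl; simp [forDo, wr] at hr
  have hpf : ∀ {s₁ s₂ : RamState F}, Frame p s₁ s₂ → Frame (forDo i m p) s₁ s₂ := fun f =>
    f.mono (by simp +contextual [forDo, wr]) (by simp +contextual [forDo, fwr])
      (by simp [forDo, stores]) (by simp [forDo, fstores])
  refine ⟨s.reg m, hM, ?_⟩
  have key : ∀ j k s', k + j = s.reg m → Frame (forDo i m p) s s' → s'.reg i = k → s'.reg 1 = j →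
      Inv k s' → loopWp (wp M (p ;; set 1 1 ;; add i i 1 ;; sub 1 m i)) 1 Q j s' := by
    intro j
    induction j with
    | zero => intro k s' hk f _ h1 hI; exact ⟨h1, hQ s' f (by simpa [← hk] using hI)⟩
    | succ j ih =>
      intro k s' hk f hik h1 hI
      refine ⟨by omega, ?_⟩
      refine wp_conseq (p := p) (hstep k s' (by omega) f hik hI) fun s'' f' hI' => ?_
      have e1 : s''.reg i = k := (f'.reg i hi).trans hik
      have e2 : s''.reg m = s.reg m := by
        rw [f'.reg m hm, f.reg m]
        simp [forDo, wr, hm, him.symm, hm1]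
      have hk' := ih (k + 1) (tick s'' i (k + 1) (s.reg m - (k + 1))) (by omega) ?_ ?_ ?_ hI'
      · change loopWp _ 1 Q j _
        convert hk' using 1
        simp only [tick, RamState.mk.injEq, and_true]
        funext r
        simp only [Function.update_apply, him.symm, hi1, hm1, e1, e2, if_true, if_false]
        split_ifs <;> rfl
      · refine (f.trans (hpf f')).trans ⟨fun r hr => ?_, fun _ _ => rfl, fun _ => rfl, fun _ => rfl⟩
        have h1 : r ≠ 1 := by rintro rfl; simp [forDo, wr] at hr
        have h2 : r ≠ i := by rintro rfl; simp [forDo, wr] at hr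
        simp [h1, h2]
      · simp [hi1]
      · simp; omega
  have hk' := key (s.reg m) 0 (tick s i 0 (s.reg m)) (by omega)
    (hfr _ (fun r h1 h2 => ?_) rfl rfl rfl) ?_ ?_ h0
  · change loopWp _ 1 Q _ _
    convert hk' using 1
    simp [tick, Function.update_of_ne him.symm]
  · simp [h1, h2]
  · simp [hi1]
  · simp

end wp

end RamProgram

/-! Two-dimensional arrays above a read-only region -/

/-- Below `base` the memory holds `inp`; from `base` on it holds the rows of `B`, of length `len`. -/
def Grid {α : Type*} (base len : ℕ) (inp : ℕ → α) (B : ℕ → ℕ → α) (m : ℕ → α) : Prop :=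
  (∀ a < base, m a = inp a) ∧ ∀ q e, e < len → m (base + q * len + e) = B q e

namespace Grid
variable {α : Type*} {base len : ℕ} {inp : ℕ → α} {B B' : ℕ → ℕ → α} {m : ℕ → α}

theorem write (h : Grid base len inp B m) {q k : ℕ} (hk : k < len) (x : α) :
    Grid base len inp (Function.update B q (Function.update (B q) k x))
      (Function.update m (base + q * len + k) x) := by
  refine ⟨fun a ha => ?_, fun q' e he => ?_⟩
  · rw [Function.update_of_ne (by omega)]; exact h.1 a ha
  · by_cases hq : q' = q
    · subst hq
      rw [Function.update_self]
      by_cases hek : e = k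
      · subst hek; simp
      · rw [Function.update_of_ne (by omega), Function.update_of_ne hek]; exact h.2 _ _ he
    · rw [Function.update_of_ne hq, Function.update_of_ne]
      · exact h.2 _ _ he
      · intro heq
        rcases lt_or_gt_of_ne hq with hlt | hgt
        · have := Nat.mul_le_mul_right len (Nat.succ_le_of_lt hlt)
          rw [Nat.succ_eq_add_one, add_mul] at this; omega
        · have := Nat.mul_le_mul_right len (Nat.succ_le_of_lt hgt)
          rw [Nat.succ_eq_add_one, add_mul] at this; omega

theorem congr (h : Grid base len inp B m) (hB : ∀ q, ∀ e < len, B q e = B' q e) :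
    Grid base len inp B' m :=
  ⟨h.1, fun q e he => (h.2 q e he).trans (hB q e he)⟩

end Grid

/-- The first `k` entries of `f`, followed by those of `g`. -/
def splice {α : Type*} (k : ℕ) (f g : ℕ → α) (e : ℕ) : α := if e < k then f e else g e

theorem splice_zero {α : Type*} (f g : ℕ → α) : splice 0 f g = g := by
  funext e; simp [splice]

theorem update_splice {α : Type*} (k : ℕ) (f g : ℕ → α) :
    Function.update (splice k f g) k (f k) = splice (k + 1) f g := by
  funext e
  simp only [splice, Function.update_apply]
  split_ifs with h1 h2 h3 <;> first | rfl | (exfalso; omega) | rw [h1]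

theorem splice_of_lt {α : Type*} {k e : ℕ} (f g : ℕ → α) (h : e < k) : splice k f g e = f e :=
  if_pos h

theorem splice_of_ge {α : Type*} {k e : ℕ} (f g : ℕ → α) (h : k ≤ e) : splice k f g e = g e :=
  if_neg h.not_gt

namespace Grid
variable {α : Type*} {base len : ℕ} {inp : ℕ → α} {B : ℕ → ℕ → α} {m : ℕ → α}

theorem write_splice {q k : ℕ} {f : ℕ → α}
    (h : Grid base len inp (Function.update B q (splice k f (B q))) m) (hk : k < len) {a : ℕ}
    (ha : a = base + q * len + k) {x : α} (hx : x = f k) :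
    Grid base len inp (Function.update B q (splice (k + 1) f (B q))) (Function.update m a x) := by
  have := h.write (q := q) hk x
  rwa [Function.update_idem, Function.update_self, hx, update_splice, ← hx, ← ha] at this

theorem of_splice {q : ℕ} {f : ℕ → α}
    (h : Grid base len inp (Function.update B q (splice len f (B q))) m) :
    Grid base len inp (Function.update B q f) m := by
  refine h.congr fun q' e he => ?_
  by_cases hq : q' = q
  · subst hq; simp [splice_of_lt _ _ he]
  · simp [hq]

theorem splice_start {f : ℕ → α} (q : ℕ) (h : Grid base len inp B m) :
    Grid base len inp (Function.update B q (splice 0 f (B q))) m := by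
  rwa [splice_zero, Function.update_eq_self]

end Grid

/-! Arithmetic of truncated polynomials. Register `37` holds the length of the arrays, `51` and
`52` the addresses of the destination and of the source, `41` and `42` those of a work array and of
an accumulator. -/

/-- The memory holds, above the input, the polynomials `A 0`, `A 1`, …, truncated at `len`. -/
def PolyMem {F : Type*} [Field F] (base len : ℕ) (inp : ℕ → F) (A : ℕ → Polynomial F)
    (m : ℕ → F) : Prop :=
  Grid base len inp (fun q => (A q).coeff) m

theorem PolyMem.of_update {F : Type*} [Field F] {base len : ℕ} {inp : ℕ → F}
    {A : ℕ → Polynomial F} {m : ℕ → F} {q : ℕ} {P : Polynomial F}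
    (h : Grid base len inp (Function.update (fun q => (A q).coeff) q P.coeff) m) :
    PolyMem base len inp (Function.update A q P) m := by
  refine h.congr fun q' e _ => ?_
  by_cases hq : q' = q
  · subst hq; simp
  · simp [hq]

namespace RamProgram

/-- destination `:= freg 1 * z ^ reg 58` -/
def polyMono : RamProgram :=
  forDo 53 37 (add 55 51 53 ;; fzero 2 ;; fstore 55 2) ;; add 55 51 58 ;; fstore 55 1

/-- destination `+= freg 1 *` source -/
def polyAxpy : RamProgram :=
  forDo 53 37 (add 55 51 53 ;; add 56 52 53 ;; fload 2 55 ;; fload 3 56 ;; fmul 3 1 3 ;;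
    fadd 2 2 3 ;; fstore 55 2)

/-- work array `:=` accumulator `*` source -/
def polyMulAux : RamProgram :=
  forDo 53 37 (fzero 2 ;; set 1 1 ;; add 57 53 1 ;;
    forDo 54 57 (add 55 42 54 ;; fload 3 55 ;; sub 56 53 54 ;; add 56 52 56 ;; fload 4 56 ;;
      fmul 3 3 4 ;; fadd 2 2 3) ;;
    add 55 41 53 ;; fstore 55 2)

/-- accumulator `*=` source -/
def polyMul : RamProgram :=
  polyMulAux ;; forDo 53 37 (add 55 41 53 ;; fload 2 55 ;; add 55 42 53 ;; fstore 55 2)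

section
variable {F : Type*} [Field F] {M base len : ℕ} {inp : ℕ → F} {A : ℕ → Polynomial F}
  {s : RamState F} {Q : RamState F → Prop}

theorem wp_polyMono {q : ℕ} (hlen : s.reg 37 = len) (hM : len ≤ M)
    (hq : s.reg 51 = base + q * len) (hE : s.reg 58 < len) (h : PolyMem base len inp A s.fmem)
    (hQ : ∀ s', Frame polyMono s s' → PolyMem base len inp
      (Function.update A q (Polynomial.monomial (s.reg 58) (s.freg 1))) s'.fmem → Q s') :
    wp M polyMono Q s := by
  refine wp_conseq (Q := fun s' => PolyMem base len inp
      (Function.update A q (Polynomial.monomial (s.reg 58) (s.freg 1))) s'.fmem) ?_ hQ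
  refine wp_forDo (Inv := fun k s' => Grid base len inp (Function.update (fun q => (A q).coeff) q
    (splice k (fun _ => 0) (A q).coeff)) s'.fmem) rfl rfl (by decide) (hlen ▸ hM)
    (Grid.splice_start q h) ?_ ?_
  · intro k s' hk f hi hI
    have e1 := f.reg 51 rfl
    have e2 := f.reg 37 rfl
    refine hI.write_splice (hlen ▸ hk) ?_ ?_ <;> simp [e1, hq, hi]
  · intro s' f hI
    have e1 := f.reg 51 rfl
    have e2 := f.reg 58 rfl
    have e3 := f.freg 1 rfl
    rw [hlen] at hI
    have hI' := hI.of_splice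
    simp only [wp, PolyMem]
    have := hI'.write (q := q) hE (s.freg 1)
    simp only [Function.update_self, Function.update_idem] at this
    refine PolyMem.of_update ?_
    convert this using 2
    · funext e
      simp [Polynomial.coeff_monomial, Function.update_apply, eq_comm]
    · simp [e1, e2, hq]

theorem wp_polyAxpy {q q' : ℕ} (hlen : s.reg 37 = len) (hM : len ≤ M)
    (hq : s.reg 51 = base + q * len) (hq' : s.reg 52 = base + q' * len) (hne : q' ≠ q)
    (h : PolyMem base len inp A s.fmem)
    (hQ : ∀ s', Frame polyAxpy s s' → PolyMem base len inp
      (Function.update A q (A q + Polynomial.C (s.freg 1) * A q')) s'.fmem → Q s') :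
    wp M polyAxpy Q s := by
  refine wp_forDo (Inv := fun k s' => Grid base len inp (Function.update (fun q => (A q).coeff) q
    (splice k (A q + Polynomial.C (s.freg 1) * A q').coeff (A q).coeff)) s'.fmem)
    rfl rfl (by decide) (hlen ▸ hM) (Grid.splice_start q h) ?_ ?_
  · intro k s' hk f hi hI
    have e1 := f.reg 51 rfl
    have e2 := f.reg 52 rfl
    have e3 := f.freg 1 rfl
    have hk' : k < len := hlen ▸ hk
    have r1 := hI.2 q k hk'
    have r2 := hI.2 q' k hk'
    simp [hne, splice_of_ge] at r1 r2
    refine hI.write_splice hk' ?_ ?_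
    · simp [e1, hq, hi]
    · simp [e1, e2, e3, hq, hq', hi, r1, r2]
  · intro s' f hI
    rw [hlen] at hI
    exact hQ s' f (PolyMem.of_update hI.of_splice)

theorem wp_polyMulAux {q : ℕ} (hlen : s.reg 37 = len) (hM : len ≤ M)
    (h41 : s.reg 41 = base) (h42 : s.reg 42 = base + len)
    (hq : s.reg 52 = base + q * len) (hne : q ≠ 0)
    (h : PolyMem base len inp A s.fmem)
    (hQ : ∀ s', Frame polyMulAux s s' → PolyMem base len inp
      (Function.update A 0 (A 1 * A q)) s'.fmem → Q s') :
    wp M polyMulAux Q s := by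
  refine wp_forDo (Inv := fun k s' => Grid base len inp (Function.update (fun q => (A q).coeff) 0
    (splice k (A 1 * A q).coeff (A 0).coeff)) s'.fmem)
    rfl rfl (by decide) (hlen ▸ hM) (Grid.splice_start 0 h) ?_ ?_
  · intro k s' hk f hi hI
    have hk' : k < len := hlen ▸ hk
    refine wp_forDo (Inv := fun j s'' => s''.freg 2 =
      ∑ i ∈ Finset.range j, (A 1).coeff i * (A q).coeff (k - i)) rfl rfl (by decide) ?_ ?_ ?_ ?_
    · simp [hi]; omega
    · simp
    · intro j s'' hj f' hi' hI'
      simp [hi] at hj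
      have e0 := (f'.reg 53 rfl).trans hi
      have e1 := (f'.reg 42 rfl).trans (f.reg 42 rfl)
      have e2 := (f'.reg 52 rfl).trans (f.reg 52 rfl)
      have e3 := f'.fmem rfl
      have r1 := hI.2 1 j (by omega)
      have r2 := hI.2 q (k - j) (by omega)
      simp [hne] at r1 r2 e3
      simp [wp, e0, e1, e2, e3, hi', h42, hq, r1, r2, Finset.sum_range_succ, hI']
    · intro s'' f' hI'
      have e0 := (f'.reg 53 rfl).trans hi
      have e1 := (f'.reg 41 rfl).trans (f.reg 41 rfl)
      have e3 := f'.fmem rfl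
      refine Grid.write_splice (m := s''.fmem) (e3 ▸ hI) hk' ?_ ?_
      · simp [e0, e1, h41]
      · simp [hi] at hI'
        simp [hI', Polynomial.coeff_mul, Finset.Nat.sum_antidiagonal_eq_sum_range_succ
          (fun i j => (A 1).coeff i * (A q).coeff j)]
  · intro s' f hI
    rw [hlen] at hI
    exact hQ s' f (PolyMem.of_update hI.of_splice)

theorem wp_polyMul {q : ℕ} (hlen : s.reg 37 = len) (hM : len ≤ M)
    (h41 : s.reg 41 = base) (h42 : s.reg 42 = base + len)
    (hq : s.reg 52 = base + q * len) (hne : q ≠ 0)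
    (h : PolyMem base len inp A s.fmem)
    (hQ : ∀ s' W, Frame polyMul s s' → PolyMem base len inp
      (Function.update (Function.update A 0 W) 1 (A 1 * A q)) s'.fmem → Q s') :
    wp M polyMul Q s := by
  refine wp_conseq (Q := fun s' => PolyMem base len inp
      (Function.update (Function.update A 0 (A 1 * A q)) 1 (A 1 * A q)) s'.fmem) ?_
      fun s' f h => hQ s' _ f h
  refine wp_polyMulAux hlen hM h41 h42 hq hne h fun s₁ f₁ h₁ => ?_
  have hlen₁ : s₁.reg 37 = len := (f₁.reg 37 rfl).trans hlen
  refine wp_forDo (Inv := fun k s' => Grid base len inp (Function.update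
    (fun q' => (Function.update A 0 (A 1 * A q) q').coeff) 1
    (splice k (A 1 * A q).coeff (Function.update A 0 (A 1 * A q) 1).coeff)) s'.fmem)
    rfl rfl (by decide) (hlen₁ ▸ hM) (Grid.splice_start 1 h₁) ?_ ?_
  · intro k s' hk f hi hI
    have hk' : k < len := hlen₁ ▸ hk
    have e1 := (f.reg 41 rfl).trans (f₁.reg 41 rfl)
    have e2 := (f.reg 42 rfl).trans (f₁.reg 42 rfl)
    have r1 := hI.2 0 k hk'
    simp at r1
    refine hI.write_splice hk' ?_ ?_
    · simp [e2, h42, hi]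
    · simp [e1, h41, hi, r1]
  · intro s' f hI
    rw [hlen₁] at hI
    exact PolyMem.of_update hI.of_splice

end

end RamProgram

/-! Reading the input -/

/-- From address `p` up to `N`, the memory `inp` holds the list `L`. -/
def Reads {α : Type*} (inp : ℕ → α) (N p : ℕ) (L : List α) : Prop :=
  p + L.length = N ∧ ∀ k (h : k < L.length), inp (p + k) = L[k]

namespace Reads
variable {α : Type*} {inp : ℕ → α} {N p : ℕ} {L : List α}

theorem head {x : α} (h : Reads inp N p (x :: L)) : inp p = x ∧ p < N := by
  have h0 := h.2 0 (by simp)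
  rw [add_zero, List.getElem_cons_zero] at h0
  refine ⟨h0, ?_⟩
  have := h.1
  simp at this; omega

theorem tail {x : α} (h : Reads inp N p (x :: L)) : Reads inp N (p + 1) L := by
  refine ⟨by have := h.1; simp at this; omega, fun k hk => ?_⟩
  have := h.2 (k + 1) (by simpa using hk)
  rw [List.getElem_cons_succ] at this
  rw [← this]; congr 1; omega

theorem of_getD (L : List α) (d : α) : Reads (fun a => L.getD a d) L.length 0 L := by
  refine ⟨by simp, fun k hk => ?_⟩
  simp [List.getD_eq_getElem?_getD, List.getElem?_eq_getElem hk]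

end Reads

theorem drop_ofFn {α : Type*} {m : ℕ} (f : Fin m → α) {k : ℕ} (hk : k < m) :
    (List.ofFn f).drop k = f ⟨k, hk⟩ :: (List.ofFn f).drop (k + 1) := by
  rw [List.drop_eq_getElem_cons (by simpa using hk)]
  simp

theorem drop_ofFn_self {α : Type*} {m : ℕ} (f : Fin m → α) : (List.ofFn f).drop m = [] := by
  simp

namespace DepthThreeCircuit
variable {F : Type*} {n c : ℕ}

/-- The field elements of a factor. -/
def factorCode (C : Fin c → DepthThreeCircuit F n) (l : Fin c) (i : Fin (C l).topFanin)
    (j : Fin ((C l).fanin i)) : List F :=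
  ((C l).factor i j).const :: List.ofFn ((C l).factor i j).coeff

/-- The field elements of a gate. -/
def gateCode (C : Fin c → DepthThreeCircuit F n) (l : Fin c) (i : Fin (C l).topFanin) : List F :=
  (C l).scalar i :: (List.ofFn (factorCode C l i)).flatten

/-- The part of the shape from circuit `l` on. -/
def shapeFrom (C : Fin c → DepthThreeCircuit F n) (l : ℕ) : List ℕ :=
  ((List.ofFn fun l => (C l).topFanin :: List.ofFn (C l).fanin).drop l).flatten

/-- The part of the shape from gate `i` of circuit `l` on. -/
def shapeFrom₂ (C : Fin c → DepthThreeCircuit F n) (l : Fin c) (i : ℕ) : List ℕ :=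
  (List.ofFn (C l).fanin).drop i ++ shapeFrom C (l + 1)

/-- The field elements from circuit `l` on. -/
def fieldFrom (C : Fin c → DepthThreeCircuit F n) (l : ℕ) : List F :=
  ((List.ofFn fun l => (List.ofFn (gateCode C l)).flatten).drop l).flatten

/-- The field elements from gate `i` of circuit `l` on. -/
def fieldFrom₂ (C : Fin c → DepthThreeCircuit F n) (l : Fin c) (i : ℕ) : List F :=
  ((List.ofFn (gateCode C l)).drop i).flatten ++ fieldFrom C (l + 1)

/-- The field elements from factor `j` of gate `i` of circuit `l` on. -/
def fieldFrom₃ (C : Fin c → DepthThreeCircuit F n) (l : Fin c) (i : Fin (C l).topFanin) (j : ℕ) :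
    List F :=
  ((List.ofFn (factorCode C l i)).drop j).flatten ++ fieldFrom₂ C l (i + 1)

/-- The field elements from coefficient `v` of factor `j` of gate `i` of circuit `l` on. -/
def fieldFrom₄ (C : Fin c → DepthThreeCircuit F n) (l : Fin c) (i : Fin (C l).topFanin)
    (j : Fin ((C l).fanin i)) (v : ℕ) : List F :=
  (List.ofFn ((C l).factor i j).coeff).drop v ++ fieldFrom₃ C l i (j + 1)

variable (C : Fin c → DepthThreeCircuit F n)

theorem shapeCode_eq : shapeCode C = n :: c :: shapeFrom C 0 := rfl

theorem fieldCode_eq : fieldCode C = fieldFrom C 0 := rfl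

theorem shapeFrom_fin (l : Fin c) : shapeFrom C l = (C l).topFanin :: shapeFrom₂ C l 0 := by
  rw [shapeFrom, drop_ofFn _ l.2]; rfl

theorem shapeFrom₂_fin (l : Fin c) (i : Fin (C l).topFanin) :
    shapeFrom₂ C l i = (C l).fanin i :: shapeFrom₂ C l (i + 1) := by
  rw [shapeFrom₂, drop_ofFn _ i.2]; rfl

theorem shapeFrom₂_end (l : Fin c) : shapeFrom₂ C l (C l).topFanin = shapeFrom C (l + 1) := by
  rw [shapeFrom₂, drop_ofFn_self, List.nil_append]

theorem shapeFrom_end : shapeFrom C c = [] := by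
  rw [shapeFrom, drop_ofFn_self, List.flatten_nil]

theorem fieldFrom_fin (l : Fin c) : fieldFrom C l = fieldFrom₂ C l 0 := by
  rw [fieldFrom, drop_ofFn _ l.2]; rfl

theorem fieldFrom₂_fin (l : Fin c) (i : Fin (C l).topFanin) :
    fieldFrom₂ C l i = (C l).scalar i :: fieldFrom₃ C l i 0 := by
  rw [fieldFrom₂, drop_ofFn _ i.2]
  simp [gateCode, fieldFrom₃, fieldFrom₂]

theorem fieldFrom₂_end (l : Fin c) : fieldFrom₂ C l (C l).topFanin = fieldFrom C (l + 1) := by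
  rw [fieldFrom₂, drop_ofFn_self, List.flatten_nil, List.nil_append]

theorem fieldFrom₃_fin (l : Fin c) (i : Fin (C l).topFanin) (j : Fin ((C l).fanin i)) :
    fieldFrom₃ C l i j = ((C l).factor i j).const :: fieldFrom₄ C l i j 0 := by
  rw [fieldFrom₃, drop_ofFn _ j.2]
  simp [factorCode, fieldFrom₃, fieldFrom₄]

theorem fieldFrom₃_end (l : Fin c) (i : Fin (C l).topFanin) :
    fieldFrom₃ C l i ((C l).fanin i) = fieldFrom₂ C l (i + 1) := by
  rw [fieldFrom₃, drop_ofFn_self, List.flatten_nil, List.nil_append]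

theorem fieldFrom₄_fin (l : Fin c) (i : Fin (C l).topFanin) (j : Fin ((C l).fanin i)) (v : Fin n) :
    fieldFrom₄ C l i j v = ((C l).factor i j).coeff v :: fieldFrom₄ C l i j (v + 1) := by
  rw [fieldFrom₄, drop_ofFn _ v.2]; rfl

theorem fieldFrom₄_end (l : Fin c) (i : Fin (C l).topFanin) (j : Fin ((C l).fanin i)) :
    fieldFrom₄ C l i j n = fieldFrom₃ C l i (j + 1) := by
  rw [fieldFrom₄, drop_ofFn_self, List.nil_append]

end DepthThreeCircuit

namespace RamProgram
open DepthThreeCircuit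

/-- Run through the input, with the given programs at the beginning of a circuit, gate, factor, at
every coefficient, and at the end of a factor, gate, circuit. The element just read is in the field
register `1`; register `19` holds the index of the variable. -/
def walk (cs gs fs cf fe ge ce : RamProgram) : RamProgram :=
  set 16 2 ;; set 17 0 ;;
  forDo 18 3 (cs ;; load 21 16 ;; add 16 16 6 ;;
    forDo 22 21 (load 23 16 ;; add 16 16 6 ;; fload 1 17 ;; add 17 17 6 ;; gs ;;
      forDo 24 23 (fload 1 17 ;; add 17 17 6 ;; fs ;;
        forDo 19 2 (fload 1 17 ;; add 17 17 6 ;; cf) ;; fe) ;; ge) ;; ce)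

/-- The registers that `walk` assigns to. -/
def walkRegs : List ℕ := [1, 16, 17, 18, 19, 21, 22, 23, 24]

/-- The part of the configuration that is not touched by `walk` itself. -/
def mask {F : Type*} [Field F] (s : RamState F) : RamState F where
  reg := fun r => if r ∈ walkRegs then 0 else s.reg r
  freg := fun r => if r = 1 then 0 else s.freg r
  mem := s.mem
  fmem := s.fmem

section
variable {F : Type*} [Field F] {n c : ℕ}

theorem mask_eq {s s' : RamState F} (h1 : ∀ r, r ∉ walkRegs → s'.reg r = s.reg r)
    (h2 : ∀ r, r ≠ 1 → s'.freg r = s.freg r) (h3 : s'.mem = s.mem) (h4 : s'.fmem = s.fmem) :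
    mask s' = mask s := by
  simp only [mask, RamState.mk.injEq]
  refine ⟨?_, ?_, h3, h4⟩
  · funext r; split_ifs with h
    · rfl
    · exact h1 r h
  · funext r; split_ifs with h
    · rfl
    · exact h2 r h

/-- The input is still in memory. -/
def InputOK (C : Fin c → DepthThreeCircuit F n) (s : RamState F) : Prop :=
  (∀ a < (shapeCode C).length, s.mem a = (shapeCode C).getD a 0) ∧
  ∀ a < (fieldCode C).length, s.fmem a = (fieldCode C).getD a 0

theorem wp_walk {M : ℕ} (C : Fin c → DepthThreeCircuit F n) {cs gs fs cf fe ge ce : RamProgram}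
    {s : RamState F} {Q : RamState F → Prop}
    (IC : ℕ → RamState F → Prop) (IG : Fin c → ℕ → RamState F → Prop)
    (IF : (l : Fin c) → Fin (C l).topFanin → ℕ → RamState F → Prop)
    (IV : (l : Fin c) → (i : Fin (C l).topFanin) → Fin ((C l).fanin i) → ℕ → RamState F → Prop)
    (hw : ∀ p ∈ [cs, gs, fs, cf, fe, ge, ce], ∀ r ∈ [2, 3, 6, 16, 17, 18, 19, 21, 22, 23, 24],
      p.wr r = false)
    (h2 : s.reg 2 = n) (h3 : s.reg 3 = c) (h6 : s.reg 6 = 1)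
    (hMn : n ≤ M) (hMc : c ≤ M) (hMt : ∀ l, (C l).topFanin ≤ M) (hMf : ∀ l i, (C l).fanin i ≤ M)
    (hIG : ∀ l i s, IG l i s → InputOK C s)
    (hIF : ∀ l i j s, IF l i j s → InputOK C s) (hIV : ∀ l i j v s, IV l i j v s → InputOK C s)
    (h0 : IC 0 (mask s))
    (hcs : ∀ (l : Fin c) s', (∀ r, (walk cs gs fs cf fe ge ce).wr r = false → s'.reg r = s.reg r) →
      IC l (mask s') → wp M cs (fun s'' => IG l 0 (mask s'')) s')
    (hgs : ∀ (l : Fin c) (i : Fin (C l).topFanin) s',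
      (∀ r, (walk cs gs fs cf fe ge ce).wr r = false → s'.reg r = s.reg r) →
      s'.freg 1 = (C l).scalar i →
      IG l i (mask s') → wp M gs (fun s'' => IF l i 0 (mask s'')) s')
    (hfs : ∀ (l : Fin c) (i : Fin (C l).topFanin) (j : Fin ((C l).fanin i)) s',
      (∀ r, (walk cs gs fs cf fe ge ce).wr r = false → s'.reg r = s.reg r) →
      s'.freg 1 = ((C l).factor i j).const →
      IF l i j (mask s') → wp M fs (fun s'' => IV l i j 0 (mask s'')) s')
    (hcf : ∀ (l : Fin c) (i : Fin (C l).topFanin) (j : Fin ((C l).fanin i)) (v : Fin n) s',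
      (∀ r, (walk cs gs fs cf fe ge ce).wr r = false → s'.reg r = s.reg r) →
      s'.reg 19 = v.val → s'.freg 1 = ((C l).factor i j).coeff v →
      IV l i j v (mask s') → wp M cf (fun s'' => IV l i j (v + 1) (mask s'')) s')
    (hfe : ∀ (l : Fin c) (i : Fin (C l).topFanin) (j : Fin ((C l).fanin i)) s',
      (∀ r, (walk cs gs fs cf fe ge ce).wr r = false → s'.reg r = s.reg r) →
      IV l i j n (mask s') → wp M fe (fun s'' => IF l i (j + 1) (mask s'')) s')
    (hge : ∀ (l : Fin c) (i : Fin (C l).topFanin) s',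
      (∀ r, (walk cs gs fs cf fe ge ce).wr r = false → s'.reg r = s.reg r) →
      IF l i ((C l).fanin i) (mask s') → wp M ge (fun s'' => IG l (i + 1) (mask s'')) s')
    (hce : ∀ (l : Fin c) s', (∀ r, (walk cs gs fs cf fe ge ce).wr r = false → s'.reg r = s.reg r) →
      IG l (C l).topFanin (mask s') → wp M ce (fun s'' => IC (l + 1) (mask s'')) s')
    (hQ : ∀ s', Frame (walk cs gs fs cf fe ge ce) s s' → s'.reg 17 = (fieldCode C).length →
      IC c (mask s') → Q s') : wp M (walk cs gs fs cf fe ge ce) Q s := by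
  refine wp_conseq (Q := fun s' => s'.reg 17 = (fieldCode C).length ∧ IC c (mask s')) ?_
    fun s' f h => hQ s' f h.1 h.2
  simp only [List.mem_cons, List.not_mem_nil, or_false, forall_eq_or_imp, forall_eq] at hw
  obtain ⟨wcs, wgs, wfs, wcf, wfe, wge, wce⟩ := hw
  set K : RamState F → Prop := fun s' =>
    ∀ r, (walk cs gs fs cf fe ge ce).wr r = false → s'.reg r = s.reg r with hK
  have hKr : ∀ {s' s''}, K s' → (∀ r, (walk cs gs fs cf fe ge ce).wr r = false →
    s''.reg r = s'.reg r) → K s'' := fun h h' r hr => (h' r hr).trans (h r hr)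
  have hKw : ∀ {r}, r ∈ walkRegs → (walk cs gs fs cf fe ge ce).wr r = true := by
    intro r hr
    simp only [walkRegs, List.mem_cons, List.not_mem_nil, or_false] at hr
    rcases hr with rfl | rfl | rfl | rfl | rfl | rfl | rfl | rfl | rfl <;>
      simp [walk, wr, forDo]
  have hKm : ∀ {r}, (walk cs gs fs cf fe ge ce).wr r = false → r ∉ walkRegs := fun hr h => by
    rw [hKw h] at hr; cases hr
  have sub : ∀ {r}, (walk cs gs fs cf fe ge ce).wr r = false → cs.wr r = false ∧ gs.wr r = false ∧
      fs.wr r = false ∧ cf.wr r = false ∧ fe.wr r = false ∧ ge.wr r = false ∧ ce.wr r = false := by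
    simp +contextual [walk, wr, forDo]
  have maskTick : ∀ (s' : RamState F) {i : ℕ} (k x : ℕ), i ∈ walkRegs →
      mask (tick s' i k x) = mask s' := fun s' i k x hi => by
    refine mask_eq (fun r hr => ?_) (fun _ _ => rfl) rfl rfl
    have h1 : r ≠ i := by rintro rfl; exact hr hi
    have h2 : r ≠ 1 := by rintro rfl; exact hr (by decide)
    simp [h1, h2]
  have KTick : ∀ {s' : RamState F} {i : ℕ} (k x : ℕ), i ∈ walkRegs → K s' →
      K (tick s' i k x) := fun k x hi h => hKr h fun r hr => by
    have hr' := hKm hr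
    have h1 : r ≠ _ := fun h => hr' (h ▸ hi)
    have h2 : r ≠ 1 := by rintro rfl; exact hr' (by decide)
    simp [h1, h2]
  set R : RamState F → List ℕ → List F → Prop := fun s' A B =>
    Reads (fun a => (shapeCode C).getD a 0) (shapeCode C).length (s'.reg 16) A ∧
    Reads (fun a => (fieldCode C).getD a 0) (fieldCode C).length (s'.reg 17) B with hR
  have hK6 : ∀ {s'}, K s' → s'.reg 6 = 1 := fun h => (h 6 (by
    simp [walk, wr, forDo, wcs, wgs, wfs, wcf, wfe, wge, wce])).trans h6
  have hK2 : ∀ {s'}, K s' → s'.reg 2 = n := fun h => (h 2 (by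
    simp [walk, wr, forDo, wcs, wgs, wfs, wcf, wfe, wge, wce])).trans h2
  -- reading one field element
  have readF : ∀ {s' : RamState F} {A B x}, K s' → InputOK C (mask s') → R s' A (x :: B) →
      ∀ {q Q'}, (∀ s'', K s'' → mask s'' = mask s' → R s'' A B → s''.freg 1 = x →
        (∀ r, r ≠ 17 → s''.reg r = s'.reg r) → wp M q Q' s'') →
      wp M (fload 1 17 ;; add 17 17 6 ;; q) Q' s' := by
    intro s' A B x hK' hin hR' q Q' hq
    have hx := hR'.2.head
    refine hq _ (hKr hK' fun r hr => ?_) (mask_eq (fun r hr => ?_) (fun r hr => ?_) rfl rfl)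
      ⟨?_, ?_⟩ ?_ fun r hr => ?_
    · have := hKm hr
      exact Function.update_of_ne (by rintro rfl; exact this (by decide)) _ _
    · exact Function.update_of_ne (by rintro rfl; exact hr (by decide)) _ _
    · exact Function.update_of_ne hr _ _
    · simpa using hR'.1
    · simpa [hK6 hK'] using hR'.2.tail
    · rw [← hx.1, ← hin.2 _ hx.2]; simp [mask]
    · exact Function.update_of_ne hr _ _
  -- reading one entry of the shape
  have readN : ∀ {s' : RamState F} {A B x d}, K s' → InputOK C (mask s') → R s' (x :: A) B →
      d ∈ [21, 23] →
      ∀ {q Q'}, (∀ s'', K s'' → mask s'' = mask s' → R s'' A B → s''.reg d = x →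
        (∀ r, r ≠ 16 → r ≠ d → s''.reg r = s'.reg r) → wp M q Q' s'') →
      wp M (load d 16 ;; add 16 16 6 ;; q) Q' s' := by
    intro s' A B x d hK' hin hR' hd q Q' hq
    have hx := hR'.1.head
    have hd' : d ∈ walkRegs ∧ d ≠ 16 ∧ d ≠ 17 ∧ d ≠ 6 := by
      simp only [List.mem_cons, List.not_mem_nil, or_false] at hd
      rcases hd with rfl | rfl <;> decide
    obtain ⟨hdw, hd16, hd17, hd6⟩ := hd'
    refine hq _ (hKr hK' fun r hr => ?_) (mask_eq (fun r hr => ?_) (fun r hr => rfl) rfl rfl)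
      ⟨?_, ?_⟩ ?_ fun r hr hr' => ?_
    · have := hKm hr
      have h1 : r ≠ 16 := by rintro rfl; exact this (by decide)
      have h2 : r ≠ d := by rintro rfl; exact this hdw
      simp [h1, h2]
    · have h1 : r ≠ 16 := by rintro rfl; exact hr (by decide)
      have h2 : r ≠ d := by rintro rfl; exact hr hdw
      simp [h1, h2]
    · simpa [hd16.symm, hd6.symm, hK6 hK'] using hR'.1.tail
    · simpa [hd17.symm] using hR'.2
    · rw [← hx.1, ← hin.1 _ hx.2]; simp [mask, hd16]
    · simp [hr, hr']
  -- the loop over the coefficients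
  have loopV : ∀ l i j s' A, K s' → IV l i j 0 (mask s') → R s' A (fieldFrom₄ C l i j 0) →
      wp M (forDo 19 2 (fload 1 17 ;; add 17 17 6 ;; cf)) (fun s'' => K s'' ∧
        IV l i j n (mask s'') ∧ R s'' A (fieldFrom₃ C l i (j + 1))) s' := by
    intro l i j s' A hK' hI hR'
    refine wp_forDo (Inv := fun k s'' => K s'' ∧ IV l i j k (mask s'') ∧
      R s'' A (fieldFrom₄ C l i j k)) (by simp [wr, wcf]) (by simp [wr, wcf]) (by decide)
      (by rw [hK2 hK']; exact hMn) ⟨KTick _ _ (by decide) hK', ?_, by simpa [hR] using hR'⟩ ?_ ?_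
    · rwa [maskTick _ _ _ (by decide)]
    · rintro k s₁ hk - hi ⟨hK₁, hI₁, hR₁⟩
      rw [hK2 hK'] at hk
      rw [fieldFrom₄_fin C l i j ⟨k, hk⟩] at hR₁
      refine readF hK₁ (hIV _ _ _ _ _ hI₁) hR₁ fun s₂ hK₂ hm hR₂ hx hr => ?_
      refine wp_conseq (hcf l i j ⟨k, hk⟩ s₂ hK₂ ?_ hx (hm ▸ hI₁)) fun s₃ f hI₃ => ?_
      · rw [hr 19 (by decide), hi]
      · refine ⟨KTick _ _ (by decide) (hKr hK₂ fun r hr => f.reg r (sub hr).2.2.2.1), ?_, ?_⟩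
        · rwa [maskTick _ _ _ (by decide)]
        · simpa [hR, f.reg 16 (by simp [wcf]), f.reg 17 (by simp [wcf])] using hR₂
    · rintro s₁ - ⟨hK₁, hI₁, hR₁⟩
      rw [hK2 hK'] at hI₁ hR₁
      exact ⟨hK₁, hI₁, fieldFrom₄_end C l i j ▸ hR₁⟩
  -- the loop over the factors
  have loopF : ∀ l i s' A, K s' → IF l i 0 (mask s') → R s' A (fieldFrom₃ C l i 0) →
      s'.reg 23 = (C l).fanin i →
      wp M (forDo 24 23 (fload 1 17 ;; add 17 17 6 ;; fs ;;
        forDo 19 2 (fload 1 17 ;; add 17 17 6 ;; cf) ;; fe)) (fun s'' => K s'' ∧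
        IF l i ((C l).fanin i) (mask s'') ∧ R s'' A (fieldFrom₂ C l (i + 1))) s' := by
    intro l i s' A hK' hI hR' h23
    refine wp_forDo (Inv := fun k s'' => K s'' ∧ IF l i k (mask s'') ∧
      R s'' A (fieldFrom₃ C l i k)) (by simp [wr, forDo, wcf, wfs, wfe])
      (by simp [wr, forDo, wcf, wfs, wfe]) (by decide)
      (by rw [h23]; exact hMf l i) ⟨KTick _ _ (by decide) hK', ?_, by simpa [hR] using hR'⟩ ?_ ?_
    · rwa [maskTick _ _ _ (by decide)]
    · rintro k s₁ hk - hi ⟨hK₁, hI₁, hR₁⟩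
      rw [h23] at hk
      rw [fieldFrom₃_fin C l i ⟨k, hk⟩] at hR₁
      refine readF hK₁ (hIF _ _ _ _ hI₁) hR₁ fun s₂ hK₂ hm hR₂ hx hr => ?_
      refine wp_conseq (p := fs) (hfs l i ⟨k, hk⟩ s₂ hK₂ hx (hm ▸ hI₁)) fun s₃ f hI₃ => ?_
      refine wp_conseq (p := forDo 19 2 _) (loopV l i ⟨k, hk⟩ s₃ A
        (hKr hK₂ fun r hr => f.reg r (sub hr).2.2.1) hI₃
        (by simpa [hR, f.reg 16 (by simp [wfs]), f.reg 17 (by simp [wfs])] using hR₂))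
        fun s₄ _ ⟨hK₄, hI₄, hR₄⟩ => ?_
      refine wp_conseq (p := fe) (hfe l i ⟨k, hk⟩ s₄ hK₄ hI₄) fun s₅ f hI₅ => ?_
      refine ⟨KTick _ _ (by decide) (hKr hK₄ fun r hr => f.reg r (sub hr).2.2.2.2.1), ?_, ?_⟩
      · rwa [maskTick _ _ _ (by decide)]
      · simpa [hR, f.reg 16 (by simp [wfe]), f.reg 17 (by simp [wfe])] using hR₄
    · rintro s₁ - ⟨hK₁, hI₁, hR₁⟩
      rw [h23] at hI₁ hR₁
      exact ⟨hK₁, hI₁, fieldFrom₃_end C l i ▸ hR₁⟩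
  -- the loop over the gates
  have loopG : ∀ l s', K s' → IG l 0 (mask s') → R s' (shapeFrom₂ C l 0) (fieldFrom₂ C l 0) →
      s'.reg 21 = (C l).topFanin →
      wp M (forDo 22 21 (load 23 16 ;; add 16 16 6 ;; fload 1 17 ;; add 17 17 6 ;; gs ;;
        forDo 24 23 (fload 1 17 ;; add 17 17 6 ;; fs ;;
        forDo 19 2 (fload 1 17 ;; add 17 17 6 ;; cf) ;; fe) ;; ge)) (fun s'' => K s'' ∧
        IG l (C l).topFanin (mask s'') ∧ R s'' (shapeFrom C (l + 1)) (fieldFrom C (l + 1))) s' := by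
    intro l s' hK' hI hR' h21
    refine wp_forDo (Inv := fun k s'' => K s'' ∧ IG l k (mask s'') ∧
      R s'' (shapeFrom₂ C l k) (fieldFrom₂ C l k)) (by simp [wr, forDo, wcf, wfs, wfe, wgs, wge])
      (by simp [wr, forDo, wcf, wfs, wfe, wgs, wge]) (by decide)
      (by rw [h21]; exact hMt l) ⟨KTick _ _ (by decide) hK', ?_, by simpa [hR] using hR'⟩ ?_ ?_
    · rwa [maskTick _ _ _ (by decide)]
    · rintro k s₁ hk - hi ⟨hK₁, hI₁, hR₁⟩
      rw [h21] at hk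
      rw [fieldFrom₂_fin C l ⟨k, hk⟩, shapeFrom₂_fin C l ⟨k, hk⟩] at hR₁
      refine readN hK₁ (hIG _ _ _ hI₁) hR₁ (by decide) fun s₂ hK₂ hm₂ hR₂ hx₂ hr₂ => ?_
      refine readF hK₂ (hm₂ ▸ hIG _ _ _ hI₁) hR₂ fun s₃ hK₃ hm₃ hR₃ hx₃ hr₃ => ?_
      refine wp_conseq (p := gs) (hgs l ⟨k, hk⟩ s₃ hK₃ hx₃ (hm₃ ▸ hm₂ ▸ hI₁)) fun s₄ f hI₄ => ?_
      refine wp_conseq (p := forDo 24 23 _) (loopF l ⟨k, hk⟩ s₄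
        (shapeFrom₂ C l (k + 1))
        (hKr hK₃ fun r hr => f.reg r (sub hr).2.1) hI₄
        (by simpa [hR, f.reg 16 (by simp [wgs]), f.reg 17 (by simp [wgs])] using hR₃)
        (by rw [f.reg 23 (by simp [wgs]), hr₃ 23 (by decide), hx₂]))
        fun s₅ _ ⟨hK₅, hI₅, hR₅⟩ => ?_
      refine wp_conseq (p := ge) (hge l ⟨k, hk⟩ s₅ hK₅ hI₅) fun s₆ f hI₆ => ?_
      refine ⟨KTick _ _ (by decide) (hKr hK₅ fun r hr => f.reg r (sub hr).2.2.2.2.2.1), ?_, ?_⟩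
      · rwa [maskTick _ _ _ (by decide)]
      · simpa [hR, f.reg 16 (by simp [wge]), f.reg 17 (by simp [wge])] using hR₅
    · rintro s₁ - ⟨hK₁, hI₁, hR₁⟩
      rw [h21] at hI₁ hR₁
      exact ⟨hK₁, hI₁, shapeFrom₂_end C l ▸ fieldFrom₂_end C l ▸ hR₁⟩
  -- the loop over the circuits
  have hstart : ∀ x : ℕ → ℕ, (∀ r, r ∉ walkRegs → x r = s.reg r) →
      K ⟨x, s.freg, s.mem, s.fmem⟩ ∧ mask ⟨x, s.freg, s.mem, s.fmem⟩ = mask s := fun x hx =>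
    ⟨fun r hr => hx r (hKm hr), mask_eq hx (fun _ _ => rfl) rfl rfl⟩
  have h16 : ∀ r, r ∉ walkRegs →
      Function.update (Function.update s.reg 16 2) 17 0 r = s.reg r := fun r hr => by
    have h1 : r ≠ 16 := by rintro rfl; exact hr (by decide)
    have h2 : r ≠ 17 := by rintro rfl; exact hr (by decide)
    simp [h1, h2]
  obtain ⟨hK₀, hm₀⟩ := hstart _ h16
  refine wp_forDo (p := cs ;; _) (Inv := fun k s'' => K s'' ∧ IC k (mask s'') ∧
      R s'' (shapeFrom C k) (fieldFrom C k))
      (by simp [wr, forDo, wcf, wfs, wfe, wgs, wge, wcs, wce])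
      (by simp [wr, forDo, wcf, wfs, wfe, wgs, wge, wcs, wce]) (by decide)
      (by simpa [h3] using hMc) ⟨KTick _ _ (by decide) hK₀, ?_, ?_⟩ ?_ ?_
  · rw [maskTick _ _ _ (by decide)]
    exact hm₀ ▸ h0
  · have r1 := Reads.of_getD (shapeCode C) 0
    rw [shapeCode_eq] at r1
    have r2 := Reads.of_getD (fieldCode C) 0
    have r1' := r1.tail.tail
    rw [← shapeCode_eq] at r1'
    rw [← fieldCode_eq]
    exact ⟨by simpa using r1', by simpa using r2⟩
  · rintro k s₁ hk - hi ⟨hK₁, hI₁, hR₁⟩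
    have hk : k < c := by simpa [h3] using hk
    rw [fieldFrom_fin C ⟨k, hk⟩, shapeFrom_fin C ⟨k, hk⟩] at hR₁
    refine wp_conseq (p := cs) (hcs ⟨k, hk⟩ s₁ hK₁ hI₁) fun s₂ f hI₂ => ?_
    have hK₂ : K s₂ := hKr hK₁ fun r hr => f.reg r (sub hr).1
    have hR₂ : R s₂ ((C ⟨k, hk⟩).topFanin :: shapeFrom₂ C ⟨k, hk⟩ 0)
        (fieldFrom₂ C ⟨k, hk⟩ 0) := by
      simpa [hR, f.reg 16 (by simp [wcs]), f.reg 17 (by simp [wcs])] using hR₁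
    refine readN hK₂ (hIG _ _ _ hI₂) hR₂ (by decide) fun s₃ hK₃ hm₃ hR₃ hx₃ hr₃ => ?_
    refine wp_conseq (p := forDo 22 21 _) (loopG ⟨k, hk⟩ s₃ hK₃ (hm₃ ▸ hI₂) hR₃ hx₃)
      fun s₄ _ ⟨hK₄, hI₄, hR₄⟩ => ?_
    refine wp_conseq (p := ce) (hce ⟨k, hk⟩ s₄ hK₄ hI₄) fun s₅ f hI₅ => ?_
    refine ⟨KTick _ _ (by decide) (hKr hK₄ fun r hr => f.reg r (sub hr).2.2.2.2.2.2), ?_, ?_⟩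
    · rwa [maskTick _ _ _ (by decide)]
    · simpa [hR, f.reg 16 (by simp [wce]), f.reg 17 (by simp [wce])] using hR₄
  · rintro s₁ - ⟨hK₁, hI₁, hR₁⟩
    have h3' : Function.update (Function.update s.reg 16 2) 17 0 3 = c := by simp [h3]
    simp only [h3'] at hI₁ hR₁
    refine ⟨?_, hI₁⟩
    have := hR₁.2.1
    rw [fieldFrom, drop_ofFn_self] at this
    simpa using this

end
end RamProgram

theorem splice_succ_of_eq {α : Type*} {k : ℕ} {f g : ℕ → α} (h : f k = g k) :
    splice (k + 1) f g = splice k f g := by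
  rw [← update_splice, h]
  funext e
  by_cases he : e = k
  · subst he; simp [splice]
  · simp [he]

namespace RamProgram
open DepthThreeCircuit

section
variable {F : Type*} [Field F]

@[simp] theorem mask_mem (s : RamState F) : (mask s).mem = s.mem := rfl

@[simp] theorem mask_fmem (s : RamState F) : (mask s).fmem = s.fmem := rfl

theorem mask_reg (s : RamState F) {r : ℕ} (hr : r ∉ walkRegs) : (mask s).reg r = s.reg r :=
  if_neg hr

end

/-! Header: `reg 2 = n`, `reg 3 = c`, `reg 4` is the length of the shape, `reg 5` is twice that,
`reg 6 = 1`; the registers `10` to `14` hold the addresses of the first five rows of an array. -/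

def header : RamProgram :=
  set 6 1 ;; load 2 0 ;; load 3 6 ;; set 4 2 ;;
  forDo 8 3 (load 9 4 ;; add 4 4 9 ;; add 4 4 6) ;;
  add 5 4 4 ;; add 10 4 0 ;; add 11 10 2 ;; add 12 11 2 ;; add 13 12 2 ;; add 14 13 2

section
variable {F : Type*} [Field F] {n c : ℕ}

/-- The constants computed by `header`. -/
structure Header (n c S : ℕ) (r : ℕ → ℕ) : Prop where
  r0 : r 0 = 0
  r2 : r 2 = n
  r3 : r 3 = c
  r4 : r 4 = S
  r5 : r 5 = S + S
  r6 : r 6 = 1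
  r10 : r 10 = S
  r11 : r 11 = S + n
  r12 : r 12 = S + 2 * n
  r13 : r 13 = S + 3 * n
  r14 : r 14 = S + 4 * n

theorem wp_header {M : ℕ} (C : Fin c → DepthThreeCircuit F n) (hM : c ≤ M)
    {Q : RamState F → Prop}
    (hQ : ∀ s', Frame header (inputState C) s' → Header n c (shapeCode C).length s'.reg → Q s') :
    wp M header (fun s' => Q s') (inputState C) := by
  refine wp_conseq (p := header) (Q := fun s' => Header n c (shapeCode C).length s'.reg) ?_ hQ
  have hm0 : (inputState C).mem 0 = n := by simp [inputState, shapeCode_eq]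
  have hm1 : (inputState C).mem 1 = c := by simp [inputState, shapeCode_eq]
  have hr : ∀ r, (inputState C).reg r = 0 := fun _ => rfl
  have hmem : (inputState C).mem = fun a => (shapeCode C).getD a 0 := rfl
  have hfs : ∀ r, (inputState C).freg r = 0 := fun _ => rfl
  generalize inputState C = s at *
  refine wp_forDo (Inv := fun k s' => Reads (fun a => (shapeCode C).getD a 0)
    (shapeCode C).length (s'.reg 4) (shapeFrom C k)) rfl rfl (by decide) ?_ ?_ ?_ ?_
  · simpa [hr, hm1] using hM
  · have r1 := Reads.of_getD (shapeCode C) 0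
    rw [shapeCode_eq] at r1
    have r1' := r1.tail.tail
    rw [← shapeCode_eq] at r1'
    simpa using r1'
  · intro k s' hk f hi hI
    have hk : k < c := by simpa [hr, hm1] using hk
    rw [shapeFrom_fin C ⟨k, hk⟩] at hI
    have e6 := f.reg 6 rfl
    have em := f.mem rfl
    simp at e6 em
    have hx := hI.head
    simp only [wp]
    have ht := hI.tail
    have key : s'.reg 4 + (C ⟨k, hk⟩).topFanin + 1 + (shapeFrom C (k + 1)).length =
        (shapeCode C).length ∧ Reads (fun a => (shapeCode C).getD a 0)
        (shapeCode C).length (s'.reg 4 + (C ⟨k, hk⟩).topFanin + 1) (shapeFrom C (k + 1)) := by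
      have gen : ∀ i ≤ (C ⟨k, hk⟩).topFanin, Reads (fun a => (shapeCode C).getD a 0)
          (shapeCode C).length (s'.reg 4 + 1 + i) (shapeFrom₂ C ⟨k, hk⟩ i) := by
        intro i hi
        induction i with
        | zero => simpa using ht
        | succ i ih =>
          have := ih (by omega)
          rw [shapeFrom₂_fin C ⟨k, hk⟩ ⟨i, by omega⟩] at this
          exact this.tail
      have := gen _ le_rfl
      rw [shapeFrom₂_end] at this
      have e : s'.reg 4 + 1 + (C ⟨k, hk⟩).topFanin = s'.reg 4 + (C ⟨k, hk⟩).topFanin + 1 := by omega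
      rw [e] at this
      exact ⟨this.1, this⟩
    have hx1 : s'.mem (s'.reg 4) = (C ⟨k, hk⟩).topFanin := by
      rw [em, hmem]; exact hx.1
    simpa [e6, hx1] using key.2
  · intro s' f hI
    have e0 := f.reg 0 rfl
    have e2 := f.reg 2 rfl
    have e3 := f.reg 3 rfl
    have e6 := f.reg 6 rfl
    simp [hr, hm0, hm1] at e0 e2 e3 e6 hI
    have e4 : s'.reg 4 = (shapeCode C).length := by
      have := hI.1
      rw [shapeFrom_end] at this
      simpa using this
    simp only [wp]
    constructor <;> simp [e0, e2, e3, e4, e6] <;> ring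

end

/-! Colors: row `4 + l` of the array receives the connected components of circuit `l`. -/

/-- Replace the color `reg 27` by `reg 28` in the row at `reg 15`. -/
def relabel : RamProgram :=
  forDo 29 2 (add 20 15 29 ;; load 30 20 ;; sub 31 30 27 ;; sub 32 27 30 ;; add 31 31 32 ;;
    ifz 31 (store 20 28) skip)

/-- At the start of a circuit all variables have different colors. -/
def colorStart : RamProgram := forDo 29 2 (add 20 15 29 ;; store 20 29)

/-- Merge the color of the current variable with that of the first variable of the factor. -/
def colorStep : RamProgram :=
  fifz 1 skip (ifz 25 (set 25 1 ;; add 26 19 0)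
    (add 20 15 19 ;; load 27 20 ;; add 20 15 26 ;; load 28 20 ;; relabel))

def colors : RamProgram :=
  add 15 14 0 ;; walk colorStart skip (set 25 0) colorStep skip skip (add 15 15 2)

section
variable {F : Type*} [Field F] {n c : ℕ}

theorem wp_relabel {M S q : ℕ} {inp : ℕ → ℕ} {B : ℕ → ℕ → ℕ} {s : RamState F}
    {Q : RamState F → Prop} (hn : s.reg 2 = n) (hM : n ≤ M) (hq : s.reg 15 = S + q * n)
    (h : Grid S n inp B s.mem)
    (hQ : ∀ s', Frame relabel s s' → Grid S n inp (Function.update B q fun v =>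
      if B q v = s.reg 27 then s.reg 28 else B q v) s'.mem → Q s') : wp M relabel Q s := by
  refine wp_forDo (Inv := fun k s' => Grid S n inp (Function.update B q
    (splice k (fun v => if B q v = s.reg 27 then s.reg 28 else B q v) (B q))) s'.mem)
    rfl rfl (by decide) (hn ▸ hM) (Grid.splice_start q h) ?_ ?_
  · intro k s' hk f hi hI
    have e1 := f.reg 15 rfl
    have e2 := f.reg 27 rfl
    have e3 := f.reg 28 rfl
    have r1 := hI.2 q k (hn ▸ hk)
    simp [splice_of_ge] at r1
    refine ⟨fun h0 => ?_, fun h0 => ?_⟩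
    · simp [e1, e2, hq, hi, r1] at h0
      refine hI.write_splice (hn ▸ hk) ?_ ?_
      · simp [e1, hq, hi]
      · simp [e3]; intro h; omega
    · simp [e1, e2, hq, hi, r1] at h0
      change Grid _ _ _ _ s'.mem
      rw [splice_succ_of_eq]
      · exact hI
      · rw [if_neg]; omega
  · intro s' f hI
    rw [hn] at hI
    exact hQ s' f hI.of_splice

theorem wp_colorStart {M S q : ℕ} {inp : ℕ → ℕ} {B : ℕ → ℕ → ℕ} {s : RamState F}
    {Q : RamState F → Prop} (hn : s.reg 2 = n) (hM : n ≤ M) (hq : s.reg 15 = S + q * n)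
    (h : Grid S n inp B s.mem)
    (hQ : ∀ s', Frame colorStart s s' →
      Grid S n inp (Function.update B q fun v => v) s'.mem → Q s') : wp M colorStart Q s := by
  refine wp_forDo (Inv := fun k s' => Grid S n inp (Function.update B q
    (splice k (fun v => v) (B q))) s'.mem)
    rfl rfl (by decide) (hn ▸ hM) (Grid.splice_start q h) ?_ ?_
  · intro k s' hk f hi hI
    have e1 := f.reg 15 rfl
    refine hI.write_splice (hn ▸ hk) ?_ ?_
    · simp [e1, hq, hi]
    · simp [hi]
  · intro s' f hI
    rw [hn] at hI
    exact hQ s' f hI.of_splice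

/-- Equal colors only within a part. -/
def Sound {κ : Type*} (part : Fin n → κ) (col : ℕ → ℕ) : Prop :=
  ∀ v v' : Fin n, col v = col v' → part v = part v'

/-- The variables of the given factor have the same color. -/
def Monochromatic (L : AffineForm F n) (col : ℕ → ℕ) : Prop :=
  ∀ v v' : Fin n, L.coeff v ≠ 0 → L.coeff v' ≠ 0 → col v = col v'

/-- The colors computed for the circuits before `k`. -/
def Colored {κ : Type*} (C : Fin c → DepthThreeCircuit F n) (part : Fin c → Fin n → κ) (k : ℕ)
    (B : ℕ → ℕ → ℕ) : Prop :=
  ∀ l : Fin c, l < k → Sound (part l) (B (4 + l)) ∧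
    ∀ i j, Monochromatic ((C l).factor i j) (B (4 + l))

theorem wp_colors {M : ℕ} {κ : Type*} (C : Fin c → DepthThreeCircuit F n)
    (part : Fin c → Fin n → κ)
    (hpart : ∀ l i j v v', ((C l).factor i j).coeff v ≠ 0 → ((C l).factor i j).coeff v' ≠ 0 →
      part l v = part l v') {s : RamState F} {Q : RamState F → Prop}
    (hs : Header n c (shapeCode C).length s.reg)
    (hMn : n ≤ M) (hMc : c ≤ M) (hMt : ∀ l, (C l).topFanin ≤ M) (hMf : ∀ l i, (C l).fanin i ≤ M)
    (hmem : s.mem = (inputState C).mem) (hfmem : s.fmem = (inputState C).fmem)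
    (hQ : ∀ s' B, Frame colors s s' →
      Grid (shapeCode C).length n (inputState C).mem B s'.mem → Colored C part c B →
      (∀ v, B 1 v = 0) → s'.reg 17 = (fieldCode C).length →
      s'.reg 15 = (shapeCode C).length + (4 + c) * n → Q s') : wp M colors Q s := by
  set S := (shapeCode C).length with hS
  set inp := (inputState C).mem with hinp
  have hinp' : inp = fun a => (shapeCode C).getD a 0 := rfl
  have hG0 : Grid S n inp (fun _ _ => 0) s.mem := by
    rw [hmem]
    refine ⟨fun a _ => rfl, fun q e he => ?_⟩
    rw [hinp']
    refine List.getD_eq_default _ _ ?_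
    rw [← hS]; omega
  let Base : Fin c → ℕ → (ℕ → ℕ → ℕ) → RamState F → Prop := fun l i B s' =>
    (Grid S n inp B s'.mem ∧ s'.fmem = (inputState C).fmem ∧ s'.reg 15 = S + (4 + l) * n) ∧
    (Colored C part l B ∧ (∀ v, B 1 v = 0)) ∧ Sound (part l) (B (4 + l)) ∧
      ∀ i' : Fin (C l).topFanin, i' < i → ∀ j, Monochromatic ((C l).factor i' j) (B (4 + l))
  refine wp_conseq (p := colors) (Q := fun s' => ∃ B, (Grid S n inp B s'.mem ∧ Colored C part c B ∧
    (∀ v, B 1 v = 0)) ∧ s'.reg 17 = (fieldCode C).length ∧ s'.reg 15 = S + (4 + c) * n) ?_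
    fun s' f ⟨B, h1, h2, h3⟩ => hQ s' B f h1.1 h1.2.1 h1.2.2 h2 h3
  have hin : ∀ (s' : RamState F) B, Grid S n inp B s'.mem → s'.fmem = (inputState C).fmem →
      InputOK C s' := fun s' B h1 h2 => ⟨fun a ha => h1.1 a ha, fun a _ => by rw [h2]; rfl⟩
  refine wp_walk C
    (IC := fun k s' => ∃ B, (Grid S n inp B s'.mem ∧ s'.fmem = (inputState C).fmem ∧
      s'.reg 15 = S + (4 + k) * n) ∧ Colored C part k B ∧ (∀ v, B 1 v = 0))
    (IG := fun l i s' => ∃ B, Base l i B s')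
    (IF := fun l i j s' => ∃ B, Base l i B s' ∧
      ∀ j' : Fin ((C l).fanin i), j' < j → Monochromatic ((C l).factor i j') (B (4 + l)))
    (IV := fun l i j v s' => ∃ B, Base l i B s' ∧
      (∀ j' : Fin ((C l).fanin i), j' < j → Monochromatic ((C l).factor i j') (B (4 + l))) ∧
      (s'.reg 25 = 0 → ∀ v' : Fin n, v' < v → ((C l).factor i j).coeff v' = 0) ∧
      (s'.reg 25 ≠ 0 → ∃ x : Fin n, s'.reg 26 = x ∧ ((C l).factor i j).coeff x ≠ 0 ∧
        ∀ v' : Fin n, v' < v → ((C l).factor i j).coeff v' ≠ 0 → B (4 + l) v' = B (4 + l) x))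
    (by decide) (by simpa using hs.r2) (by simpa using hs.r3) (by simpa using hs.r6)
    hMn hMc hMt hMf
    ?_ ?_ ?_ ?_ ?_ ?_ ?_ ?_ ?_ ?_ ?_ ?_
  · rintro _ _ s' ⟨B, h, -⟩; exact hin _ B h.1 h.2.1
  · rintro _ _ _ s' ⟨B, ⟨h, -⟩, -⟩; exact hin _ B h.1 h.2.1
  · rintro _ _ _ _ s' ⟨B, ⟨h, -⟩, -⟩; exact hin _ B h.1 h.2.1
  · refine ⟨_, ⟨hG0, hfmem, ?_⟩, fun l hl => absurd hl (Nat.not_lt_zero _), fun _ => rfl⟩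
    rw [mask_reg _ (by decide)]
    simp [hs.r14, hs.r0]
  · rintro l s' hK ⟨B, ⟨h1, h2, h3⟩, h4, h5⟩
    rw [mask_reg _ (by decide)] at h3
    refine wp_colorStart (n := n) ((hK 2 rfl).trans (by simpa using hs.r2)) hMn h3 h1
      fun s'' f h1' => ?_
    refine ⟨_, ⟨h1', (f.fmem rfl).trans h2, ?_⟩, ⟨fun l' hl' => ?_, fun v => ?_⟩, ?_, ?_⟩
    · rw [mask_reg _ (by decide), f.reg 15 rfl, h3]
    · have hne : (l' : ℕ) ≠ l := (show (l' : ℕ) < l from hl').ne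
      rw [Function.update_of_ne (by omega)]
      exact h4 l' hl'
    · rw [Function.update_of_ne (by omega)]
      exact h5 v
    · intro v v' h
      rw [Function.update_self] at h
      rw [Fin.ext h]
    · intro i' hi'
      exact absurd hi' (Nat.not_lt_zero _)
  · rintro l i s' hK - ⟨B, h⟩
    exact ⟨B, h, fun j' hj' => absurd hj' (Nat.not_lt_zero _)⟩
  · rintro l i j s' hK - ⟨B, h, h'⟩
    refine ⟨B, ⟨⟨h.1.1, h.1.2.1, ?_⟩, h.2⟩, h', fun _ v' hv' => absurd hv' (Nat.not_lt_zero _),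
      fun h25 => ?_⟩
    · have := h.1.2.2
      rw [mask_reg _ (by decide)] at this ⊢
      simpa using this
    · rw [mask_reg _ (by decide)] at h25
      simp at h25
  · rintro l i j v s' hK h19 hco ⟨B, ⟨⟨h1, h2, h3⟩, ⟨h4, h5⟩, h6, h7⟩, h8, h9, h10⟩
    rw [mask_reg _ (by decide)] at h3 h9 h10
    rw [mask_reg _ (by decide)] at h10
    have hn : s'.reg 2 = n := (hK 2 rfl).trans (by simpa using hs.r2)
    have h0 : s'.reg 0 = 0 := (hK 0 rfl).trans (by simpa using hs.r0)
    refine ⟨fun hc => ?_, fun hc => ⟨fun h25 => ?_, fun h25 => ?_⟩⟩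
    · rw [hco] at hc
      refine ⟨B, ⟨⟨h1, h2, ?_⟩, ⟨h4, h5⟩, h6, h7⟩, h8, fun h25 v' hv' => ?_, fun h25 => ?_⟩
      · rw [mask_reg _ (by decide)]; exact h3
      · rw [mask_reg _ (by decide)] at h25
        rcases Nat.lt_succ_iff_lt_or_eq.1 hv' with h | h
        · exact h9 h25 v' h
        · rw [Fin.ext h]; exact hc
      · rw [mask_reg _ (by decide)] at h25 ⊢
        obtain ⟨x, hx1, hx2, hx3⟩ := h10 h25
        refine ⟨x, hx1, hx2, fun v' hv' hcv => ?_⟩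
        rcases Nat.lt_succ_iff_lt_or_eq.1 hv' with h | h
        · exact hx3 v' h hcv
        · rw [Fin.ext h] at hcv; exact absurd hc hcv
    · rw [hco] at hc
      refine ⟨B, ⟨⟨h1, h2, ?_⟩, ⟨h4, h5⟩, h6, h7⟩, h8, fun h25' => ?_, fun _ => ⟨v, ?_, hc, ?_⟩⟩
      · rw [mask_reg _ (by decide)]; simpa using h3
      · rw [mask_reg _ (by decide)] at h25'; simp at h25'
      · rw [mask_reg _ (by decide)]; simp [h19, h0]
      · intro v' hv' hcv
        rcases Nat.lt_succ_iff_lt_or_eq.1 hv' with h | h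
        · exact absurd (h9 h25 v' h) hcv
        · rw [Fin.ext h]
    · rw [hco] at hc
      obtain ⟨x, hx1, hx2, hx3⟩ := h10 h25
      have rv := h1.2 (4 + l) v v.2
      have rx := h1.2 (4 + l) x x.2
      simp only [mask_mem] at rv rx
      refine wp_relabel (n := n) (q := 4 + l) (by simpa using hn) hMn (by simpa using h3)
        (by simpa using h1) fun s'' f h1' => ?_
      have e15 := f.reg 15 rfl
      have e25 := f.reg 25 rfl
      have e26 := f.reg 26 rfl
      have ef := f.fmem rfl
      simp at e15 e25 e26 ef
      simp [h3, h19, hx1, rv, rx] at h1'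
      set col' : ℕ → ℕ := fun y => if B (4 + l) y = B (4 + l) v then B (4 + l) x else B (4 + l) y
        with hcol'
      have mono : ∀ y z : ℕ, B (4 + l) y = B (4 + l) z → col' y = col' z := fun y z h => by
        simp [col', h]
      refine ⟨_, ⟨⟨h1', by simpa [ef] using h2, ?_⟩, ⟨fun l' hl' => ?_, fun y => ?_⟩, ?_, ?_⟩, ?_, ?_, ?_⟩
      · rw [mask_reg _ (by decide), e15, h3]
      · have hne : (l' : ℕ) ≠ l := (show (l' : ℕ) < l from hl').ne
        rw [Function.update_of_ne (by omega)]
        exact h4 l' hl'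
      · rw [Function.update_of_ne (by omega)]
        exact h5 y
      · rw [Function.update_self]
        have hvx := hpart l i j v x hc hx2
        intro y z hyz
        simp only [hcol'] at hyz
        split_ifs at hyz with hy hz hz
        · exact h6 y z (hy.trans hz.symm)
        · exact (h6 _ _ hy).trans (hvx.trans (h6 _ _ hyz))
        · exact (h6 _ _ hyz).trans (hvx.symm.trans (h6 _ _ hz).symm)
        · exact h6 y z hyz
      · rw [Function.update_self]
        exact fun i' hi' j' y z hy hz => mono y z (h7 i' hi' j' y z hy hz)
      · rw [Function.update_self]
        exact fun j' hj' y z hy hz => mono y z (h8 j' hj' y z hy hz)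
      · rw [mask_reg _ (by decide), e25]
        exact fun h => absurd h h25
      · rw [mask_reg _ (by decide), mask_reg _ (by decide), e26, Function.update_self]
        refine fun _ => ⟨x, hx1, hx2, fun v' hv' hcv => ?_⟩
        rcases Nat.lt_succ_iff_lt_or_eq.1 hv' with h | h
        · exact mono _ _ (hx3 v' h hcv)
        · rw [Fin.ext h]
          simp only [hcol']
          split_ifs <;> rfl
  · rintro l i j s' hK ⟨B, h, h8, h9, h10⟩
    refine ⟨B, h, fun j' hj' => ?_⟩
    rcases Nat.lt_succ_iff_lt_or_eq.1 hj' with hlt | heq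
    · exact h8 j' hlt
    · rw [Fin.ext heq]
      intro y z hy hz
      by_cases h25 : (mask s').reg 25 = 0
      · exact absurd (h9 h25 y y.2) hy
      · obtain ⟨x, -, -, hx⟩ := h10 h25
        exact (hx y y.2 hy).trans (hx z z.2 hz).symm
  · rintro l i s' hK ⟨B, ⟨h1, h2, h3, h4⟩, h8⟩
    refine ⟨B, h1, h2, h3, fun i' hi' => ?_⟩
    rcases Nat.lt_succ_iff_lt_or_eq.1 hi' with hlt | heq
    · exact h4 i' hlt
    · obtain rfl := Fin.ext heq
      exact fun j => h8 j j.2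
  · rintro l s' hK ⟨B, ⟨h1, h2, h3⟩, ⟨h4, h5⟩, h6, h7⟩
    have hn : s'.reg 2 = n := (hK 2 rfl).trans (by simpa using hs.r2)
    rw [mask_reg _ (by decide)] at h3
    refine ⟨B, ⟨h1, h2, ?_⟩, fun l' hl' => ?_, h5⟩
    · rw [mask_reg _ (by decide)]
      simp [h3, hn]; ring
    · rcases Nat.lt_succ_iff_lt_or_eq.1 hl' with hlt | heq
      · exact h4 l' hlt
      · obtain rfl := Fin.ext heq
        exact ⟨h6, fun i j => h7 i i.2 j⟩
  · rintro s' f h17 ⟨B, ⟨h1, -, h3⟩, h4, h5⟩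
    rw [mask_reg _ (by decide)] at h3
    exact ⟨B, ⟨h1, h4, h5⟩, h17, h3⟩

end
end RamProgram

namespace RamProgram
open DepthThreeCircuit

/-! Positions: row `0` of the array receives the rank of every variable when the variables are sorted
by their color in the last circuit. -/

/-- Set `reg 33` to the number of variables preceding the variable `reg 19` of color `reg 27`. -/
def countBefore : RamProgram :=
  set 33 0 ;; forDo 29 2 (add 20 32 29 ;; load 30 20 ;; sub 31 27 30 ;;
    ifz 31 (sub 31 30 27 ;; ifz 31 (sub 31 19 29 ;; ifz 31 skip (add 33 33 6)) skip)
      (add 33 33 6))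

def positions : RamProgram :=
  sub 32 15 2 ;;
  forDo 19 2 (add 20 32 19 ;; load 27 20 ;; countBefore ;; add 20 10 19 ;; store 20 33)

/-- The order of the variables by their color. -/
def Before (col : ℕ → ℕ) (v v' : ℕ) : Prop := col v' < col v ∨ col v' = col v ∧ v' < v

open Classical in
/-- The rank of a variable in the order by colors. -/
noncomputable def rank (n : ℕ) (col : ℕ → ℕ) (v : ℕ) : ℕ := Nat.count (Before col v) n

theorem Before.trans {col : ℕ → ℕ} {u v x : ℕ} (h : Before col u v) (h' : Before col v x) :
    Before col u x := by
  unfold Before at *; omega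

theorem rank_lt_rank {n : ℕ} {col : ℕ → ℕ} {v v' : ℕ} (hv : v < n) (h : Before col v' v) :
    rank n col v < rank n col v' := by
  classical
  unfold rank
  rw [Nat.count_eq_card_filter_range, Nat.count_eq_card_filter_range]
  refine Finset.card_lt_card (Finset.ssubset_iff_of_subset ?_ |>.2 ⟨v, ?_, ?_⟩)
  · intro x hx
    rw [Finset.mem_filter] at hx ⊢
    exact ⟨hx.1, h.trans hx.2⟩
  · simpa [hv] using h
  · rw [Finset.mem_filter]
    rintro ⟨-, h'⟩
    unfold Before at h'
    omega

theorem rank_lt {n : ℕ} {col : ℕ → ℕ} {v : ℕ} (hv : v < n) : rank n col v < n := by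
  classical
  unfold rank
  rw [Nat.count_eq_card_filter_range]
  refine (Finset.card_lt_card (Finset.filter_ssubset.2 ⟨v, by simpa using hv, ?_⟩)).trans_eq (by simp)
  simp [Before]

theorem before_of_rank_lt {n : ℕ} {col : ℕ → ℕ} {v v' : ℕ} (hv' : v' < n)
    (h : rank n col v < rank n col v') : Before col v' v := by
  by_contra hn
  have h1 : v = v' ∨ Before col v v' := by unfold Before at *; omega
  rcases h1 with rfl | h1
  · omega
  · have := rank_lt_rank hv' h1; omega

theorem rank_injective {n : ℕ} (col : ℕ → ℕ) :
    Function.Injective fun v : Fin n => rank n col v := by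
  intro v v' h
  by_contra hne
  have hne' : (v : ℕ) ≠ v' := fun h => hne (Fin.ext h)
  have h1 : Before col v v' ∨ Before col v' v := by unfold Before; omega
  simp only at h
  rcases h1 with h1 | h1
  · have := rank_lt_rank v'.2 h1; omega
  · have := rank_lt_rank v.2 h1; omega

section
variable {F : Type*} [Field F] {n : ℕ}

theorem wp_countBefore {M S q x : ℕ} {inp : ℕ → ℕ} {B : ℕ → ℕ → ℕ} {s : RamState F}
    {Q : RamState F → Prop} (hn : s.reg 2 = n) (h6 : s.reg 6 = 1) (hM : n ≤ M)
    (hq : s.reg 32 = S + q * n) (hx : s.reg 19 = x) (hc : s.reg 27 = B q x)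
    (h : Grid S n inp B s.mem)
    (hQ : ∀ s', Frame countBefore s s' → s'.reg 33 = rank n (B q) x → Q s') :
    wp M countBefore Q s := by
  classical
  refine wp_conseq (p := countBefore) (Q := fun s' => s'.reg 33 = rank n (B q) x) ?_ hQ
  refine wp_forDo (Inv := fun k s' => s'.reg 33 = Nat.count (Before (B q) x) k)
    rfl rfl (by decide) (by simpa [hn] using hM) (by simp) ?_ ?_
  · intro k s' hk f hi hI
    have hk : k < n := by simpa [hn] using hk
    have e1 := f.reg 32 rfl
    have e2 := f.reg 27 rfl
    have e3 := f.reg 19 rfl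
    have e4 := f.reg 6 rfl
    have e5 := f.mem rfl
    simp at e1 e2 e3 e4 e5
    have r1 := h.2 q k hk
    have hcount : Nat.count (Before (B q) x) (k + 1) = Nat.count (Before (B q) x) k +
        if Before (B q) x k then 1 else 0 := Nat.count_succ _ _
    by_cases hb : Before (B q) x k
    · rw [if_pos hb] at hcount
      unfold Before at hb
      simp only [wp]
      simp [e1, e2, e3, e4, e5, hq, hi, hx, hc, r1, h6, hI, hcount]
      omega
    · rw [if_neg hb] at hcount
      unfold Before at hb
      simp only [wp]
      simp [e1, e2, e3, e4, e5, hq, hi, hx, hc, r1, h6, hI, hcount]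
      omega
  · intro s' f hI
    simpa [hn, rank] using hI

theorem wp_positions {M S q : ℕ} {inp : ℕ → ℕ} {B : ℕ → ℕ → ℕ} {s : RamState F}
    {Q : RamState F → Prop} (hn : s.reg 2 = n) (h6 : s.reg 6 = 1) (hM : n ≤ M) (h10 : s.reg 10 = S)
    (hq : s.reg 15 = S + (q + 1) * n) (hq0 : q ≠ 0) (h : Grid S n inp B s.mem)
    (hQ : ∀ s', Frame positions s s' →
      Grid S n inp (Function.update B 0 (rank n (B q))) s'.mem → Q s') :
    wp M positions Q s := by
  refine wp_conseq (p := positions) (Q := fun s' =>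
    Grid S n inp (Function.update B 0 (rank n (B q))) s'.mem) ?_ hQ
  refine wp_forDo (Inv := fun k s' => Grid S n inp (Function.update B 0
    (splice k (rank n (B q)) (B 0))) s'.mem)
    rfl rfl (by decide) (by simpa [hn] using hM) (Grid.splice_start 0 h) ?_ ?_
  · intro k s' hk f hi hI
    have hk : k < n := by simpa [hn] using hk
    have e0 := f.reg 2 rfl
    have e1 := f.reg 32 rfl
    have e2 := f.reg 10 rfl
    have e4 := f.reg 6 rfl
    simp at e0 e1 e2 e4
    have e1' : s'.reg 32 = S + q * n := by rw [e1, hq, hn, add_mul]; omega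
    have r1 := hI.2 q k hk
    simp [hq0] at r1
    refine wp_countBefore (n := n) (S := S) (q := q) (x := k) (inp := inp) (by simpa [e0] using hn)
      (by simpa [e4] using h6) hM (by simpa using e1') (by simpa using hi) ?_ hI
      fun s'' f' hI' => ?_
    · simp [hq0, e1', hi, r1]
    · have g1 := f'.reg 10 rfl
      have g2 := f'.reg 19 rfl
      have g3 := f'.mem rfl
      simp at g1 g2 g3
      simp only [wp]
      refine Grid.write_splice (g3 ▸ hI) hk ?_ ?_
      · simp [g1, g2, e2, h10, hi]
      · simpa [hq0] using hI'
  · intro s' f hI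
    simp [hn] at hI
    exact hI.of_splice

/-! Parameters: `reg 34 = 2 ^ r` and `reg 35 = r`, where `r` is the depth of the binary trees;
`reg 38` is larger than the degree of the substituted polynomial in each of its parameters. -/

def depth : RamProgram :=
  set 34 1 ;; set 35 0 ;;
  forDo 8 2 (sub 9 2 34 ;; ifz 9 skip (add 34 34 34 ;; add 35 35 6))

def degrees : RamProgram :=
  set 36 1 ;; forDo 8 35 (add 9 36 5 ;; add 36 9 0 ;; forDo 29 5 (add 36 36 9)) ;;
  set 38 1 ;; forDo 8 2 (add 38 38 36)

theorem wp_depth {M : ℕ} {s : RamState F} {Q : RamState F → Prop} (hn : s.reg 2 = n)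
    (h6 : s.reg 6 = 1) (hM : n ≤ M)
    (hQ : ∀ s', Frame depth s s' → s'.reg 34 = 2 ^ Nat.clog 2 n → s'.reg 35 = Nat.clog 2 n → Q s') :
    wp M depth Q s := by
  refine wp_conseq (p := depth) (Q := fun s' => s'.reg 34 = 2 ^ Nat.clog 2 n ∧
    s'.reg 35 = Nat.clog 2 n) ?_ fun s' f h => hQ s' f h.1 h.2
  refine wp_forDo (Inv := fun k s' => s'.reg 34 = 2 ^ s'.reg 35 ∧ s'.reg 35 = min k (Nat.clog 2 n))
    rfl rfl (by decide) (by simpa [hn] using hM) (by simp) ?_ ?_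
  · intro k s' hk f hi ⟨hI, hI'⟩
    have e0 := f.reg 2 rfl
    have e4 := f.reg 6 rfl
    simp at e0 e4
    simp only [wp]
    refine ⟨fun h => ?_, fun h => ?_⟩
    · simp [e0, hn, hI] at h
      have := Nat.clog_le_of_le_pow (by omega : n ≤ 2 ^ s'.reg 35)
      refine ⟨by simpa using hI, ?_⟩
      simp
      omega
    · simp [e0, hn, hI] at h
      have := (Nat.lt_clog_iff_pow_lt one_lt_two).2 (by omega : 2 ^ s'.reg 35 < n)
      simp [e4, h6, hI, pow_succ, mul_two]
      omega
  · intro s' f ⟨hI, hI'⟩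
    simp [hn] at hI'
    have h1 : Nat.clog 2 n ≤ n := Nat.clog_le_of_le_pow (Nat.lt_two_pow_self).le
    rw [min_eq_right h1] at hI'
    exact ⟨hI' ▸ hI, hI'⟩

theorem wp_degrees {M w r : ℕ} {s : RamState F} {Q : RamState F → Prop} (hn : s.reg 2 = n)
    (h0 : s.reg 0 = 0) (hw : s.reg 5 = w) (hr : s.reg 35 = r) (hM : n ≤ M) (hMw : w ≤ M)
    (hMr : r ≤ M)
    (hQ : ∀ s', Frame degrees s s' → s'.reg 38 = n * (curveDegree w)^[r] 1 + 1 → Q s') :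
    wp M degrees Q s := by
  refine wp_conseq (p := degrees) (Q := fun s' => s'.reg 38 = n * (curveDegree w)^[r] 1 + 1) ?_ hQ
  refine wp_forDo (Inv := fun k s' => s'.reg 36 = (curveDegree w)^[k] 1)
    rfl rfl (by decide) (by simpa [hr] using hMr) (by simp) ?_ ?_
  · intro k s' hk f hi hI
    have e0 := f.reg 5 rfl
    have e4 := f.reg 0 rfl
    simp at e0 e4
    refine wp_forDo (Inv := fun j s'' => s''.reg 36 = (j + 1) * ((curveDegree w)^[k] 1 + w))
      rfl rfl (by decide) (by simpa [e0, hw] using hMw) (by simp [hI, e0, hw, e4, h0]) ?_ ?_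
    · intro j s'' hj f' hi' hI'
      have g1 := f'.reg 9 rfl
      simp at g1
      simp [wp, hI', g1, hI, e0, hw]
      ring
    · intro s'' f' hI'
      simp [e0, hw] at hI'
      simp [hI', Function.iterate_succ_apply', curveDegree]
  · intro s' f hI
    have e0 := f.reg 2 rfl
    simp at e0
    refine wp_forDo (Inv := fun j s'' => s''.reg 38 = j * (curveDegree w)^[r] 1 + 1)
      rfl rfl (by decide) (by simpa [e0, hn] using hM) (by simp) ?_ ?_
    · intro j s'' hj f' hi' hI'
      have g1 := f'.reg 36 rfl
      simp [hr] at g1 hI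
      simp [wp, hI', g1, hI]
      ring
    · intro s'' f' hI'
      simpa [e0, hn] using hI'

end
end RamProgram

/-! Blocks of variables -/

/-- The variables satisfying `P` have all the same color or pairwise different colors. -/
def Plain (n : ℕ) (col : ℕ → ℕ) (P : ℕ → Prop) : Prop :=
  (∀ v < n, ∀ v' < n, P v → P v' → col v = col v') ∨
    ∀ v < n, ∀ v' < n, P v → P v' → col v = col v' → v = v'

theorem Plain.mono {n : ℕ} {col : ℕ → ℕ} {P P' : ℕ → Prop} (h : Plain n col P)
    (hP : ∀ v < n, P' v → P v) : Plain n col P' :=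
  h.imp (fun h v hv v' hv' p p' => h v hv v' hv' (hP v hv p) (hP v' hv' p'))
    fun h v hv v' hv' p p' => h v hv v' hv' (hP v hv p) (hP v' hv' p')

/-- The number of nonzero entries. -/
def weight (n : ℕ) (X : ℕ → ℕ) : ℕ := Nat.count (fun v => X v ≠ 0) n

theorem weight_eq_card (n : ℕ) (X : ℕ → ℕ) :
    weight n X = ((Finset.range n).filter fun v => X v ≠ 0).card :=
  Nat.count_eq_card_filter_range _ _

/-- The size of a color class within the support of `X`. -/
def classSize (X col : ℕ → ℕ) (a n : ℕ) : ℕ := Nat.count (fun v => X v ≠ 0 ∧ col v = a) n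

theorem classSize_eq_card (X col : ℕ → ℕ) (a n : ℕ) :
    classSize X col a n = ((Finset.range n).filter fun v => X v ≠ 0 ∧ col v = a).card :=
  Nat.count_eq_card_filter_range _ _

theorem classSize_eq_zero {X col : ℕ → ℕ} {a n : ℕ} :
    classSize X col a n = 0 ↔ ∀ v < n, X v ≠ 0 → col v ≠ a := by
  rw [classSize_eq_card, Finset.card_eq_zero, Finset.filter_eq_empty_iff]
  simp

/-- The indicator of the first variables of the color classes. -/
def firsts (X col : ℕ → ℕ) (v : ℕ) : ℕ := if X v ≠ 0 ∧ classSize X col (col v) v = 0 then 1 else 0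

/-- The indicator of a color class. -/
def colorClass (X col : ℕ → ℕ) (a v : ℕ) : ℕ := if X v ≠ 0 ∧ col v = a then 1 else 0

/-- `X'` is a large part of `X` that is plain. -/
structure Thinning (n : ℕ) (col X X' : ℕ → ℕ) : Prop where
  sub : ∀ v < n, X' v ≠ 0 → X v ≠ 0
  card : weight n X ≤ weight n X' ^ 2
  plain : Plain n col fun v => X' v ≠ 0

theorem weight_le_mul {n b : ℕ} {X col : ℕ → ℕ}
    (h : ∀ v < n, X v ≠ 0 → classSize X col (col v) n ≤ b) :
    weight n X ≤ weight n (firsts X col) * b := by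
  classical
  rw [weight_eq_card, weight_eq_card]
  have key : (Finset.range n).filter (fun v => X v ≠ 0) ⊆
      ((Finset.range n).filter fun v => firsts X col v ≠ 0).biUnion fun x =>
        (Finset.range n).filter fun v => X v ≠ 0 ∧ col v = col x := by
    intro v hv
    rw [Finset.mem_filter, Finset.mem_range] at hv
    have hex : ∃ x, X x ≠ 0 ∧ col x = col v := ⟨v, hv.2, rfl⟩
    obtain ⟨h1, h2⟩ := Nat.find_spec hex
    have h3 : Nat.find hex ≤ v := Nat.find_min' hex ⟨hv.2, rfl⟩
    simp only [Finset.mem_biUnion, Finset.mem_filter, Finset.mem_range]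
    refine ⟨Nat.find hex, ⟨by omega, ?_⟩, hv.1, hv.2, h2.symm⟩
    unfold firsts
    rw [if_pos]
    · exact one_ne_zero
    · refine ⟨h1, classSize_eq_zero.2 fun y hy hXy hcy => ?_⟩
      exact Nat.find_min hex hy ⟨hXy, hcy.trans h2⟩
  refine (Finset.card_le_card key).trans (Finset.card_biUnion_le_card_mul _ _ _ fun x hx => ?_)
  rw [Finset.mem_filter, Finset.mem_range] at hx
  rw [← classSize_eq_card]
  refine h x hx.1 fun h0 => hx.2 ?_
  simp [firsts, h0]

theorem thinning_firsts {n b : ℕ} {X col : ℕ → ℕ}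
    (h : ∀ v < n, X v ≠ 0 → classSize X col (col v) n ≤ b) (hb : b ≤ weight n (firsts X col)) :
    Thinning n col X (firsts X col) := by
  refine ⟨fun v _ hv h0 => hv (by simp [firsts, h0]), ?_, Or.inr ?_⟩
  · rw [sq]
    exact (weight_le_mul h).trans (Nat.mul_le_mul_left _ hb)
  · intro v hv v' hv' h1 h2 hc
    have e1 : X v ≠ 0 ∧ classSize X col (col v) v = 0 := by
      by_contra hn; exact h1 (by simp only [firsts]; rw [if_neg hn])
    have e2 : X v' ≠ 0 ∧ classSize X col (col v') v' = 0 := by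
      by_contra hn; exact h2 (by simp only [firsts]; rw [if_neg hn])
    by_contra hne
    rcases lt_or_gt_of_ne hne with hlt | hlt
    · exact classSize_eq_zero.1 e2.2 v hlt e1.1 hc
    · exact classSize_eq_zero.1 e1.2 v' hlt e2.1 hc.symm

theorem thinning_colorClass {n a b : ℕ} {X col : ℕ → ℕ}
    (h : ∀ v < n, X v ≠ 0 → classSize X col (col v) n ≤ b) (hb : weight n (firsts X col) ≤ b)
    (ha : classSize X col a n = b) : Thinning n col X (colorClass X col a) := by
  have key : ∀ v, colorClass X col a v ≠ 0 ↔ X v ≠ 0 ∧ col v = a := fun v => by simp [colorClass]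
  refine ⟨fun v _ hv => ((key v).1 hv).1, ?_, Or.inl ?_⟩
  · have : weight n (colorClass X col a) = b := by
      rw [← ha]; simp only [weight, classSize, key]
    rw [this, sq]
    exact (weight_le_mul h).trans (Nat.mul_le_mul_right _ hb)
  · intro v hv v' hv' h1 h2
    exact ((key v).1 h1).2.trans ((key v').1 h2).2.symm

namespace RamProgram

/-- Set `reg 24` to the number of variables before `reg m` of color `reg 27` in the current set. -/
def countSame (m : ℕ) : RamProgram :=
  set 24 0 ;; forDo 29 m (add 20 12 29 ;; load 30 20 ;; ifz 30 skip
    (add 20 15 29 ;; load 30 20 ;; sub 31 30 27 ;; sub 32 27 30 ;; add 31 31 32 ;;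
      ifz 31 (add 24 24 6) skip))

/-- Mark the first variable of each color class in row `3` and find a largest class. -/
def classify : RamProgram :=
  set 21 0 ;; set 22 0 ;; set 23 0 ;;
  forDo 19 2 (add 20 12 19 ;; load 28 20 ;; ifz 28 skip
      (add 20 15 19 ;; load 27 20 ;; countSame 2 ;; sub 30 24 22 ;;
        ifz 30 skip (add 22 24 0 ;; add 23 27 0) ;;
        countSame 19 ;; ifz 24 (set 28 1 ;; add 21 21 6) (set 28 0)) ;;
    add 20 13 19 ;; store 20 28)

def keepFirsts : RamProgram :=
  forDo 19 2 (add 20 13 19 ;; load 28 20 ;; add 20 12 19 ;; store 20 28)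

def keepClass : RamProgram :=
  forDo 19 2 (add 20 12 19 ;; load 28 20 ;; ifz 28 skip
      (add 20 15 19 ;; load 27 20 ;; sub 30 27 23 ;; sub 31 23 27 ;; add 30 30 31 ;;
        ifz 30 (set 28 1) (set 28 0)) ;;
    add 20 12 19 ;; store 20 28)

/-- Thin out row `2` with respect to the coloring at `reg 15`. -/
def thin : RamProgram :=
  classify ;; sub 30 22 21 ;; ifz 30 keepFirsts keepClass

section
variable {F : Type*} [Field F] {n : ℕ} {M S l : ℕ} {inp : ℕ → ℕ} {B : ℕ → ℕ → ℕ} {s : RamState F}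
  {Q : RamState F → Prop}

theorem wp_countSame {m : ℕ} (hm : m = 2 ∨ m = 19) (h6 : s.reg 6 = 1) (hmn : s.reg m ≤ n)
    (hM : n ≤ M) (h12 : s.reg 12 = S + 2 * n) (h15 : s.reg 15 = S + (4 + l) * n)
    (h : Grid S n inp B s.mem)
    (hQ : ∀ s', Frame (countSame m) s s' →
      s'.reg 24 = classSize (B 2) (B (4 + l)) (s.reg 27) (s.reg m) → Q s') :
    wp M (countSame m) Q s := by
  refine wp_conseq (p := countSame m) (Q := fun s' =>
    s'.reg 24 = classSize (B 2) (B (4 + l)) (s.reg 27) (s.reg m)) ?_ hQ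
  have hm24 : m ≠ 24 := by omega
  refine wp_forDo (Inv := fun k s' => s'.reg 24 = classSize (B 2) (B (4 + l)) (s.reg 27) k)
    (by rcases hm with rfl | rfl <;> rfl) (by rcases hm with rfl | rfl <;> rfl)
    (by rcases hm with rfl | rfl <;> decide) (by simpa [hm24] using hmn.trans hM)
    (by simp [classSize]) ?_ ?_
  · intro k s' hk f hi hI
    have hk : k < n := by simp [hm24] at hk; omega
    have e1 := f.reg 12 (by rcases hm with rfl | rfl <;> rfl)
    have e2 := f.reg 27 (by rcases hm with rfl | rfl <;> rfl)
    have e3 := f.reg 15 (by rcases hm with rfl | rfl <;> rfl)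
    have e4 := f.reg 6 (by rcases hm with rfl | rfl <;> rfl)
    have e5 := f.mem rfl
    simp at e1 e2 e3 e4 e5
    have r1 := h.2 2 k hk
    have r2 := h.2 (4 + l) k hk
    have hcount : classSize (B 2) (B (4 + l)) (s.reg 27) (k + 1) =
      classSize (B 2) (B (4 + l)) (s.reg 27) k +
        if B 2 k ≠ 0 ∧ B (4 + l) k = s.reg 27 then 1 else 0 := Nat.count_succ _ _
    by_cases hb : B 2 k ≠ 0 ∧ B (4 + l) k = s.reg 27
    · rw [if_pos hb] at hcount
      simp only [wp]
      simp [e1, e2, e3, e4, e5, h12, h15, hi, r1, r2, h6, hI, hcount]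
      omega
    · rw [if_neg hb] at hcount
      simp only [wp]
      simp [e1, e2, e3, e4, e5, h12, h15, hi, r1, r2, h6, hI, hcount]
      omega
  · intro s' f hI
    simpa [hm24] using hI

theorem wp_classify (h0 : s.reg 0 = 0) (h2 : s.reg 2 = n) (h6 : s.reg 6 = 1)
    (hM : n ≤ M) (h12 : s.reg 12 = S + 2 * n) (h13 : s.reg 13 = S + 3 * n)
    (h15 : s.reg 15 = S + (4 + l) * n) (h : Grid S n inp B s.mem)
    (hQ : ∀ s', Frame classify s s' →
      Grid S n inp (Function.update B 3 (firsts (B 2) (B (4 + l)))) s'.mem →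
      s'.reg 21 = weight n (firsts (B 2) (B (4 + l))) →
      (∀ v < n, B 2 v ≠ 0 → classSize (B 2) (B (4 + l)) (B (4 + l) v) n ≤ s'.reg 22) →
      (s'.reg 22 = 0 ∨ classSize (B 2) (B (4 + l)) (s'.reg 23) n = s'.reg 22) → Q s') :
    wp M classify Q s := by
  set X := B 2 with hX
  set col := B (4 + l) with hcol
  refine wp_conseq (p := classify) (Q := fun s' =>
      Grid S n inp (Function.update B 3 (firsts X col)) s'.mem ∧
      s'.reg 21 = weight n (firsts X col) ∧
      (∀ v < n, X v ≠ 0 → classSize X col (col v) n ≤ s'.reg 22) ∧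
      (s'.reg 22 = 0 ∨ classSize X col (s'.reg 23) n = s'.reg 22)) ?_
      fun s' f h => hQ s' f h.1 h.2.1 h.2.2.1 h.2.2.2
  refine wp_forDo (Inv := fun k s' =>
      Grid S n inp (Function.update B 3 (splice k (firsts X col) (B 3))) s'.mem ∧
      s'.reg 21 = weight k (firsts X col) ∧
      (∀ v < k, X v ≠ 0 → classSize X col (col v) n ≤ s'.reg 22) ∧
      (s'.reg 22 = 0 ∨ classSize X col (s'.reg 23) n = s'.reg 22))
    rfl rfl (by decide) (by simpa [h2] using hM)
    ⟨Grid.splice_start 3 h, by simp [weight], by simp, by simp⟩ ?_ ?_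
  · rintro k s' hk f hi ⟨hG, h21, h22, h23⟩
    have hk : k < n := by simpa [h2] using hk
    have e0 := f.reg 0 rfl
    have e1 := f.reg 2 rfl
    have e2 := f.reg 6 rfl
    have e3 := f.reg 12 rfl
    have e4 := f.reg 13 rfl
    have e5 := f.reg 15 rfl
    simp [h0, h2, h6, h12, h13, h15] at e0 e1 e2 e3 e4 e5
    have r1 := hG.2 2 k hk
    have r2 := hG.2 (4 + l) k hk
    rw [Function.update_of_ne (by omega)] at r1 r2
    rw [← hX] at r1
    rw [← hcol] at r2
    have hcount : weight (k + 1) (firsts X col) = weight k (firsts X col) +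
        if firsts X col k ≠ 0 then 1 else 0 := Nat.count_succ _ _
    have hsplit : ∀ v < k + 1, v < k ∨ v = k := fun v hv => by omega
    have hG' : ∀ (q : ℕ) , q ≠ 3 → Function.update B 3 (splice k (firsts X col) (B 3)) q = B q :=
      fun q hq => Function.update_of_ne hq _ _
    simp only [wp]
    refine ⟨fun hz => ?_, fun hz => ?_⟩
    · simp [e3, hi, r1] at hz
      have hf : firsts X col k = 0 := by simp [firsts, hz]
      simp only [hf] at hcount
      refine ⟨?_, ?_, ?_, ?_⟩
      · refine hG.write_splice hk (by simp [e4, hi]) (by simp [e3, hi, r1, hz, hf])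
      · simpa [h21] using hcount.symm
      · intro v hv hXv
        rcases hsplit v hv with hv | rfl
        · simpa using h22 v hv hXv
        · exact absurd hz hXv
      · simpa using h23
    · simp [e3, hi, r1] at hz
      refine wp_countSame (n := n) (S := S) (l := l) (inp := inp)
        (B := Function.update B 3 (splice k (firsts X col) (B 3))) (Or.inl rfl)
        (by simp [e2]) (by simp [e1]) hM (by simp [e3]) (by simp [e5]) hG fun s₁ f₁ g₁ => ?_
      simp [e1, e3, e5, hi, r2] at g₁
      rw [Function.update_of_ne (by omega), ← hX, ← hcol] at g₁
      have a0 := f₁.reg 0 rfl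
      have a1 := f₁.reg 2 rfl
      have a2 := f₁.reg 6 rfl
      have a3 := f₁.reg 12 rfl
      have a4 := f₁.reg 13 rfl
      have a5 := f₁.reg 15 rfl
      have a6 := f₁.reg 19 rfl
      have a7 := f₁.reg 21 rfl
      have a8 := f₁.reg 22 rfl
      have a9 := f₁.reg 23 rfl
      have a10 := f₁.reg 27 rfl
      have a11 := f₁.mem rfl
      simp [e0, e1, e2, e3, e4, e5, hi, r2, h21] at a0 a1 a2 a3 a4 a5 a6 a7 a8 a9 a10 a11
      -- the second half of the step
      have rest : ∀ s₂ : RamState F, (∀ r, r ≠ 22 → r ≠ 23 → r ≠ 30 → s₂.reg r = s₁.reg r) →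
          s₂.mem = s₁.mem →
          (∀ v < k + 1, X v ≠ 0 → classSize X col (col v) n ≤ s₂.reg 22) →
          (s₂.reg 22 = 0 ∨ classSize X col (s₂.reg 23) n = s₂.reg 22) →
          wp M (countSame 19 ;; ifz 24 (set 28 1 ;; add 21 21 6) (set 28 0)) (fun s₃ =>
            wp M (add 20 13 19 ;; store 20 28) (fun s'' =>
              Grid S n inp (Function.update B 3 (splice (k + 1) (firsts X col) (B 3))) s''.mem ∧
              s''.reg 21 = weight (k + 1) (firsts X col) ∧
              (∀ v < k + 1, X v ≠ 0 → classSize X col (col v) n ≤ s''.reg 22) ∧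
              (s''.reg 22 = 0 ∨ classSize X col (s''.reg 23) n = s''.reg 22)) s₃) s₂ := by
        intro s₂ hr hm b22 b23
        have b1 := (hr 2 (by decide) (by decide) (by decide)).trans a1
        have b2 := (hr 6 (by decide) (by decide) (by decide)).trans a2
        have b3 := (hr 12 (by decide) (by decide) (by decide)).trans a3
        have b4 := (hr 13 (by decide) (by decide) (by decide)).trans a4
        have b5 := (hr 15 (by decide) (by decide) (by decide)).trans a5
        have b6 := (hr 19 (by decide) (by decide) (by decide)).trans a6
        have b7 := (hr 21 (by decide) (by decide) (by decide)).trans a7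
        have b8 := (hr 27 (by decide) (by decide) (by decide)).trans a10
        have hG₂ : Grid S n inp (Function.update B 3 (splice k (firsts X col) (B 3))) s₂.mem := by
          rw [hm, a11]; exact hG
        refine wp_countSame (n := n) (S := S) (l := l) (inp := inp)
          (B := Function.update B 3 (splice k (firsts X col) (B 3))) (Or.inr rfl)
          b2 (by rw [b6]; exact hk.le) hM b3 b5 hG₂ fun s₃ f₃ g₃ => ?_
        rw [hG' 2 (by decide), hG' (4 + l) (by omega), b6, b8, ← hX, ← hcol] at g₃
        have c1 := (f₃.reg 13 rfl).trans b4
        have c2 := (f₃.reg 19 rfl).trans b6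
        have c3 := (f₃.reg 21 rfl).trans b7
        have c4 := f₃.reg 22 rfl
        have c5 := f₃.reg 23 rfl
        have c6 := (f₃.reg 6 rfl).trans b2
        have c7 := f₃.mem rfl
        rw [← c4] at b22 b23
        rw [← c5] at b23
        have hG₃ : Grid S n inp (Function.update B 3 (splice k (firsts X col) (B 3))) s₃.mem :=
          c7 ▸ hG₂
        refine ⟨fun hz' => ?_, fun hz' => ?_⟩
        · rw [g₃] at hz'
          have hf : firsts X col k = 1 := by simp [firsts, hz, hz']
          refine ⟨hG₃.write_splice hk (by simp [c1, c2]) (by simp [hf]), ?_, ?_, ?_⟩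
          · simp [c3, c6, hcount, hf]
          · simpa using b22
          · simpa using b23
        · rw [g₃] at hz'
          have hf : firsts X col k = 0 := by simp [firsts, hz']
          refine ⟨hG₃.write_splice hk (by simp [c1, c2]) (by simp [hf]), ?_, ?_, ?_⟩
          · simp [c3, hcount, hf]
          · simpa using b22
          · simpa using b23
      refine ⟨fun hz' => ?_, fun hz' => ?_⟩
      · simp [g₁, a8] at hz'
        refine rest _ (fun r h1 h2 h3 => by simp [h3]) rfl ?_ ?_
        · intro v hv hXv
          refine le_of_le_of_eq ?_ a8.symm
          rcases hsplit v hv with hv | rfl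
          · exact h22 v hv hXv
          · omega
        · simpa [a8, a9] using h23
      · simp [g₁, a8] at hz'
        refine rest _ (fun r h1 h2 h3 => by simp [h1, h2, h3]) rfl ?_ ?_
        · intro v hv hXv
          simp [g₁, a0]
          rcases hsplit v hv with hv | rfl
          · exact (h22 v hv hXv).trans (by omega)
          · exact le_rfl
        · simp [g₁, a0, a10]
  · rintro s' f ⟨h1, h3, h4, h5⟩
    simp [h2] at h1 h3 h4 h5
    exact ⟨h1.of_splice, h3, fun v hv hX => h4 v hv hX, h5⟩

theorem wp_keepFirsts (h2 : s.reg 2 = n) (hM : n ≤ M) (h12 : s.reg 12 = S + 2 * n)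
    (h13 : s.reg 13 = S + 3 * n) (h : Grid S n inp B s.mem)
    (hQ : ∀ s', Frame keepFirsts s s' →
      Grid S n inp (Function.update B 2 (B 3)) s'.mem → Q s') : wp M keepFirsts Q s := by
  refine wp_forDo (Inv := fun k s' =>
      Grid S n inp (Function.update B 2 (splice k (B 3) (B 2))) s'.mem)
    rfl rfl (by decide) (by simpa [h2] using hM) (Grid.splice_start 2 h) ?_ ?_
  · intro k s' hk f hi hI
    have hk : k < n := h2 ▸ hk
    have e1 := (f.reg 12 rfl).trans h12
    have e2 := (f.reg 13 rfl).trans h13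
    have r1 := hI.2 3 k hk
    rw [Function.update_of_ne (by decide)] at r1
    exact hI.write_splice hk (by simp [e1, hi]) (by simp [e2, hi, r1])
  · intro s' f hI
    rw [h2] at hI
    exact hQ s' f hI.of_splice

theorem wp_keepClass (h2 : s.reg 2 = n) (hM : n ≤ M) (h12 : s.reg 12 = S + 2 * n)
    (h15 : s.reg 15 = S + (4 + l) * n) (h : Grid S n inp B s.mem)
    (hQ : ∀ s', Frame keepClass s s' →
      Grid S n inp (Function.update B 2 (colorClass (B 2) (B (4 + l)) (s.reg 23))) s'.mem → Q s') :
    wp M keepClass Q s := by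
  refine wp_forDo (Inv := fun k s' =>
      Grid S n inp (Function.update B 2 (splice k (colorClass (B 2) (B (4 + l)) (s.reg 23)) (B 2)))
        s'.mem)
    rfl rfl (by decide) (by simpa [h2] using hM) (Grid.splice_start 2 h) ?_ ?_
  · intro k s' hk f hi hI
    have hk : k < n := h2 ▸ hk
    have e1 := (f.reg 12 rfl).trans h12
    have e2 := (f.reg 15 rfl).trans h15
    have e3 := f.reg 23 rfl
    have r1 := hI.2 2 k hk
    have r2 := hI.2 (4 + l) k hk
    rw [Function.update_self, splice_of_ge _ _ le_rfl] at r1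
    rw [Function.update_of_ne (by omega)] at r2
    simp only [wp]
    refine ⟨fun hz => ?_, fun hz => ⟨fun hz' => ?_, fun hz' => ?_⟩⟩
    · simp [e1, hi, r1] at hz
      exact hI.write_splice hk (by simp [e1, hi]) (by simp [e1, hi, r1, hz, colorClass])
    · simp [e1, hi, r1] at hz
      simp [e1, e2, e3, hi, r2] at hz'
      exact hI.write_splice hk (by simp [e1, hi])
        (by simp [colorClass, hz, (by omega : B (4 + l) k = s.reg 23)])
    · simp [e1, hi, r1] at hz
      simp [e1, e2, e3, hi, r2] at hz'
      exact hI.write_splice hk (by simp [e1, hi])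
        (by simp [colorClass]; intro _; omega)
  · intro s' f hI
    rw [h2] at hI
    exact hQ s' f hI.of_splice

theorem wp_thin (h0 : s.reg 0 = 0) (h2 : s.reg 2 = n) (h6 : s.reg 6 = 1)
    (hM : n ≤ M) (h12 : s.reg 12 = S + 2 * n) (h13 : s.reg 13 = S + 3 * n)
    (h15 : s.reg 15 = S + (4 + l) * n) (h : Grid S n inp B s.mem)
    (hQ : ∀ s' X' Y, Frame thin s s' → Thinning n (B (4 + l)) (B 2) X' →
      Grid S n inp (Function.update (Function.update B 3 Y) 2 X') s'.mem → Q s') :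
    wp M thin Q s := by
  refine wp_conseq (p := thin) (Q := fun s' => ∃ X' Y, Thinning n (B (4 + l)) (B 2) X' ∧
      Grid S n inp (Function.update (Function.update B 3 Y) 2 X') s'.mem) ?_
      fun s' f ⟨X', Y, h, h'⟩ => hQ s' X' Y f h h'
  refine wp_classify (l := l) h0 h2 h6 hM h12 h13 h15 h fun s₁ f₁ hG h21 h22 h23 => ?_
  have e1 := (f₁.reg 2 rfl).trans h2
  have e2 := (f₁.reg 12 rfl).trans h12
  have e3 := (f₁.reg 13 rfl).trans h13
  have e4 := (f₁.reg 15 rfl).trans h15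
  refine ⟨fun hz => ?_, fun hz => ?_⟩
  · simp [h21] at hz
    refine wp_keepFirsts (n := n) (S := S) (inp := inp) (by simpa using e1) hM (by simpa using e2)
      (by simpa using e3) hG fun s₂ f₂ hG₂ => ?_
    rw [Function.update_self] at hG₂
    exact ⟨_, _, thinning_firsts h22 (by omega), hG₂⟩
  · simp [h21] at hz
    refine wp_keepClass (n := n) (S := S) (inp := inp) (l := l) (by simpa using e1) hM
      (by simpa using e2) (by simpa using e4) hG fun s₂ f₂ hG₂ => ?_
    rw [Function.update_of_ne (by decide), Function.update_of_ne (by omega)] at hG₂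
    refine ⟨_, _, thinning_colorClass h22 (by omega) ?_, hG₂⟩
    simp
    omega

end
end RamProgram

/-- The variables with a nonzero entry of `expo` are divided into `u` plain blocks; the entry of a
variable in block `b` is `D ^ (b + 1)`. -/
structure Blocked (n N D u : ℕ) (col : ℕ → ℕ → ℕ) (expo blk : ℕ → ℕ) : Prop where
  expo_eq : ∀ v < n, expo v ≠ 0 → expo v = D ^ (blk v + 1) ∧ blk v < u
  plain : ∀ l < N, ∀ b, Plain n (col l) fun v => expo v ≠ 0 ∧ blk v = b

/-- The indicator of the zero set. -/
def unused (expo : ℕ → ℕ) (v : ℕ) : ℕ := if expo v = 0 then 1 else 0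

/-- Put the variables with a nonzero entry of `X` into a new block. -/
def assign (X : ℕ → ℕ) (x : ℕ) (f : ℕ → ℕ) (v : ℕ) : ℕ := if X v = 0 then f v else x

theorem weight_eq_zero {n : ℕ} {X : ℕ → ℕ} : weight n X = 0 ↔ ∀ v < n, X v = 0 := by
  rw [weight_eq_card, Finset.card_eq_zero, Finset.filter_eq_empty_iff]
  simp

theorem weight_unused_assign {n : ℕ} {X expo : ℕ → ℕ} {x : ℕ} (hx : x ≠ 0)
    (hX : ∀ v < n, X v ≠ 0 → unused expo v ≠ 0) :
    weight n (unused (assign X x expo)) + weight n X = weight n (unused expo) := by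
  rw [weight_eq_card, weight_eq_card, weight_eq_card, ← Finset.card_union_of_disjoint]
  · congr 1
    ext v
    simp only [Finset.mem_union, Finset.mem_filter, Finset.mem_range]
    have := hX v
    by_cases h : X v = 0
    · simp [unused, assign, h]
    · have h1 : unused (assign X x expo) v = 0 := by simp [unused, assign, h, hx]
      exact ⟨fun h2 => h2.elim (fun h2 => absurd h1 h2.2) fun h2 => ⟨h2.1, this h2.1 h⟩,
        fun h2 => Or.inr ⟨h2.1, h⟩⟩
  · rw [Finset.disjoint_left]
    intro v h1 h2
    rw [Finset.mem_filter] at h1 h2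
    simp [unused, assign, h2.2, hx] at h1

theorem Blocked.assign {n N D u : ℕ} {col : ℕ → ℕ → ℕ} {expo blk X : ℕ → ℕ}
    (h : Blocked n N D u col expo blk) (hX : ∀ l < N, Plain n (col l) fun v => X v ≠ 0) :
    Blocked n N D (u + 1) col (assign X (D ^ (u + 1)) expo) (assign X u blk) := by
  refine ⟨fun v hv h1 => ?_, fun l hl b => ?_⟩
  · by_cases h0 : X v = 0
    · simp only [_root_.assign, h0, if_true] at h1 ⊢
      have := h.expo_eq v hv h1
      exact ⟨this.1, by omega⟩
    · simp [_root_.assign, h0]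
  · by_cases hb : b = u
    · refine (hX l hl).mono fun v hv h1 h0 => ?_
      simp only [_root_.assign, h0, if_true] at h1
      have := h.expo_eq v hv h1.1
      omega
    · refine (h.plain l hl b).mono fun v hv h1 => ?_
      by_cases h0 : X v = 0
      · simpa only [_root_.assign, h0, if_true] using h1
      · simp only [_root_.assign, h0, if_false] at h1
        exact absurd h1.2.symm hb

theorem Blocked.congr {n N D u : ℕ} {col : ℕ → ℕ → ℕ} {expo expo' blk : ℕ → ℕ}
    (h : Blocked n N D u col expo blk) (he : ∀ v < n, expo' v = expo v) :
    Blocked n N D u col expo' blk :=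
  ⟨fun v hv h1 => by rw [he v hv] at h1 ⊢; exact h.expo_eq v hv h1,
    fun l hl b => (h.plain l hl b).mono fun v hv h1 => by rwa [he v hv] at h1⟩

theorem weight_congr {n : ℕ} {X X' : ℕ → ℕ} (h : ∀ v < n, X v = X' v) : weight n X = weight n X' := by
  rw [weight_eq_card, weight_eq_card]
  congr 1
  ext v
  simp only [Finset.mem_filter, Finset.mem_range]
  constructor
  · rintro ⟨h1, h2⟩; exact ⟨h1, h v h1 ▸ h2⟩
  · rintro ⟨h1, h2⟩; exact ⟨h1, (h v h1).symm ▸ h2⟩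

namespace RamProgram

def markUnused : RamProgram :=
  forDo 19 2 (add 20 11 19 ;; load 27 20 ;; ifz 27 (set 28 1) (set 28 0) ;; add 20 12 19 ;;
    store 20 28)

def thinAll : RamProgram := add 15 14 0 ;; forDo 18 39 (thin ;; add 15 15 2)

/-- Assign `reg 37` to the variables in the current set; `reg 25` tells whether it is nonempty. -/
def assignBlock : RamProgram :=
  set 25 0 ;; forDo 19 2 (add 20 12 19 ;; load 27 20 ;; ifz 27 skip
    (set 25 1 ;; add 20 11 19 ;; store 20 37))

/-- Multiply `reg 37` by `reg 38`. -/
def grow : RamProgram := set 9 0 ;; forDo 19 38 (add 9 9 37) ;; add 37 9 0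

/-- Form one block. -/
def blockStep : RamProgram := markUnused ;; thinAll ;; assignBlock ;; ifz 25 skip grow

/-- Divide the variables into blocks. -/
def blocks : RamProgram := add 37 38 0 ;; sub 39 3 6 ;; forDo 8 2 blockStep

section
variable {F : Type*} [Field F] {n : ℕ} {M S N D : ℕ} {inp : ℕ → ℕ} {B : ℕ → ℕ → ℕ} {s : RamState F}
  {Q : RamState F → Prop}

theorem wp_markUnused (h2 : s.reg 2 = n) (hM : n ≤ M) (h11 : s.reg 11 = S + n)
    (h12 : s.reg 12 = S + 2 * n) (h : Grid S n inp B s.mem)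
    (hQ : ∀ s', Frame markUnused s s' →
      Grid S n inp (Function.update B 2 (unused (B 1))) s'.mem → Q s') : wp M markUnused Q s := by
  refine wp_forDo (Inv := fun k s' =>
      Grid S n inp (Function.update B 2 (splice k (unused (B 1)) (B 2))) s'.mem)
    rfl rfl (by decide) (by simpa [h2] using hM) (Grid.splice_start 2 h) ?_ ?_
  · intro k s' hk f hi hI
    have hk : k < n := h2 ▸ hk
    have e1 := (f.reg 11 rfl).trans h11
    have e2 := (f.reg 12 rfl).trans h12
    have r1 := hI.2 1 k hk
    rw [Function.update_of_ne (by decide), one_mul] at r1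
    refine ⟨fun hz => ?_, fun hz => ?_⟩
    · simp [e1, hi, r1] at hz
      exact hI.write_splice hk (by simp [e2, hi]) (by simp [unused, hz])
    · simp [e1, hi, r1] at hz
      exact hI.write_splice hk (by simp [e2, hi]) (by simp [unused, hz])
  · intro s' f hI
    rw [h2] at hI
    exact hQ s' f hI.of_splice

theorem wp_thinAll (h0 : s.reg 0 = 0) (h2 : s.reg 2 = n) (h6 : s.reg 6 = 1)
    (hM : n ≤ M) (h12 : s.reg 12 = S + 2 * n) (h13 : s.reg 13 = S + 3 * n)
    (h14 : s.reg 14 = S + 4 * n) (h39 : s.reg 39 = N) (hN : N ≤ M) (h : Grid S n inp B s.mem)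
    (hQ : ∀ s' B', Frame thinAll s s' → Grid S n inp B' s'.mem →
      (∀ q, q ≠ 2 → q ≠ 3 → B' q = B q) → (∀ v < n, B' 2 v ≠ 0 → B 2 v ≠ 0) →
      weight n (B 2) ≤ weight n (B' 2) ^ 2 ^ N →
      (∀ l < N, Plain n (B (4 + l)) fun v => B' 2 v ≠ 0) → Q s') :
    wp M thinAll Q s := by
  refine wp_conseq (p := thinAll) (Q := fun s' => ∃ B', Grid S n inp B' s'.mem ∧
      (∀ q, q ≠ 2 → q ≠ 3 → B' q = B q) ∧ (∀ v < n, B' 2 v ≠ 0 → B 2 v ≠ 0) ∧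
      weight n (B 2) ≤ weight n (B' 2) ^ 2 ^ N ∧
      (∀ l < N, Plain n (B (4 + l)) fun v => B' 2 v ≠ 0)) ?_
      fun s' f ⟨B', h1, h2, h3, h4, h5⟩ => hQ s' B' f h1 h2 h3 h4 h5
  refine wp_forDo (Inv := fun k s' => s'.reg 15 = S + (4 + k) * n ∧ ∃ B', Grid S n inp B' s'.mem ∧
      (∀ q, q ≠ 2 → q ≠ 3 → B' q = B q) ∧ (∀ v < n, B' 2 v ≠ 0 → B 2 v ≠ 0) ∧
      weight n (B 2) ≤ weight n (B' 2) ^ 2 ^ k ∧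
      (∀ l < k, Plain n (B (4 + l)) fun v => B' 2 v ≠ 0))
    rfl rfl (by decide) (by simpa [h39] using hN)
    ⟨by simp [h14, h0], B, h, by simp, by simp, by simp, by simp⟩ ?_ ?_
  · rintro k s' hk f hi ⟨h15, B', hG, b1, b2, b3, b4⟩
    have hk : k < N := by simpa [h39] using hk
    have e0 := f.reg 0 rfl
    have e1 := f.reg 2 rfl
    have e2 := f.reg 6 rfl
    have e3 := f.reg 12 rfl
    have e4 := f.reg 13 rfl
    simp [h0, h2, h6, h12, h13] at e0 e1 e2 e3 e4
    refine wp_thin (l := k) e0 e1 e2 hM e3 e4 h15 hG fun s₁ X' Y f₁ ht hG₁ => ?_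
    have a1 := (f₁.reg 2 rfl).trans e1
    have a2 := (f₁.reg 15 rfl).trans h15
    rw [b1 (4 + k) (by omega) (by omega)] at ht
    refine ⟨by simp [a1, a2]; ring, _, hG₁, ?_, ?_, ?_, ?_⟩
    · intro q hq hq'
      rw [Function.update_of_ne hq, Function.update_of_ne hq', b1 q hq hq']
    · rw [Function.update_self]
      exact fun v hv h1 => b2 v hv (ht.sub v hv h1)
    · rw [Function.update_self, pow_succ', pow_mul]
      exact b3.trans (Nat.pow_le_pow_left ht.card _)
    · rw [Function.update_self]
      intro l hl
      rcases Nat.lt_succ_iff_lt_or_eq.1 hl with hl | rfl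
      · exact (b4 l hl).mono ht.sub
      · exact ht.plain
  · rintro s' f ⟨-, h1⟩
    simpa [h39] using h1

theorem wp_assignBlock (h2 : s.reg 2 = n) (hM : n ≤ M) (h11 : s.reg 11 = S + n)
    (h12 : s.reg 12 = S + 2 * n) (h : Grid S n inp B s.mem)
    (hQ : ∀ s', Frame assignBlock s s' →
      Grid S n inp (Function.update B 1 (assign (B 2) (s.reg 37) (B 1))) s'.mem →
      (s'.reg 25 = 0 ↔ weight n (B 2) = 0) → Q s') : wp M assignBlock Q s := by
  refine wp_conseq (p := assignBlock) (Q := fun s' =>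
      Grid S n inp (Function.update B 1 (assign (B 2) (s.reg 37) (B 1))) s'.mem ∧
      (s'.reg 25 = 0 ↔ weight n (B 2) = 0)) ?_ fun s' f h => hQ s' f h.1 h.2
  refine wp_forDo (Inv := fun k s' =>
      Grid S n inp (Function.update B 1 (splice k (assign (B 2) (s.reg 37) (B 1)) (B 1))) s'.mem ∧
      (s'.reg 25 = 0 ↔ weight k (B 2) = 0))
    rfl rfl (by decide) (by simpa [h2] using hM) ⟨Grid.splice_start 1 h, by simp [weight]⟩ ?_ ?_
  · rintro k s' hk f hi ⟨hI, h25⟩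
    have hk : k < n := by simpa [h2] using hk
    have e1 := f.reg 11 rfl
    have e2 := f.reg 12 rfl
    have e3 := f.reg 37 rfl
    simp [h11, h12] at e1 e2 e3
    have r1 := hI.2 2 k hk
    rw [Function.update_of_ne (by decide)] at r1
    have hcount : weight (k + 1) (B 2) = weight k (B 2) + if B 2 k ≠ 0 then 1 else 0 :=
      Nat.count_succ _ _
    simp only [wp]
    refine ⟨fun hz => ?_, fun hz => ?_⟩
    · simp [e2, hi, r1] at hz
      rw [if_neg (by simpa using hz)] at hcount
      refine ⟨?_, by simpa [hcount] using h25⟩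
      rwa [splice_succ_of_eq (by simp [assign, hz])]
    · simp [e2, hi, r1] at hz
      rw [if_pos hz] at hcount
      exact ⟨hI.write_splice hk (by simp [e1, hi]) (by simp [assign, e3, hz]), by simp [hcount]⟩
  · rintro s' f ⟨hI, h25⟩
    simp [h2] at hI h25
    exact ⟨hI.of_splice, h25⟩

theorem wp_grow (h0 : s.reg 0 = 0) (hM : s.reg 38 ≤ M)
    (hQ : ∀ s', Frame grow s s' → s'.reg 37 = s.reg 38 * s.reg 37 → Q s') : wp M grow Q s := by
  refine wp_conseq (p := grow) (Q := fun s' => s'.reg 37 = s.reg 38 * s.reg 37) ?_ hQ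
  refine wp_forDo (Inv := fun j s' => s'.reg 9 = j * s.reg 37) rfl rfl (by decide)
    (by simpa using hM) (by simp) ?_ ?_
  · intro j s' hj f hi hI
    have e1 := f.reg 37 rfl
    simp at e1
    simp [wp, hI, e1]
    ring
  · intro s' f hI
    have e1 := f.reg 0 rfl
    simp [h0] at e1 hI
    simp [wp, hI, e1]

/-- The situation after `k` rounds of forming blocks; `φ` bounds the number of blocks to come. -/
def BlockState (n N D S : ℕ) (φ : ℕ → ℝ) (inp : ℕ → ℕ) (B : ℕ → ℕ → ℕ) (k : ℕ)
    (s : RamState F) : Prop :=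
  ∃ (B' : ℕ → ℕ → ℕ) (u : ℕ) (blk : ℕ → ℕ),
    Grid S n inp B' s.mem ∧ (∀ q, q ≠ 1 → q ≠ 2 → q ≠ 3 → B' q = B q) ∧
    s.reg 37 = D ^ (u + 1) ∧ Blocked n N D u (fun l => B (4 + l)) (B' 1) blk ∧
    weight n (unused (B' 1)) ≤ n - k ∧ u + φ (weight n (unused (B' 1))) ≤ φ n

theorem wp_blockStep {φ : ℕ → ℝ} {k : ℕ}
    (hφ : ∀ r x, 1 ≤ x → x ≤ r → r ≤ x ^ 2 ^ N → φ (r - x) + 1 ≤ φ r)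
    (h0 : s.reg 0 = 0) (h2 : s.reg 2 = n) (h6 : s.reg 6 = 1)
    (hM : n ≤ M) (h11 : s.reg 11 = S + n) (h12 : s.reg 12 = S + 2 * n) (h13 : s.reg 13 = S + 3 * n)
    (h14 : s.reg 14 = S + 4 * n) (h39 : s.reg 39 = N) (hN : N ≤ M) (h38 : s.reg 38 = D)
    (hD0 : D ≠ 0) (hD : D ≤ M) (h : BlockState n N D S φ inp B k s) :
    wp M blockStep (BlockState n N D S φ inp B (k + 1)) s := by
  obtain ⟨B', u, blk, hG, hB', h37, hbl, hle, hpot⟩ := h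
  refine wp_markUnused (n := n) h2 hM h11 h12 hG fun s₁ f₁ hG₁ => ?_
  refine wp_thinAll (n := n) (N := N) ((f₁.reg 0 rfl).trans h0) ((f₁.reg 2 rfl).trans h2)
    ((f₁.reg 6 rfl).trans h6) hM ((f₁.reg 12 rfl).trans h12) ((f₁.reg 13 rfl).trans h13)
    ((f₁.reg 14 rfl).trans h14) ((f₁.reg 39 rfl).trans h39) hN hG₁
    fun s₂ B₂ f₂ hG₂ g1 g2 g3 g4 => ?_
  simp only [Function.update_self] at g2 g3
  have b1 := (f₂.reg 2 rfl).trans ((f₁.reg 2 rfl).trans h2)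
  have b3 := (f₂.reg 11 rfl).trans ((f₁.reg 11 rfl).trans h11)
  have b4 := (f₂.reg 12 rfl).trans ((f₁.reg 12 rfl).trans h12)
  have b9 := (f₂.reg 37 rfl).trans ((f₁.reg 37 rfl).trans h37)
  have hB₂ : ∀ q, q ≠ 1 → q ≠ 2 → q ≠ 3 → B₂ q = B q := fun q q1 q2 q3 => by
    rw [g1 q q2 q3, Function.update_of_ne q2, hB' q q1 q2 q3]
  have hB₂1 : B₂ 1 = B' 1 := by
    rw [g1 1 (by decide) (by decide), Function.update_of_ne (by decide)]
  have g4' : ∀ l < N, Plain n (B (4 + l)) fun v => B₂ 2 v ≠ 0 := fun l hl => by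
    have := g4 l hl
    rwa [Function.update_of_ne (by omega), hB' _ (by omega) (by omega) (by omega)] at this
  refine wp_assignBlock (n := n) b1 hM b3 b4 hG₂ fun s₃ f₃ hG₃ h25 => ?_
  rw [hB₂1, b9] at hG₃
  have c9 := (f₃.reg 37 rfl).trans b9
  have c8 := (f₃.reg 38 rfl).trans ((f₂.reg 38 rfl).trans ((f₁.reg 38 rfl).trans h38))
  have c0 := (f₃.reg 0 rfl).trans ((f₂.reg 0 rfl).trans ((f₁.reg 0 rfl).trans h0))
  have hB₃ : ∀ q, q ≠ 1 → q ≠ 2 → q ≠ 3 →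
      Function.update B₂ 1 (assign (B₂ 2) (D ^ (u + 1)) (B' 1)) q = B q := fun q q1 q2 q3 => by
    rw [Function.update_of_ne q1, hB₂ q q1 q2 q3]
  refine ⟨fun hz => ?_, fun hz => ?_⟩
  · have hX := h25.1 hz
    rw [hX, zero_pow (pow_ne_zero _ two_ne_zero), Nat.le_zero] at g3
    have hX' := weight_eq_zero.1 hX
    have hsame : ∀ v < n, assign (B₂ 2) (D ^ (u + 1)) (B' 1) v = B' 1 v := fun v hv => by
      simp [assign, hX' v hv]
    have hw : weight n (unused (assign (B₂ 2) (D ^ (u + 1)) (B' 1))) = weight n (unused (B' 1)) :=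
      weight_congr fun v hv => by simp only [unused, hsame v hv]
    refine ⟨_, u, blk, hG₃, hB₃, c9, ?_, ?_, ?_⟩
    · rw [Function.update_self]
      exact hbl.congr hsame
    · rw [Function.update_self, hw, g3]
      exact Nat.zero_le _
    · rw [Function.update_self, hw]
      exact hpot
  · have hX : weight n (B₂ 2) ≠ 0 := fun h => hz (h25.2 h)
    have hw := weight_unused_assign (pow_ne_zero (u + 1) hD0) g2
    refine wp_grow c0 (by rwa [c8]) fun s₄ f₄ hI₄ => ?_
    have dm := f₄.mem rfl
    rw [c8, c9] at hI₄
    rw [← dm] at hG₃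
    refine ⟨_, u + 1, assign (B₂ 2) u blk, hG₃, hB₃, ?_, ?_, ?_, ?_⟩
    · rw [hI₄, pow_succ' D (u + 1)]
    · rw [Function.update_self]
      exact hbl.assign g4'
    · rw [Function.update_self]
      omega
    · rw [Function.update_self]
      have := hφ _ _ (Nat.one_le_iff_ne_zero.2 hX) (by omega) g3
      rw [← hw, Nat.add_sub_cancel] at this
      rw [← hw] at hpot
      push_cast
      linarith

theorem wp_blocks (φ : ℕ → ℝ) (hφ : ∀ r x, 1 ≤ x → x ≤ r → r ≤ x ^ 2 ^ N → φ (r - x) + 1 ≤ φ r)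
    (h0 : s.reg 0 = 0) (h2 : s.reg 2 = n) (h3 : s.reg 3 = N + 1) (h6 : s.reg 6 = 1)
    (hM : n ≤ M) (h11 : s.reg 11 = S + n) (h12 : s.reg 12 = S + 2 * n) (h13 : s.reg 13 = S + 3 * n)
    (h14 : s.reg 14 = S + 4 * n) (hN : N ≤ M) (h38 : s.reg 38 = D) (hD0 : D ≠ 0) (hD : D ≤ M)
    (h : Grid S n inp B s.mem) (hB : ∀ v, B 1 v = 0)
    (hQ : ∀ s' B' u blk, Frame blocks s s' → Grid S n inp B' s'.mem → B' 0 = B 0 →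
      s'.reg 37 = D ^ (u + 1) → Blocked n N D u (fun l => B (4 + l)) (B' 1) blk →
      (∀ v < n, B' 1 v ≠ 0) → u + φ 0 ≤ φ n → Q s') :
    wp M blocks Q s := by
  refine wp_conseq (p := blocks) (Q := BlockState n N D S φ inp B n) ?_ ?_
  · have hw0 : weight n (unused (B 1)) = n := by
      rw [weight_eq_card, Finset.filter_true_of_mem]
      · simp
      · intro v _; simp [unused, hB]
    refine wp_forDo (Inv := BlockState n N D S φ inp B) rfl rfl (by decide)
      (by simpa [h2] using hM)
      ⟨B, 0, fun _ => 0, h, by simp, by simp [h38, h0], ⟨?_, ?_⟩, hw0.le, by simp [hw0]⟩ ?_ ?_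
    · exact fun v _ hv => absurd (hB v) hv
    · exact fun l _ b => Or.inl fun v _ v' _ hv => absurd (hB v) hv.1
    · intro k s' hk f hi hI
      have e0 := f.reg 0 rfl
      have e1 := f.reg 2 rfl
      have e2 := f.reg 6 rfl
      have e3 := f.reg 11 rfl
      have e4 := f.reg 12 rfl
      have e5 := f.reg 13 rfl
      have e6 := f.reg 14 rfl
      have e7 := f.reg 39 rfl
      have e8 := f.reg 38 rfl
      simp [h0, h2, h6, h11, h12, h13, h14, h3, h38] at e0 e1 e2 e3 e4 e5 e6 e7 e8
      refine wp_conseq (wp_blockStep hφ e0 e1 e2 hM e3 e4 e5 e6 e7 hN e8 hD0 hD hI)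
        fun s'' f' hI' => ?_
      obtain ⟨B', u, blk, hG, hB', h37, hrest⟩ := hI'
      exact ⟨B', u, blk, hG, hB', h37, hrest⟩
    · intro s' f hI
      simpa [h2] using hI
  · rintro s' f ⟨B', u, blk, hG, hB', h37, hbl, hle, hpot⟩
    rw [Nat.sub_self, Nat.le_zero] at hle
    rw [hle] at hpot
    refine hQ s' B' u blk f hG (hB' 0 (by decide) (by decide) (by decide)) h37 hbl
      (fun v hv h0 => ?_) hpot
    have := weight_eq_zero.1 hle v hv
    simp [unused, h0] at this

end
end RamProgram

theorem PolyMem.add_monomial {F : Type*} [Field F] {base len : ℕ} {inp : ℕ → F}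
    {A : ℕ → Polynomial F} {m : ℕ → F} (h : PolyMem base len inp A m) (q : ℕ) {k : ℕ}
    (hk : k < len) {a : ℕ} (ha : a = base + q * len + k) {c x : F} (hx : x = (A q).coeff k + c) :
    PolyMem base len inp (Function.update A q (A q + Polynomial.monomial k c))
      (Function.update m a x) := by
  refine PolyMem.of_update ?_
  have := h.write (q := q) hk x
  rw [← ha] at this
  convert this using 2
  funext e
  simp only [Polynomial.coeff_add, Polynomial.coeff_monomial, Function.update_apply, hx]
  split_ifs with h1 h2 h2
  · rw [h1]
  · exact absurd h1.symm h2
  · exact absurd h2.symm h1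
  · rw [add_zero]

namespace RamProgram

/-- Multiply the accumulator by the polynomials `g - z ^ e`, `e < reg 5`, where `g` is at `reg 46`. -/
def curveProd : RamProgram :=
  forDo 22 5 (add 20 46 22 ;; fone 6 ;; fload 5 20 ;; fsub 5 5 6 ;; fstore 20 5 ;; polyMul ;;
    fload 5 20 ;; fadd 5 5 6 ;; fstore 20 5)

/-- Replace the polynomial at `reg 46` by its image under the curve selected by `reg 49`. -/
def curveStep : RamProgram :=
  set 58 0 ;; add 51 42 0 ;; fone 1 ;; polyMono ;; add 52 46 0 ;; curveProd ;;
  ifz 49 skip polyMul ;;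
  add 51 46 0 ;; fzero 1 ;; polyMono ;; add 52 42 0 ;; fone 1 ;; polyAxpy

/-- The next binary digit of `reg 47`, most significant digit first. -/
def digit : RamProgram :=
  add 47 47 47 ;; sub 48 34 47 ;; ifz 48 (sub 47 47 34 ;; set 49 1) (set 49 0)

/-- The generator of the variable `reg 19`. -/
def genOne : RamProgram :=
  add 20 11 19 ;; load 58 20 ;; add 20 10 19 ;; load 47 20 ;; add 51 46 0 ;; fone 1 ;; polyMono ;;
  forDo 18 35 (digit ;; curveStep)

def gens : RamProgram :=
  add 41 17 0 ;; add 42 41 37 ;; add 43 42 37 ;; add 44 43 37 ;; add 45 44 37 ;; add 46 45 0 ;;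
  forDo 19 2 (genOne ;; add 46 46 37)

section
variable {F : Type*} [Field F] {n : ℕ} {M base len w : ℕ} {inp : ℕ → F}
  {A : ℕ → Polynomial F} {s : RamState F} {Q : RamState F → Prop}

theorem wp_curveProd {q : ℕ} (h5 : s.reg 5 = w) (hw : w ≤ len) (h37 : s.reg 37 = len)
    (hM : len ≤ M) (h41 : s.reg 41 = base) (h42 : s.reg 42 = base + len)
    (h46 : s.reg 46 = base + q * len) (h52 : s.reg 52 = base + q * len) (hq : 2 ≤ q)
    (h : PolyMem base len inp A s.fmem) (hA : A 1 = 1)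
    (hQ : ∀ s' A', Frame curveProd s s' → PolyMem base len inp A' s'.fmem →
      A' 1 = ∏ e ∈ Finset.range w, (A q - Polynomial.X ^ e) →
      (∀ i, 2 ≤ i → A' i = A i) → Q s') : wp M curveProd Q s := by
  refine wp_forDo (Inv := fun k s' => ∃ A', PolyMem base len inp A' s'.fmem ∧
      A' 1 = ∏ e ∈ Finset.range k, (A q - Polynomial.X ^ e) ∧ ∀ i, 2 ≤ i → A' i = A i)
    rfl rfl (by decide) (by rw [h5]; exact hw.trans hM) ⟨A, h, by simpa using hA, fun _ _ => rfl⟩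
    ?_ ?_
  · rintro k s₁ hk f hi ⟨A', hA', h1, h2⟩
    have hk : k < len := by omega
    have e1 := (f.reg 37 rfl).trans h37
    have e2 := (f.reg 41 rfl).trans h41
    have e3 := (f.reg 42 rfl).trans h42
    have e4 := (f.reg 46 rfl).trans h46
    have e5 := (f.reg 52 rfl).trans h52
    have r1 := hA'.2 q k hk
    have ha : s₁.reg 46 + s₁.reg 22 = base + q * len + k := by rw [e4, hi]
    refine wp_polyMul (len := len) (base := base) (inp := inp) (q := q) (M := M)
      (A := Function.update A' q (A' q + Polynomial.monomial k (-1)))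
      (by simpa using e1) hM (by simpa using e2) (by simpa using e3) (by simpa using e5) (by omega)
      ?_ fun s₂ W f₂ hp => ?_
    · refine hA'.add_monomial q hk (by simp [ha]) ?_
      simp [ha, r1, sub_eq_add_neg]
    · have g1 := f₂.reg 20 rfl
      have g2 := f₂.freg 6 rfl
      simp [ha] at g1 g2
      rw [Function.update_self, Function.update_of_ne (by omega : 1 ≠ q)] at hp
      have r2 := hp.2 q k hk
      simp only [Function.update_of_ne (by omega : q ≠ 1), Function.update_of_ne (by omega : q ≠ 0),
        Function.update_self] at r2
      refine ⟨_, hp.add_monomial q hk (c := 1) ?_ ?_, ?_, ?_⟩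
      · simp [g1]
      · rw [Function.update_of_ne (by omega : q ≠ 1), Function.update_of_ne (by omega : q ≠ 0),
          Function.update_self]
        simp [g1, g2, r2]
      · rw [Function.update_of_ne (by omega : 1 ≠ q), Function.update_self, h1, h2 q hq,
          Finset.prod_range_succ, map_neg, Polynomial.monomial_one_right_eq_X_pow, sub_eq_add_neg]
      · intro i hi
        by_cases hiq : i = q
        · subst hiq
          rw [Function.update_self, Function.update_of_ne (by omega), Function.update_of_ne (by omega),
            Function.update_self, add_assoc, ← map_add, neg_add_cancel, map_zero, add_zero, h2 i hi]
        · rw [Function.update_of_ne hiq, Function.update_of_ne (by omega),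
            Function.update_of_ne (by omega), Function.update_of_ne hiq, h2 i hi]
  · rintro s' f ⟨A', h1, h2, h3⟩
    rw [h5] at h2
    exact hQ s' A' f h1 h2 h3

theorem wp_curveStep {q : ℕ} (h0 : s.reg 0 = 0) (h5 : s.reg 5 = w) (hw : w ≤ len)
    (h37 : s.reg 37 = len) (hlen : 0 < len)
    (hM : len ≤ M) (h41 : s.reg 41 = base) (h42 : s.reg 42 = base + len)
    (h46 : s.reg 46 = base + q * len) (hq : 2 ≤ q) (hb : s.reg 49 < 2)
    (h : PolyMem base len inp A s.fmem)
    (hQ : ∀ s' A', Frame curveStep s s' → PolyMem base len inp A' s'.fmem →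
      A' q = curve Polynomial.X w (s.reg 49) (A q) →
      (∀ i, 2 ≤ i → i ≠ q → A' i = A i) → Q s') : wp M curveStep Q s := by
  refine wp_conseq (p := curveStep) (Q := fun s' => ∃ A', PolyMem base len inp A' s'.fmem ∧
      A' q = curve Polynomial.X w (s.reg 49) (A q) ∧ ∀ i, 2 ≤ i → i ≠ q → A' i = A i) ?_
      fun s' f ⟨A', h1, h2, h3⟩ => hQ s' A' f h1 h2 h3
  refine wp_polyMono (base := base) (inp := inp) (A := A) (len := len) (q := 1) (by simpa using h37)
    hM (by simp [h42, h0]) (by simpa using hlen) h fun s₁ f₁ p₁ => ?_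
  have a0 := f₁.reg 0 rfl
  have a5 := f₁.reg 5 rfl
  have a37 := f₁.reg 37 rfl
  have a41 := f₁.reg 41 rfl
  have a42 := f₁.reg 42 rfl
  have a46 := f₁.reg 46 rfl
  have a49 := f₁.reg 49 rfl
  simp [h0, h5, h37, h41, h42, h46] at a0 a5 a37 a41 a42 a46 a49 p₁
  refine wp_curveProd (base := base) (inp := inp) (len := len) (q := q) (w := w) (by simpa using a5)
    hw (by simpa using a37) hM (by simpa using a41) (by simpa using a42) (by simpa using a46)
    (by simp [a46, a0]) hq p₁ (by simp) fun s₂ A₂ f₂ p₂ g₁ g₂ => ?_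
  rw [Function.update_of_ne (by omega : q ≠ 1)] at g₁
  have b0 := f₂.reg 0 rfl
  have b37 := f₂.reg 37 rfl
  have b41 := f₂.reg 41 rfl
  have b42 := f₂.reg 42 rfl
  have b46 := f₂.reg 46 rfl
  have b49 := f₂.reg 49 rfl
  have b52 := f₂.reg 52 rfl
  simp [a0, a37, a41, a42, a46, a49] at b0 b37 b41 b42 b46 b49 b52
  have rest : ∀ s₃ A₃, s₃.reg 0 = 0 → s₃.reg 37 = len → s₃.reg 42 = base + len →
      s₃.reg 46 = base + q * len → s₃.reg 58 = 0 → PolyMem base len inp A₃ s₃.fmem →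
      A₃ 1 = curve Polynomial.X w (s.reg 49) (A q) → (∀ i, 2 ≤ i → A₃ i = A i) →
      wp M (add 51 46 0 ;; fzero 1 ;; polyMono ;; add 52 42 0 ;; fone 1 ;; polyAxpy)
        (fun s' => ∃ A', PolyMem base len inp A' s'.fmem ∧
        A' q = curve Polynomial.X w (s.reg 49) (A q) ∧ ∀ i, 2 ≤ i → i ≠ q → A' i = A i) s₃ := by
    intro s₃ A₃ c0 c37 c42 c46 c58 p₃ g₃ g₄
    refine wp_polyMono (base := base) (inp := inp) (A := A₃) (len := len) (q := q)
      (by simpa using c37) hM (by simp [c46, c0]) (by simpa [c58] using hlen) p₃ fun s₄ f₄ p₄ => ?_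
    have d0 := f₄.reg 0 rfl
    have d37 := f₄.reg 37 rfl
    have d42 := f₄.reg 42 rfl
    have d51 := f₄.reg 51 rfl
    simp [c0, c37, c42, c46] at d0 d37 d42 d51 p₄
    refine wp_polyAxpy (base := base) (inp := inp) (A := Function.update A₃ q 0) (len := len)
      (q := q) (q' := 1) (by simpa using d37) hM (by simpa using d51) (by simp [d42, d0])
      (by omega) p₄ fun s₅ f₅ p₅ => ?_
    refine ⟨_, p₅, ?_, ?_⟩
    · rw [Function.update_self, Function.update_self, Function.update_of_ne (by omega), g₃]
      simp
    · intro i hi hiq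
      rw [Function.update_of_ne hiq, Function.update_of_ne hiq, g₄ i hi]
  have b58 := (f₂.reg 58 rfl).trans (f₁.reg 58 rfl)
  simp at b58
  have hA₂ : ∀ i, 2 ≤ i → A₂ i = A i := fun i hi => by
    rw [g₂ i hi, Function.update_of_ne (by omega)]
  refine ⟨fun hz => ?_, fun hz => ?_⟩
  · refine rest s₂ A₂ b0 b37 b42 b46 b58 p₂ ?_ hA₂
    rw [b49] at hz
    rw [g₁, hz]
    simp [curve]
  · refine wp_polyMul (base := base) (inp := inp) (A := A₂) (len := len) (q := q)
      b37 hM b41 b42 b52 (by omega) p₂ fun s₃ W f₃ p₃ => ?_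
    refine rest s₃ _ ((f₃.reg 0 rfl).trans b0) ((f₃.reg 37 rfl).trans b37)
      ((f₃.reg 42 rfl).trans b42) ((f₃.reg 46 rfl).trans b46) ((f₃.reg 58 rfl).trans b58) p₃ ?_ ?_
    · rw [b49] at hz
      rw [Function.update_self, g₁, hA₂ q hq, (by omega : s.reg 49 = 1)]
      simp [curve, mul_comm]
    · intro i hi
      rw [Function.update_of_ne (by omega), Function.update_of_ne (by omega), hA₂ i hi]

theorem wp_digit {r i j m : ℕ} (hij : i + 1 + j = r) (h34 : s.reg 34 = 2 ^ r)
    (h47 : s.reg 47 = m % 2 ^ (i + 1) * 2 ^ j)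
    (hQ : ∀ s', Frame digit s s' → s'.reg 47 = m % 2 ^ i * 2 ^ (j + 1) →
      s'.reg 49 = m / 2 ^ i % 2 → Q s') : wp M digit Q s := by
  refine wp_conseq (p := digit) (Q := fun s' => s'.reg 47 = m % 2 ^ i * 2 ^ (j + 1) ∧
    s'.reg 49 = m / 2 ^ i % 2) ?_ fun s' f h => hQ s' f h.1 h.2
  have h1 : m % 2 ^ (i + 1) = m % 2 ^ i + 2 ^ i * (m / 2 ^ i % 2) := Nat.mod_pow_succ
  have h2 : s.reg 47 + s.reg 47 = 2 ^ r * (m / 2 ^ i % 2) + m % 2 ^ i * 2 ^ (j + 1) := by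
    rw [h47, h1, ← hij, pow_add, pow_succ, pow_succ]; ring
  have h3 : m % 2 ^ i * 2 ^ (j + 1) < 2 ^ r := by
    have e : 2 ^ r = 2 ^ i * 2 ^ (j + 1) := by rw [← pow_add]; congr 1; omega
    rw [e]
    exact Nat.mul_lt_mul_of_pos_right (Nat.mod_lt _ (by positivity)) (by positivity)
  simp only [digit, wp]
  rcases Nat.mod_two_eq_zero_or_one (m / 2 ^ i) with h | h
  · rw [h, mul_zero, zero_add] at h2
    simp [h34, h2, h]
    omega
  · rw [h, mul_one] at h2
    simp [h34, h2, h]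

/-- The constants used in the computation of the generators. -/
structure GenRegs (n S base len w r : ℕ) (R : ℕ → ℕ) : Prop where
  r0 : R 0 = 0
  r2 : R 2 = n
  r5 : R 5 = w
  r10 : R 10 = S
  r11 : R 11 = S + n
  r34 : R 34 = 2 ^ r
  r35 : R 35 = r
  r37 : R 37 = len
  r41 : R 41 = base
  r42 : R 42 = base + len
  r43 : R 43 = base + 2 * len
  r44 : R 44 = base + 3 * len
  r45 : R 45 = base + 4 * len

theorem GenRegs.of_frame {F : Type*} {S r : ℕ} {p : RamProgram} {s s' : RamState F}
    (h : GenRegs n S base len w r s.reg) (f : Frame p s s')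
    (hp : ∀ i ∈ [0, 2, 5, 10, 11, 34, 35, 37, 41, 42, 43, 44, 45], p.wr i = false) :
    GenRegs n S base len w r s'.reg := by
  have key : ∀ i ∈ [0, 2, 5, 10, 11, 34, 35, 37, 41, 42, 43, 44, 45], s'.reg i = s.reg i :=
    fun i hi => f.reg i (hp i hi)
  obtain ⟨h1, h2, h3, h4, h5, h6, h7, h8, h9, h10, h11, h12, h13⟩ := h
  constructor <;> rw [key _ (by decide)] <;> assumption

theorem wp_genOne {S r v : ℕ} {inn : ℕ → ℕ} {B : ℕ → ℕ → ℕ}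
    (hR : GenRegs n S base len w r s.reg) (hG : Grid S n inn B s.mem) (hv : v < n)
    (h19 : s.reg 19 = v) (hw : w ≤ len) (hM : len ≤ M) (hr : r ≤ M)
    (h46 : s.reg 46 = base + (4 + v) * len) (hpos : B 0 v < 2 ^ r) (hexpo : B 1 v < len)
    (h : PolyMem base len inp A s.fmem)
    (hQ : ∀ s' A', Frame genOne s s' → PolyMem base len inp A' s'.fmem →
      A' (4 + v) = gen Polynomial.X w r (B 0 v) (Polynomial.X ^ B 1 v) →
      (∀ i, 2 ≤ i → i ≠ 4 + v → A' i = A i) → Q s') : wp M genOne Q s := by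
  refine wp_conseq (p := genOne) (Q := fun s' => ∃ A', PolyMem base len inp A' s'.fmem ∧
      A' (4 + v) = gen Polynomial.X w r (B 0 v) (Polynomial.X ^ B 1 v) ∧
      ∀ i, 2 ≤ i → i ≠ 4 + v → A' i = A i) ?_
      fun s' f ⟨A', h1, h2, h3⟩ => hQ s' A' f h1 h2 h3
  have r0 := hG.2 0 v hv
  have r1 := hG.2 1 v hv
  rw [zero_mul, add_zero] at r0
  rw [one_mul] at r1
  refine wp_polyMono (base := base) (inp := inp) (A := A) (len := len) (q := 4 + v)
    (by simp [hR.r37]) hM (by simp [h46, hR.r0]) (by simp [hR.r11, h19, r1, hexpo]) h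
    fun s₁ f₁ p₁ => ?_
  have a0 := f₁.reg 0 rfl
  have a5 := f₁.reg 5 rfl
  have a34 := f₁.reg 34 rfl
  have a35 := f₁.reg 35 rfl
  have a37 := f₁.reg 37 rfl
  have a41 := f₁.reg 41 rfl
  have a42 := f₁.reg 42 rfl
  have a46 := f₁.reg 46 rfl
  have a47 := f₁.reg 47 rfl
  simp [hR.r0, hR.r5, hR.r34, hR.r35, hR.r37, hR.r41, hR.r42, hR.r10, h46, h19, r0]
    at a0 a5 a34 a35 a37 a41 a42 a46 a47
  simp [hR.r11, h19, r1, Polynomial.monomial_one_right_eq_X_pow] at p₁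
  refine wp_forDo (Inv := fun j s' => s'.reg 47 = B 0 v % 2 ^ (r - j) * 2 ^ j ∧
      ∃ A', PolyMem base len inp A' s'.fmem ∧
      gen Polynomial.X w (r - j) (B 0 v) (A' (4 + v)) =
        gen Polynomial.X w r (B 0 v) (Polynomial.X ^ B 1 v) ∧
      ∀ i, 2 ≤ i → i ≠ 4 + v → A' i = A i) rfl rfl (by decide) (by rw [a35]; exact hr)
      ⟨?_, _, p₁, ?_, ?_⟩ ?_ ?_
  · simp [a47, Nat.mod_eq_of_lt hpos]
  · simp
  · intro i hi hiv
    rw [Function.update_of_ne hiv]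
  · rintro j s₂ hj f₂ hi ⟨h47, A₂, p₂, g₂, g₃⟩
    rw [a35] at hj
    have b0 := (f₂.reg 0 rfl).trans a0
    have b5 := (f₂.reg 5 rfl).trans a5
    have b34 := (f₂.reg 34 rfl).trans a34
    have b37 := (f₂.reg 37 rfl).trans a37
    have b41 := (f₂.reg 41 rfl).trans a41
    have b42 := (f₂.reg 42 rfl).trans a42
    have b46 := (f₂.reg 46 rfl).trans a46
    obtain ⟨i, hij⟩ : ∃ i, r - j = i + 1 := ⟨r - j - 1, by omega⟩
    have hi' : r - (j + 1) = i := by omega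
    rw [hij] at h47 g₂
    rw [hi']
    refine wp_digit (i := i) (r := r) (by omega) b34 h47 fun s₃ f₃ h47' h49 => ?_
    refine wp_curveStep (base := base) (inp := inp) (A := A₂) (len := len) (q := 4 + v)
      ((f₃.reg 0 rfl).trans b0) ((f₃.reg 5 rfl).trans b5) hw ((f₃.reg 37 rfl).trans b37)
      (by omega) hM ((f₃.reg 41 rfl).trans b41) ((f₃.reg 42 rfl).trans b42)
      ((f₃.reg 46 rfl).trans b46) (by omega) (by rw [h49]; exact Nat.mod_lt _ two_pos)
      (f₃.fmem rfl ▸ p₂) fun s₄ A₄ f₄ p₄ g₄ g₅ => ?_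
    refine ⟨?_, A₄, p₄, ?_, ?_⟩
    · have := (f₄.reg 47 rfl).trans h47'
      simpa using this
    · rw [g₄, h49]
      exact g₂
    · intro i' h1 h2
      rw [g₅ i' h1 h2, g₃ i' h1 h2]
  · rintro s' f ⟨-, A', p', g', g''⟩
    rw [a35, Nat.sub_self] at g'
    exact ⟨A', p', g', g''⟩

theorem wp_gens {S r : ℕ} {inn : ℕ → ℕ} {B : ℕ → ℕ → ℕ}
    (h0 : s.reg 0 = 0) (h2 : s.reg 2 = n) (h5 : s.reg 5 = w) (h10 : s.reg 10 = S)
    (h11 : s.reg 11 = S + n) (h34 : s.reg 34 = 2 ^ r) (h35 : s.reg 35 = r) (h37 : s.reg 37 = len)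
    (h17 : s.reg 17 = base) (hG : Grid S n inn B s.mem) (hw : w ≤ len) (hM : len ≤ M)
    (hr : r ≤ M) (hn : n ≤ M) (hpos : ∀ v < n, B 0 v < 2 ^ r) (hexpo : ∀ v < n, B 1 v < len)
    (h : PolyMem base len inp A s.fmem)
    (hQ : ∀ s' A', Frame gens s s' → GenRegs n S base len w r s'.reg →
      PolyMem base len inp A' s'.fmem →
      (∀ v < n, A' (4 + v) = gen Polynomial.X w r (B 0 v) (Polynomial.X ^ B 1 v)) →
      A' 3 = A 3 → Q s') : wp M gens Q s := by
  refine wp_conseq (p := gens) (Q := fun s' => GenRegs n S base len w r s'.reg ∧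
    ∃ A', PolyMem base len inp A' s'.fmem ∧
      (∀ v < n, A' (4 + v) = gen Polynomial.X w r (B 0 v) (Polynomial.X ^ B 1 v)) ∧ A' 3 = A 3)
      ?_ fun s' f ⟨h1, A', h2, h3, h4⟩ => hQ s' A' f h1 h2 h3 h4
  refine wp_forDo (Inv := fun k s' => GenRegs n S base len w r s'.reg ∧
      s'.reg 46 = base + (4 + k) * len ∧ ∃ A', PolyMem base len inp A' s'.fmem ∧
      (∀ v < k, A' (4 + v) = gen Polynomial.X w r (B 0 v) (Polynomial.X ^ B 1 v)) ∧ A' 3 = A 3)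
      rfl rfl (by decide) (by simpa [h2] using hn) ⟨?_, ?_, A, h, by simp, rfl⟩ ?_ ?_
  · constructor <;> simp [h0, h2, h5, h10, h11, h34, h35, h37, h17] <;> omega
  · simp [h0, h37, h17]; ring
  · rintro k s₁ hk f hi ⟨hR, h46, A₁, p₁, g₁, g₂⟩
    have hk : k < n := by simpa [h2] using hk
    have hm := f.mem rfl
    simp at hm
    refine wp_genOne (v := k) hR (hm ▸ hG) hk hi hw hM hr h46 (hpos k hk) (hexpo k hk) p₁
      fun s₂ A₂ f₂ p₂ g₃ g₄ => ?_
    have hR₂ := hR.of_frame f₂ (by decide)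
    have e46 := (f₂.reg 46 rfl).trans h46
    refine ⟨?_, ?_, A₂, p₂, ?_, ?_⟩
    · obtain ⟨h1, h2, h3, h4, h5, h6, h7, h8, h9, h10, h11, h12, h13⟩ := hR₂
      constructor <;> simpa
    · simp [e46, hR₂.r37]; ring
    · intro v hv
      rcases Nat.lt_succ_iff_lt_or_eq.1 hv with hv | rfl
      · rw [g₄ _ (by omega) (by omega), g₁ v hv]
      · exact g₃
    · rw [g₄ 3 (by omega) (by omega), g₂]
  · rintro s' f ⟨hR, -, A', p', g', g''⟩
    exact ⟨hR, A', p', by simpa [h2] using g', g''⟩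

end
end RamProgram

@[to_additive]
theorem Fin.prod_filter_lt_succ {β : Type*} [CommMonoid β] {m : ℕ} (f : Fin m → β) (k : Fin m) :
    ∏ i with i.val < k.val + 1, f i = (∏ i with i.val < k.val, f i) * f k := by
  have : (Finset.univ.filter fun i : Fin m => i.val < k.val + 1) =
      insert k (Finset.univ.filter fun i : Fin m => i.val < k.val) := by
    ext i
    simp only [Finset.mem_filter, Finset.mem_univ, true_and, Finset.mem_insert, Fin.ext_iff]
    omega
  rw [this, Finset.prod_insert (by simp), mul_comm]

@[to_additive]
theorem Fin.prod_filter_lt_bot {β : Type*} [CommMonoid β] {m : ℕ} (f : Fin m → β) :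
    ∏ i with i.val < 0, f i = 1 := by
  simp

@[to_additive]
theorem Fin.prod_filter_lt_self {β : Type*} [CommMonoid β] {m : ℕ} (f : Fin m → β) :
    ∏ i with i.val < m, f i = ∏ i, f i := by
  rw [Finset.filter_true_of_mem fun i _ => i.2]

namespace RamProgram
open DepthThreeCircuit

def evalScalar : RamProgram := set 58 0 ;; add 51 42 0 ;; polyMono

def evalConst : RamProgram := set 58 0 ;; add 51 43 0 ;; polyMono ;; add 46 45 0

def evalCoeff : RamProgram := add 51 43 0 ;; add 52 46 0 ;; polyAxpy ;; add 46 46 37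

def evalFactor : RamProgram := add 52 43 0 ;; polyMul

def evalGate : RamProgram := fone 1 ;; add 51 44 0 ;; add 52 42 0 ;; polyAxpy

/-- Evaluate the circuits at the generators. -/
def eval : RamProgram := walk skip evalScalar evalConst evalCoeff evalFactor evalGate skip

/-- Set `reg 0` to `1` unless the polynomial at `reg 44` is zero. -/
def zeroTest : RamProgram := forDo 53 37 (add 55 44 53 ;; fload 1 55 ;; fifz 1 skip (set 0 1))

section
variable {F : Type*} [Field F] {n c : ℕ} {M base len : ℕ} {inp : ℕ → F} {s : RamState F}
  {Q : RamState F → Prop}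

/-- The value of a gate. -/
noncomputable def gateValue (C : Fin c → DepthThreeCircuit F n) (η : Fin n → Polynomial F)
    (l : Fin c) (i : Fin (C l).topFanin) : Polynomial F :=
  algebraMap F _ ((C l).scalar i) * ∏ j, ((C l).factor i j).value η

/-- The generators are in memory, and the accumulator contains `acc`. -/
def EvalState (base len : ℕ) (inp : ℕ → F) (m : ℕ → ℕ) (η : Fin n → Polynomial F)
    (acc : Polynomial F) (A : ℕ → Polynomial F) (s : RamState F) : Prop :=
  s.mem = m ∧ PolyMem base len inp A s.fmem ∧ (∀ v : Fin n, A (4 + v) = η v) ∧ A 3 = acc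

theorem EvalState.update {m : ℕ → ℕ} {η : Fin n → Polynomial F} {acc : Polynomial F}
    {A : ℕ → Polynomial F} {s s' : RamState F} (h : EvalState base len inp m η acc A s)
    (hm : s'.mem = s.mem) {q : ℕ} (hq : q < 3) {P : Polynomial F}
    (hp : PolyMem base len inp (Function.update A q P) s'.fmem) :
    EvalState base len inp m η acc (Function.update A q P) s' :=
  ⟨hm.trans h.1, hp, fun v => by rw [Function.update_of_ne (by omega)]; exact h.2.2.1 v,
    by rw [Function.update_of_ne (by omega)]; exact h.2.2.2⟩

theorem wp_eval (C : Fin c → DepthThreeCircuit F n) {S w r : ℕ} (η : Fin n → Polynomial F)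
    {A : ℕ → Polynomial F}
    (hR : GenRegs n S base len w r s.reg) (h3 : s.reg 3 = c) (h6 : s.reg 6 = 1)
    (hMn : n ≤ M) (hMc : c ≤ M) (hMt : ∀ l, (C l).topFanin ≤ M) (hMf : ∀ l i, (C l).fanin i ≤ M)
    (hM : len ≤ M) (hlen : 0 < len)
    (hmem : ∀ a < (shapeCode C).length, s.mem a = (shapeCode C).getD a 0)
    (hbase : base = (fieldCode C).length)
    (h : PolyMem base len (inputState C).fmem A s.fmem) (hA : ∀ v : Fin n, A (4 + v) = η v)
    (hA3 : A 3 = 0)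
    (hQ : ∀ s' A', Frame eval s s' → PolyMem base len (inputState C).fmem A' s'.fmem →
      A' 3 = ∑ l, ∑ i, gateValue C η l i → Q s') : wp M eval Q s := by
  set inp := (inputState C).fmem with hinp
  set m := s.mem with hm
  refine wp_conseq (p := eval) (Q := fun s' => ∃ A', PolyMem base len inp A' s'.fmem ∧
      A' 3 = ∑ l, ∑ i, gateValue C η l i) ?_ fun s' f ⟨A', h1, h2⟩ => hQ s' A' f h1 h2
  let accC : ℕ → Polynomial F := fun k => ∑ l with l.val < k, ∑ i, gateValue C η l i
  let accG : Fin c → ℕ → Polynomial F := fun l k => accC l + ∑ i with i.val < k, gateValue C η l i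
  let E : Polynomial F → (ℕ → Polynomial F) → RamState F → Prop := EvalState base len inp m η
  have hin : ∀ acc A s', E acc A s' → InputOK C s' := by
    rintro acc A s' ⟨h1, h2, -⟩
    refine ⟨fun a ha => by rw [h1]; exact hmem a ha, fun a ha => ?_⟩
    exact h2.1 a (hbase ▸ ha)
  refine wp_walk C
    (IC := fun k s' => ∃ A, E (accC k) A s')
    (IG := fun l k s' => ∃ A, E (accG l k) A s')
    (IF := fun l i k s' => ∃ A, E (accG l i) A s' ∧ A 1 = algebraMap F _ ((C l).scalar i) *
      ∏ j with j.val < k, ((C l).factor i j).value η)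
    (IV := fun l i j k s' => ∃ A, E (accG l i) A s' ∧ A 1 = algebraMap F _ ((C l).scalar i) *
      (∏ j' with j'.val < j.val, ((C l).factor i j').value η) ∧
      A 2 = algebraMap F _ ((C l).factor i j).const +
        ∑ v with v.val < k, algebraMap F _ (((C l).factor i j).coeff v) * η v ∧
      s'.reg 46 = base + (4 + k) * len)
    (by decide) hR.r2 h3 h6 hMn hMc hMt hMf
    ?_ ?_ ?_ ?_ ?_ ?_ ?_ ?_ ?_ ?_ ?_ ?_
  · rintro _ _ s' ⟨A, h⟩; exact hin _ A _ h
  · rintro _ _ _ s' ⟨A, h, -⟩; exact hin _ A _ h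
  · rintro _ _ _ _ s' ⟨A, h, -⟩; exact hin _ A _ h
  · refine ⟨A, rfl, h, hA, ?_⟩
    rw [hA3]
    exact (Fin.sum_filter_lt_bot _).symm
  · rintro l s' hK ⟨A, h⟩
    refine ⟨A, ?_⟩
    have : accG l 0 = accC l := by simp only [accG, Fin.sum_filter_lt_bot, add_zero]
    rw [this]
    exact h
  · rintro l i s' hK hx ⟨A, h⟩
    have e0 := (hK 0 rfl).trans hR.r0
    have e37 := (hK 37 rfl).trans hR.r37
    have e42 := (hK 42 rfl).trans hR.r42
    refine wp_polyMono (base := base) (inp := inp) (A := A) (len := len) (q := 1)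
      (by simpa using e37) hM (by simp [e42, e0]) (by simpa using hlen) h.2.1 fun s'' f hp => ?_
    refine ⟨_, h.update (f.mem rfl) (by decide) hp, ?_⟩
    rw [Function.update_self, Fin.prod_filter_lt_bot, mul_one]
    simp [hx]
  · rintro l i j s' hK hx ⟨A, h, h1⟩
    have e0 := (hK 0 rfl).trans hR.r0
    have e37 := (hK 37 rfl).trans hR.r37
    have e43 := (hK 43 rfl).trans hR.r43
    refine wp_polyMono (base := base) (inp := inp) (A := A) (len := len) (q := 2)
      (by simpa using e37) hM (by simp [e43, e0]) (by simpa using hlen) h.2.1 fun s'' f hp => ?_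
    refine ⟨_, h.update (s' := mask _) (f.mem rfl) (by decide) hp, ?_, ?_, ?_⟩
    · rw [Function.update_of_ne (by decide), h1]
    · rw [Function.update_self, Fin.sum_filter_lt_bot, add_zero]
      simp [hx]
    · have a0 := f.reg 0 rfl
      have a45 := f.reg 45 rfl
      simp [e0, (hK 45 rfl).trans hR.r45] at a0 a45
      rw [mask_reg _ (by decide)]
      simp [a0, a45]
  · rintro l i j v s' hK - hx ⟨A, h, h1, h2, h46⟩
    have e0 := (hK 0 rfl).trans hR.r0
    have e37 := (hK 37 rfl).trans hR.r37
    have e43 := (hK 43 rfl).trans hR.r43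
    rw [mask_reg _ (by decide)] at h46
    refine wp_polyAxpy (base := base) (inp := inp) (A := A) (len := len) (q := 2) (q' := 4 + v)
      (by simpa using e37) hM (by simp [e43, e0]) (by simp [h46, e0]) (by omega) h.2.1
      fun s'' f hp => ?_
    refine ⟨_, h.update (s' := mask _) (f.mem rfl) (by decide) hp, ?_, ?_, ?_⟩
    · rw [Function.update_of_ne (by decide), h1]
    · rw [Function.update_self, Fin.sum_filter_lt_succ, h2, h.2.2.1 v]
      simp [hx, add_assoc]
    · have a37 := f.reg 37 rfl
      have a46 := f.reg 46 rfl
      simp [e37, h46] at a37 a46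
      rw [mask_reg _ (by decide)]
      simp [a37, a46]
      ring
  · rintro l i j s' hK ⟨A, h, h1, h2, -⟩
    have e0 := (hK 0 rfl).trans hR.r0
    have e37 := (hK 37 rfl).trans hR.r37
    have e41 := (hK 41 rfl).trans hR.r41
    have e42 := (hK 42 rfl).trans hR.r42
    have e43 := (hK 43 rfl).trans hR.r43
    refine wp_polyMul (base := base) (inp := inp) (A := A) (len := len) (q := 2)
      (by simpa using e37) hM (by simpa using e41) (by simpa using e42) (by simp [e43, e0])
      (by decide) h.2.1 fun s'' W f hp => ?_
    have hm' : s''.mem = s'.mem := f.mem rfl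
    have : E (accG l i) (Function.update (Function.update A 0 W) 1 (A 1 * A 2)) (mask s'') := by
      refine ⟨hm'.trans h.1, hp, fun v => ?_, ?_⟩
      · rw [Function.update_of_ne (by omega), Function.update_of_ne (by omega)]
        exact h.2.2.1 v
      · rw [Function.update_of_ne (by omega), Function.update_of_ne (by omega)]
        exact h.2.2.2
    refine ⟨_, this, ?_⟩
    rw [Function.update_self, Fin.prod_filter_lt_succ, h1, h2, Fin.sum_filter_lt_self, mul_assoc]
    rfl
  · rintro l i s' hK ⟨A, h, h1⟩
    have e0 := (hK 0 rfl).trans hR.r0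
    have e37 := (hK 37 rfl).trans hR.r37
    have e42 := (hK 42 rfl).trans hR.r42
    have e44 := (hK 44 rfl).trans hR.r44
    refine wp_polyAxpy (base := base) (inp := inp) (A := A) (len := len) (q := 3) (q' := 1)
      (by simpa using e37) hM (by simp [e44, e0]) (by simp [e42, e0]) (by decide) h.2.1
      fun s'' f hp => ?_
    have hm' : s''.mem = s'.mem := f.mem rfl
    refine ⟨_, hm'.trans h.1, hp, fun v => ?_, ?_⟩
    · rw [Function.update_of_ne (by omega)]
      exact h.2.2.1 v
    · rw [Function.update_self, h.2.2.2, h1, Fin.prod_filter_lt_self]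
      simp only [accG]
      rw [Fin.sum_filter_lt_succ, ← add_assoc]
      simp [gateValue]
  · rintro l s' hK ⟨A, h⟩
    refine ⟨A, ?_⟩
    have : accC (l + 1) = accG l (C l).topFanin := by
      simp only [accG, accC, Fin.sum_filter_lt_succ, Fin.sum_filter_lt_self]
    rw [this]
    exact h
  · rintro s' f - ⟨A, h⟩
    refine ⟨A, h.2.1, ?_⟩
    rw [h.2.2.2]
    exact Fin.sum_filter_lt_self _

theorem wp_zeroTest {A : ℕ → Polynomial F} (h0 : s.reg 0 = 0) (h37 : s.reg 37 = len)
    (hM : len ≤ M) (h44 : s.reg 44 = base + 3 * len) (h : PolyMem base len inp A s.fmem)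
    (hdeg : (A 3).natDegree < len) (hQ : ∀ s' : RamState F, (s'.reg 0 = 0 ↔ A 3 = 0) → Q s') :
    wp M zeroTest Q s := by
  refine wp_forDo (Inv := fun k s' => s'.reg 0 = 0 ↔ ∀ e < k, (A 3).coeff e = 0)
    rfl rfl (by decide) (by rw [h37]; exact hM) (by simp [h0]) ?_ ?_
  · intro k s' hk f hi hI
    rw [h37] at hk
    have e44 := (f.reg 44 rfl).trans h44
    have em := f.fmem rfl
    have r := h.2 3 k hk
    have hsplit : (∀ e < k + 1, (A 3).coeff e = 0) ↔
        (∀ e < k, (A 3).coeff e = 0) ∧ (A 3).coeff k = 0 := by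
      constructor
      · exact fun h => ⟨fun e he => h e (by omega), h k (by omega)⟩
      · rintro ⟨h1, h2⟩ e he
        rcases Nat.lt_succ_iff_lt_or_eq.1 he with he | rfl
        · exact h1 e he
        · exact h2
    rw [hsplit]
    refine ⟨fun hz => ?_, fun hz => ?_⟩
    · simp [e44, hi, em, r] at hz
      simpa [wp, hz] using hI
    · simp [e44, hi, em, r] at hz
      simp [wp, hz]
  · intro s' f hI
    rw [h37] at hI
    refine hQ s' (hI.trans ⟨fun h => ?_, fun h => by simp [h]⟩)
    ext e
    rw [Polynomial.coeff_zero]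
    by_cases he : e < len
    · exact h e he
    · exact Polynomial.coeff_eq_zero_of_natDegree_lt (by omega)

end
end RamProgram

/-! The whole program -/

namespace DepthThreeCircuit
variable {F : Type*} [Field F] {n c : ℕ}

theorem IsSetMultilinear.exists_part {C : DepthThreeCircuit F n} (h : C.IsSetMultilinear) :
    ∃ part : Fin n → Finset (Fin n), (∀ i, C.fanin i ≤ n) ∧
      ∀ i j j' v v', (C.factor i j).coeff v ≠ 0 → (C.factor i j').coeff v' ≠ 0 →
        (part v = part v' ↔ j = j') := by
  obtain ⟨P, hP⟩ := h
  refine ⟨P.part, fun i => ?_, fun i j j' v v' hv hv' => ?_⟩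
  · obtain ⟨color, hinj, hmem, -⟩ := hP i
    have h1 := Fintype.card_le_of_injective (fun j => (⟨color j, hmem j⟩ : P.parts))
      fun j j' h => hinj (congrArg Subtype.val h)
    have h2 := P.card_parts_le_card
    simp at h1 h2
    exact h1.trans h2
  · obtain ⟨color, hinj, hmem, hcol⟩ := hP i
    rw [P.part_eq_of_mem (hmem j) (hcol j v hv), P.part_eq_of_mem (hmem j') (hcol j' v' hv')]
    exact hinj.eq_iff

/-- The sum of the circuits. -/
def gateSum {F : Type*} (C : Fin c → DepthThreeCircuit F n) : GateSum F n where
  ι := Σ l, Fin (C l).topFanin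
  scalar := fun i => (C i.1).scalar i.2
  fanin := fun i => (C i.1).fanin i.2
  factor := fun i => (C i.1).factor i.2

theorem gateSum_value (C : Fin c → DepthThreeCircuit F n) (η : Fin n → Polynomial F) :
    (gateSum C).value η = ∑ l, ∑ i, RamProgram.gateValue C η l i :=
  Fintype.sum_sigma _

theorem gateSum_value_X (C : Fin c → DepthThreeCircuit F n) :
    (gateSum C).value (MvPolynomial.X : Fin n → MvPolynomial (Fin n) F) = ∑ l, (C l).toPoly :=
  Fintype.sum_sigma _

theorem card_gateSum {F : Type*} (C : Fin c → DepthThreeCircuit F n) :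
    Fintype.card (gateSum C).ι = ∑ l, (C l).topFanin := by
  change Fintype.card (Σ l, Fin (C l).topFanin) = _
  simp

theorem length_shapeCode {F : Type*} (C : Fin c → DepthThreeCircuit F n) :
    (shapeCode C).length = 2 + c + ∑ l, (C l).topFanin := by
  simp [shapeCode, List.length_flatten, List.sum_ofFn, Function.comp_def, Finset.sum_add_distrib]
  ring

end DepthThreeCircuit

namespace RamProgram
open DepthThreeCircuit

section
variable {F : Type*} [Field F] {n c : ℕ}

theorem separated_of_blocked {N D u : ℕ} {C : Fin (N + 1) → DepthThreeCircuit F n}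
    {part : Fin (N + 1) → Fin n → Finset (Fin n)}
    (hpart : ∀ l i j j' v v', ((C l).factor i j).coeff v ≠ 0 → ((C l).factor i j').coeff v' ≠ 0 →
      (part l v = part l v' ↔ j = j')) {B : ℕ → ℕ → ℕ} (hB : Colored C part (N + 1) B)
    {expo blk : ℕ → ℕ} (hbl : Blocked n N D u (fun l => B (4 + l)) expo blk)
    (hexpo : ∀ v < n, expo v ≠ 0) (b : ℕ) :
    (gateSum C).Separated (fun v => rank n (B (4 + N)) v) {v | blk v = b} := by
  rintro ⟨l, i⟩ j j' v hv x hx v' hv' x' hx' h1 h2 h3 - hjv hjx hjv' hjx'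
  obtain ⟨hs, hm⟩ := hB l l.2
  refine (hpart l i j j' v v' hjv hjv').1 (hs v v' ?_)
  have m1 := hm i j v x hjv hjx
  have m2 := hm i j' v' x' hjv' hjx'
  have hne : (v : ℕ) ≠ x := fun h => by simp only at h1; rw [h] at h1; exact lt_irrefl _ h1
  rcases Nat.lt_succ_iff_lt_or_eq.1 l.2 with hl | hl
  · rcases hbl.plain l hl b with hp | hp
    · exact hp v v.2 v' v'.2 ⟨hexpo v v.2, hv⟩ ⟨hexpo v' v'.2, hv'⟩
    · exact absurd (hp v v.2 x x.2 ⟨hexpo v v.2, hv⟩ ⟨hexpo x x.2, hx⟩ m1) hne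
  · have b1 := before_of_rank_lt x.2 h2
    have b2 := before_of_rank_lt x'.2 h3
    rw [← hl] at b1 b2
    unfold Before at b1 b2
    omega

/-- Decide whether the sum of the circuits is zero; the answer is in register `0`. -/
def identityTest : RamProgram :=
  header ;; colors ;; positions ;; depth ;; degrees ;; blocks ;; gens ;; eval ;; zeroTest

theorem Header.of_frame {F : Type*} {S : ℕ} {p : RamProgram} {s s' : RamState F}
    (h : Header n c S s.reg) (f : Frame p s s')
    (hp : ∀ i ∈ [0, 2, 3, 4, 5, 6, 10, 11, 12, 13, 14], p.wr i = false) : Header n c S s'.reg := by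
  have key : ∀ i ∈ [0, 2, 3, 4, 5, 6, 10, 11, 12, 13, 14], s'.reg i = s.reg i :=
    fun i hi => f.reg i (hp i hi)
  obtain ⟨h1, h2, h3, h4, h5, h6, h7, h8, h9, h10, h11⟩ := h
  constructor <;> rw [key _ (by decide)] <;> assumption

theorem wp_identityTest {F : Type u} [Field F] {N w r D K M : ℕ}
    (C : Fin (N + 1) → DepthThreeCircuit F n)
    (hC : ∀ l, (C l).IsSetMultilinear) (hn : 2 ≤ n)
    (hw : w = (shapeCode C).length + (shapeCode C).length) (hr : r = Nat.clog 2 n)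
    (hD : D = n * (curveDegree w)^[r] 1 + 1)
    (φ : ℕ → ℝ) (hφ : ∀ r x, 1 ≤ x → x ≤ r → r ≤ x ^ 2 ^ N → φ (r - x) + 1 ≤ φ r)
    (hφ0 : 0 ≤ φ 0) (hK : φ n < K + 1) (hM : M = D ^ (K + 1)) :
    wp M identityTest (fun s' => s'.reg 0 = 0 ↔ ∑ l, (C l).toPoly = 0) (inputState C) := by
  have hlen := length_shapeCode C
  have hr1 : 1 ≤ r := by
    rw [hr]; exact Nat.clog_pos one_lt_two hn
  have hrn : r ≤ n := by
    rw [hr]; exact Nat.clog_le_of_le_pow (Nat.lt_two_pow_self).le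
  have hcurve : w ≤ (curveDegree w)^[r] 1 ∧ 1 ≤ (curveDegree w)^[r] 1 := by
    obtain ⟨r', rfl⟩ : ∃ r', r = r' + 1 := ⟨r - 1, by omega⟩
    rw [Function.iterate_succ_apply', curveDegree]
    exact ⟨by nlinarith, Nat.mul_pos (by omega) (by omega)⟩
  have hDn : n < D := by rw [hD]; nlinarith
  have hDw : w < D := by rw [hD]; nlinarith
  have hDM : D ≤ M := by rw [hM]; exact Nat.le_self_pow (by omega) D
  have hMn : n ≤ M := by omega
  have hsum : ∀ l, (C l).topFanin ≤ ∑ l, (C l).topFanin := fun l =>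
    Finset.single_le_sum (f := fun l => (C l).topFanin) (fun _ _ => Nat.zero_le _)
      (Finset.mem_univ l)
  have hMt : ∀ l, (C l).topFanin ≤ M := fun l => by have := hsum l; omega
  choose part hfan hpart using fun l => (hC l).exists_part
  have hMf : ∀ l i, (C l).fanin i ≤ M := fun l i => (hfan l i).trans hMn
  have hMc : N + 1 ≤ M := by omega
  refine wp_header C hMc fun s₁ f₁ h₁ => ?_
  refine wp_colors C part (fun l i j v v' hv hv' => (hpart l i j j v v' hv hv').2 rfl) h₁ hMn hMc
    hMt hMf (f₁.mem rfl) (f₁.fmem rfl) fun s₂ B f₂ hG₂ hB hB1 h17 h15 => ?_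
  have h₂ := h₁.of_frame f₂ (by decide)
  refine wp_positions (n := n) (q := 4 + N) h₂.r2 h₂.r6 hMn h₂.r10
    (by rw [h15]; ring) (by omega) hG₂ fun s₃ f₃ hG₃ => ?_
  have h₃ := h₂.of_frame f₃ (by decide)
  refine wp_depth h₃.r2 h₃.r6 hMn fun s₄ f₄ h34 h35 => ?_
  have h₄ := h₃.of_frame f₄ (by decide)
  refine wp_degrees h₄.r2 h₄.r0 h₄.r5 h35 hMn (by omega) (by omega) fun s₅ f₅ h38 => ?_
  have h₅ := h₄.of_frame f₅ (by decide)
  rw [← hw, ← hr, ← hD] at h38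
  have hG₅ := hG₃
  rw [← f₄.mem rfl, ← f₅.mem rfl] at hG₅
  refine wp_blocks (n := n) (N := N) (D := D) φ hφ h₅.r0 h₅.r2 h₅.r3 h₅.r6 hMn h₅.r11 h₅.r12 h₅.r13
    h₅.r14 (by omega) h38 (by omega) hDM hG₅
    (fun v => by rw [Function.update_of_ne (by decide)]; exact hB1 v)
    fun s₆ B₆ u blk f₆ hG₆ hB₆ h37 hbl hexpo hu => ?_
  have h₆ := h₅.of_frame f₆ (by decide)
  have hbl' : Blocked n N D u (fun l => B (4 + l)) (B₆ 1) blk := by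
    convert hbl using 2 with l
    rw [Function.update_of_ne (by omega)]
  rw [Function.update_self] at hB₆
  have huK : u ≤ K := by
    have : (u : ℝ) < K + 1 := by linarith
    exact Nat.lt_succ_iff.1 (by exact_mod_cast this)
  have hLM : D ^ (u + 1) ≤ M := by rw [hM]; exact Nat.pow_le_pow_right (by omega) (by omega)
  have hwL : w ≤ D ^ (u + 1) := hDw.le.trans (Nat.le_self_pow (by omega) D)
  have hfm : PolyMem (fieldCode C).length (D ^ (u + 1)) (inputState C).fmem (fun _ => 0) s₆.fmem := by
    rw [f₆.fmem rfl, f₅.fmem rfl, f₄.fmem rfl, f₃.fmem rfl, f₂.fmem rfl, f₁.fmem rfl]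
    refine ⟨fun _ _ => rfl, fun q e _ => ?_⟩
    exact List.getD_eq_default _ _ (by omega)
  refine wp_gens (n := n) (r := r) (w := w) h₆.r0 h₆.r2 (h₆.r5.trans hw.symm) h₆.r10 h₆.r11
    (by rw [f₆.reg 34 rfl, f₅.reg 34 rfl, h34, hr]) (by rw [f₆.reg 35 rfl, f₅.reg 35 rfl, h35, hr])
    h37 (by rw [f₆.reg 17 rfl, f₅.reg 17 rfl, f₄.reg 17 rfl, f₃.reg 17 rfl, h17]) hG₆ hwL hLM
    (by omega) hMn ?_ ?_ hfm fun s₇ A₇ f₇ hR₇ hp₇ hA₇ hA3 => ?_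
  · intro v hv
    rw [hB₆, hr]
    exact (rank_lt hv).trans_le (Nat.le_pow_clog one_lt_two n)
  · intro v hv
    have := hbl.expo_eq v hv (hexpo v hv)
    rw [this.1]
    exact Nat.pow_lt_pow_right (by omega) (by omega)
  refine wp_eval C (substitution F w r D (fun v => rank n (B (4 + N)) v) fun v => blk v) hR₇
    ((f₇.reg 3 rfl).trans h₆.r3) ((f₇.reg 6 rfl).trans h₆.r6) hMn hMc hMt hMf hLM (Nat.pow_pos (by omega))
    ?_ rfl hp₇ ?_ hA3 fun s₈ A₈ f₈ hp₈ hA₈ => ?_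
  · intro a ha
    rw [f₇.mem rfl]
    exact hG₆.1 a ha
  · intro v
    rw [hA₇ v v.2, hB₆, (hbl.expo_eq v v.2 (hexpo v v.2)).1]
    rfl
  have hR₈ := hR₇.of_frame f₈ (by decide)
  obtain ⟨hz, hdeg⟩ := (gateSum C).substitution_spec (w := w) (r := r) (D := D) (u := u)
    (by rw [card_gateSum]; omega) (rank_injective (B (4 + N)))
    (fun v => by rw [hr]; exact (rank_lt v.2).trans_le (Nat.le_pow_clog one_lt_two n))
    (blk := fun v => blk v) (fun v => (hbl.expo_eq v v.2 (hexpo v v.2)).2)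
    (separated_of_blocked hpart hB hbl' hexpo) (fun i => hfan i.1 i.2) (by omega)
  rw [gateSum_value, ← hA₈] at hz hdeg
  rw [gateSum_value_X] at hz
  exact wp_zeroTest hR₈.r0 hR₈.r37 hLM hR₈.r44 hp₈ hdeg fun s₉ h₉ => h₉.trans hz

end
end RamProgram

/-! Bounds -/

/-- A bound for the number of blocks needed for `r` variables. -/
noncomputable def blockBound (θ : ℝ) (r : ℕ) : ℝ := if r = 0 then 0 else 2 * (r : ℝ) ^ θ

theorem blockBound_le {N : ℕ} {θ : ℝ} (hθ : θ = 1 - 1 / 2 ^ N) (r x : ℕ) (hx : 1 ≤ x) (hxr : x ≤ r)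
    (hrx : r ≤ x ^ 2 ^ N) : blockBound θ (r - x) + 1 ≤ blockBound θ r := by
  have hinv : 1 / (2 : ℝ) ^ N ≤ 1 := by
    rw [div_le_one (by positivity)]; exact one_le_pow₀ one_le_two
  have hinv0 : 0 < 1 / (2 : ℝ) ^ N := by positivity
  have hθ0 : 0 ≤ θ := by linarith
  have hr0 : r ≠ 0 := by omega
  have hr1 : (1 : ℝ) ≤ r := by exact_mod_cast hx.trans hxr
  rcases hxr.eq_or_lt with rfl | hlt
  · have := Real.one_le_rpow hr1 hθ0
    simp [blockBound, hr0]
    linarith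
  · have hN : N ≠ 0 := by
      rintro rfl
      simp at hrx
      omega
    have hθ2 : 1 / 2 ≤ θ := by
      have : 1 / (2 : ℝ) ^ N ≤ 1 / 2 :=
        one_div_le_one_div_of_le two_pos (le_self_pow₀ one_le_two hN)
      linarith
    have hrx0 : r - x ≠ 0 := by omega
    have hxr' : (x : ℝ) ≤ r := by exact_mod_cast hxr
    have hroot : (r : ℝ) ^ (1 / (2 : ℝ) ^ N) ≤ x := by
      have h1 : (r : ℝ) ≤ (x : ℝ) ^ (2 ^ N : ℕ) := by exact_mod_cast hrx
      calc (r : ℝ) ^ (1 / (2 : ℝ) ^ N) ≤ ((x : ℝ) ^ (2 ^ N : ℕ)) ^ (1 / (2 : ℝ) ^ N) :=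
            Real.rpow_le_rpow (by linarith) h1 hinv0.le
        _ = x := by
            rw [← Real.rpow_natCast, ← Real.rpow_mul (by positivity)]
            have : ((2 ^ N : ℕ) : ℝ) * (1 / 2 ^ N) = 1 := by
              push_cast; field_simp
            rw [this, Real.rpow_one]
    have hsplit : (r : ℝ) ^ θ * (r : ℝ) ^ (1 / (2 : ℝ) ^ N) = r := by
      rw [← Real.rpow_add (by linarith), hθ, sub_add_cancel, Real.rpow_one]
    have hbern : ((r - x : ℕ) : ℝ) ^ θ ≤ (r : ℝ) ^ θ * (1 + θ * (-(x / r))) := by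
      have h1 : ((r - x : ℕ) : ℝ) = r * (1 + -(x / r)) := by
        rw [Nat.cast_sub hxr]; field_simp; ring
      have h2 : -1 ≤ -((x : ℝ) / r) := neg_le_neg ((div_le_one (by linarith)).2 hxr')
      rw [h1, Real.mul_rpow (by linarith) (by linarith)]
      exact mul_le_mul_of_nonneg_left (rpow_one_add_le_one_add_mul_self h2 hθ0 (by linarith))
        (by positivity)
    have hpos : 0 < (r : ℝ) ^ θ := by positivity
    have hkey : 1 ≤ (r : ℝ) ^ θ * (x / r) := by
      rw [← mul_div_assoc, one_le_div (by linarith)]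
      calc (r : ℝ) = (r : ℝ) ^ θ * (r : ℝ) ^ (1 / (2 : ℝ) ^ N) := hsplit.symm
        _ ≤ (r : ℝ) ^ θ * x := mul_le_mul_of_nonneg_left hroot hpos.le
    simp only [blockBound, hrx0, hr0, if_false]
    nlinarith

theorem iterate_curveDegree_add_le (w r : ℕ) : (curveDegree w)^[r] 1 + w ≤ (w + 2) ^ (r + 1) := by
  induction r with
  | zero => simp; omega
  | succ r ih =>
    rw [Function.iterate_succ_apply', curveDegree, pow_succ]
    have h1 : w ≤ (w + 2) ^ (r + 1) := by
      calc w ≤ w + 2 := by omega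
        _ ≤ (w + 2) ^ (r + 1) := Nat.le_self_pow (by omega) _
    nlinarith

theorem log_half : (1 : ℝ) / 2 ≤ Real.log 2 := by
  have := Real.log_two_gt_d9; linarith

/-- The size of the degrees, in terms of `n` and `λ = 2 ^ N * log k`. -/
theorem log_degree_le {n N k w r D t : ℕ} (hn : 2 ≤ n) (hk : 2 ≤ k) (ht : t ≤ (N + 1) * k)
    (hw : w = (2 + (N + 1) + t) + (2 + (N + 1) + t)) (hr : r = Nat.clog 2 n)
    (hD : D = n * (curveDegree w)^[r] 1 + 1) :
    Real.log D ≤ 34 * Real.log n * (2 ^ N * Real.log k) := by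
  have hl2 := log_half
  have hn' : (2 : ℝ) ≤ n := by exact_mod_cast hn
  have hk' : (2 : ℝ) ≤ k := by exact_mod_cast hk
  have hln : Real.log 2 ≤ Real.log n := Real.log_le_log two_pos hn'
  have hlk : Real.log 2 ≤ Real.log k := Real.log_le_log two_pos hk'
  have h2N : (1 : ℝ) ≤ 2 ^ N := one_le_pow₀ one_le_two
  have hlam : Real.log k ≤ 2 ^ N * Real.log k := le_mul_of_one_le_left (by linarith) h2N
  -- the number of rows
  have hw2 : Real.log (w + 2 : ℕ) ≤ 5 * (2 ^ N * Real.log k) := by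
    have h1 : w + 2 ≤ 2 ^ 3 * 2 ^ N * k := by
      have h3 : N + 1 ≤ 2 ^ N := Nat.lt_two_pow_self
      have h4 : (N + 1) * k ≤ 2 ^ N * k := Nat.mul_le_mul_right k h3
      have h5 : 1 ≤ 2 ^ N := Nat.one_le_two_pow
      nlinarith
    have h2 : ((w + 2 : ℕ) : ℝ) ≤ 2 ^ 3 * 2 ^ N * k := by exact_mod_cast h1
    have h3 := Real.log_le_log (by positivity) h2
    rw [Real.log_mul (by positivity) (by positivity), Real.log_mul (by positivity) (by positivity),
      Real.log_pow, Real.log_pow] at h3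
    have h4 : (N : ℝ) * Real.log 2 ≤ 2 ^ N * Real.log k := by
      refine mul_le_mul ?_ hlk (by linarith) (by positivity)
      exact_mod_cast (Nat.lt_two_pow_self (n := N)).le
    push_cast at h3
    push_cast
    linarith
  -- the depth
  have hr6 : (r : ℝ) + 1 ≤ 6 * Real.log n := by
    have h1 : 2 ^ r ≤ 2 * n := by
      obtain ⟨r', hr'⟩ : ∃ r', r = r' + 1 :=
        ⟨r - 1, by have := Nat.clog_pos one_lt_two hn; omega⟩
      have := Nat.pow_pred_clog_lt_self one_lt_two hn
      rw [← hr, hr'] at this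
      rw [hr', pow_succ]
      simp at this
      omega
    have h2 : (2 : ℝ) ^ r ≤ 2 * n := by exact_mod_cast h1
    have h3 := Real.log_le_log (by positivity) h2
    rw [Real.log_pow, Real.log_mul (by positivity) (by positivity)] at h3
    have h4 : (r : ℝ) * (1 / 2) ≤ r * Real.log 2 := mul_le_mul_of_nonneg_left hl2 (by positivity)
    linarith
  have hn1 : Real.log (n + 1 : ℕ) ≤ 2 * Real.log n := by
    have h1 : ((n + 1 : ℕ) : ℝ) ≤ (n : ℝ) ^ 2 := by push_cast; nlinarith
    have := Real.log_le_log (by positivity) h1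
    rw [Real.log_pow] at this
    exact_mod_cast this
  have hDle : D ≤ (n + 1) * (w + 2) ^ (r + 1) := by
    have h1 := iterate_curveDegree_add_le w r
    have h2 : 1 ≤ (w + 2) ^ (r + 1) := Nat.one_le_pow _ _ (by omega)
    rw [hD]
    nlinarith
  have hDle' : (D : ℝ) ≤ ((n + 1 : ℕ) : ℝ) * ((w + 2 : ℕ) : ℝ) ^ (r + 1) := by exact_mod_cast hDle
  have hD0 : (0 : ℝ) < D := by rw [hD]; positivity
  have h1 := Real.log_le_log hD0 hDle'
  rw [Real.log_mul (by positivity) (by positivity), Real.log_pow] at h1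
  have h2 : ((r + 1 : ℕ) : ℝ) * Real.log (w + 2 : ℕ) ≤
      (6 * Real.log n) * (5 * (2 ^ N * Real.log k)) := by
    refine mul_le_mul (by push_cast; exact hr6) hw2 (Real.log_natCast_nonneg _) (by linarith)
  have h3 : Real.log n * (1 / 2) ≤ Real.log n * (2 ^ N * Real.log k) :=
    mul_le_mul_of_nonneg_left (by linarith) (by linarith)
  linarith

/-- The running time. -/
theorem time_le {n N k D K C d t : ℕ} {θ : ℝ} (hn : 2 ≤ n) (hk : 2 ≤ k) (hθ : 0 ≤ θ) (hD : 1 ≤ D)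
    (hlog : Real.log D ≤ 34 * Real.log n * (2 ^ N * Real.log k)) (hK : (K : ℝ) ≤ 2 * (n : ℝ) ^ θ)
    (ht : t ≤ C * (D ^ (K + 1)) ^ d) :
    (t : ℝ) ≤ (n : ℝ) ^ ((4 * Real.log (C + 1) + 102 * d) *
      (2 ^ N * (n : ℝ) ^ θ * Real.log k)) := by
  have hl2 := log_half
  have hn' : (2 : ℝ) ≤ n := by exact_mod_cast hn
  have hk' : (2 : ℝ) ≤ k := by exact_mod_cast hk
  have hln : 1 / 2 ≤ Real.log n := hl2.trans (Real.log_le_log two_pos hn')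
  have hlk : 1 / 2 ≤ Real.log k := hl2.trans (Real.log_le_log two_pos hk')
  have h2N : (1 : ℝ) ≤ 2 ^ N := one_le_pow₀ one_le_two
  have hlam : 1 / 2 ≤ 2 ^ N * Real.log k := hlk.trans (le_mul_of_one_le_left (by linarith) h2N)
  have hnθ : 1 ≤ (n : ℝ) ^ θ := Real.one_le_rpow (by linarith) hθ
  have hD' : (1 : ℝ) ≤ D := by exact_mod_cast hD
  have hC0 : 0 ≤ Real.log (C + 1) := Real.log_nonneg (by simp)
  have h1 : (t : ℝ) ≤ (C + 1) * ((D : ℝ) ^ (K + 1)) ^ d := by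
    have : (t : ℝ) ≤ C * ((D : ℝ) ^ (K + 1)) ^ d := by exact_mod_cast ht
    have h2 : (0 : ℝ) ≤ ((D : ℝ) ^ (K + 1)) ^ d := by positivity
    linarith
  refine h1.trans ?_
  rw [← Real.log_le_log_iff (by positivity) (by positivity), Real.log_rpow (by linarith),
    Real.log_mul (by positivity) (by positivity), Real.log_pow, Real.log_pow]
  set ℓ := Real.log n
  set lam := 2 ^ N * Real.log k with hlamdef
  set p := (n : ℝ) ^ θ
  have e : (2 : ℝ) ^ N * p * Real.log k = p * lam := by rw [hlamdef]; ring
  rw [e]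
  have hll : 1 / 4 ≤ ℓ * lam := by nlinarith
  have hpl : 1 / 4 ≤ p * (ℓ * lam) := by nlinarith
  have h3 : Real.log (C + 1) * (1 / 4) ≤ Real.log (C + 1) * (p * (ℓ * lam)) :=
    mul_le_mul_of_nonneg_left hpl hC0
  have h4 : ((K + 1 : ℕ) : ℝ) * Real.log D ≤ (3 * p) * (34 * ℓ * lam) :=
    mul_le_mul (by push_cast; linarith) hlog (Real.log_nonneg hD') (by linarith)
  have h5 : (d : ℝ) * (((K + 1 : ℕ) : ℝ) * Real.log D) ≤ d * ((3 * p) * (34 * ℓ * lam)) :=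
    mul_le_mul_of_nonneg_left h4 (by positivity)
  nlinarith

theorem mainTheorem5 :
    ∃ (p : RamProgram) (A : ℝ),
      ∀ (F : Type u) [Field F] (n c k : ℕ), 2 ≤ n → 1 ≤ c → 2 ≤ k →
      ∀ C : Fin c → DepthThreeCircuit F n,
        (∀ l, (C l).IsSetMultilinear) → (∀ l, (C l).topFanin ≤ k) →
        ∃ (s : RamState F) (t : ℕ),
          p.Runs (DepthThreeCircuit.inputState C) s t ∧
          (s.reg 0 = 0 ↔ ∑ l, (C l).toPoly = 0) ∧
          (t : ℝ) ≤ (n : ℝ) ^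
            (A * ((2 : ℝ) ^ (c - 1) * (n : ℝ) ^ (1 - 1 / (2 : ℝ) ^ (c - 1)) * Real.log k)) := by
  obtain ⟨T, d, hT⟩ := RamProgram.identityTest.exists_timeBound_le
  refine ⟨RamProgram.identityTest, 4 * Real.log (T + 1) + 102 * d, ?_⟩
  intro F _ n c k hn hc hk C hC hCk
  obtain ⟨N, rfl⟩ : ∃ N, c = N + 1 := ⟨c - 1, by omega⟩
  rw [Nat.add_sub_cancel]
  set θ : ℝ := 1 - 1 / (2 : ℝ) ^ N with hθ
  have hθ0 : 0 ≤ θ := by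
    have : 1 / (2 : ℝ) ^ N ≤ 1 := by
      rw [div_le_one (by positivity)]; exact one_le_pow₀ one_le_two
    linarith
  obtain ⟨w, hw⟩ : ∃ w, w = (DepthThreeCircuit.shapeCode C).length +
      (DepthThreeCircuit.shapeCode C).length := ⟨_, rfl⟩
  obtain ⟨r, hr⟩ : ∃ r, r = Nat.clog 2 n := ⟨_, rfl⟩
  obtain ⟨D, hD⟩ : ∃ D, D = n * (curveDegree w)^[r] 1 + 1 := ⟨_, rfl⟩
  have hbound : blockBound θ n = 2 * (n : ℝ) ^ θ := if_neg (by omega)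
  have hwp := RamProgram.wp_identityTest C hC hn hw hr hD (blockBound θ) (blockBound_le hθ)
    (by simp [blockBound]) (Nat.lt_floor_add_one (blockBound θ n)) rfl
  obtain ⟨s, t, hs, ht, hres⟩ := RamProgram.exists_runs_of_wp hwp
  refine ⟨s, t, hs, hres, ?_⟩
  rw [DepthThreeCircuit.length_shapeCode] at hw
  refine time_le (N := N) hn hk hθ0 (by omega : 1 ≤ D) (log_degree_le hn hk ?_ hw hr hD)
    (Nat.floor_le (hbound ▸ by positivity) |>.trans_eq hbound)
    (ht.trans (hT _ (Nat.one_le_pow _ _ (by omega))))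
  calc ∑ l, (C l).topFanin ≤ ∑ _l : Fin (N + 1), k := Finset.sum_le_sum fun l _ => hCk l
    _ = (N + 1) * k := by simp
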